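/- Let $F$ be a free group of finite rank $k$ with a fixed free basis $\Sigma$, and put $A=\Sigma\cup\Sigma^{-1}$. Let $\partial F$ be the set of freely reduced right-infinite words in $A$ (geodesic rays of the Cayley graph of $F$ issued from $1$), with the topology generated by the cylinders $\mathrm{Cyl}(v)$ of rays with initial segment $v\in F$. Let $\partial^2F=\{(p,q)\in(\partial F)^2: p\neq q\}$, identified with the set of oriented bi-infinite geodesics of the Cayley graph. For $x\ne y$ in $F$ let $\mathrm{Cyl}([x,y])\subset\partial^2F$ be the set of geodesics passing through the oriented segment from $x$ to $y$, and let $B\subset\partial^2F$ be the set of geodesics passing through $1$. The uniform current $\eta_A$ is the Borel measure on $\partial^2F$ with $$\eta_A(\mathrm{Cyl}([x,y]))=\frac1{2k(2k-1)^{|x^{-1}y|-1}}\qquad (x\neq y),$$ where $|\cdot|$ is the word length. Every $\Phi\in\mathrm{Aut}(F)$ extends to a homeomorphism of $\partial F$ and so acts on $\partial^2F$; the length of $\Phi$ is $L(\Phi)=\eta_A(\Phi^{-1}(B))$. An automorphism is *simple* if it is the composition of an inner automorphism with an automorphism that permutes $A$. It is a *Whitehead automorphism of the second kind* if there is $a\in\Sigma$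 such that $\tau(x)\in\{x,\,xa,\,a^{-1}x,\,a^{-1}xa\}$ for all $x\in\Sigma$. **Theorem 1.3.** Let $\Phi\in\mathrm{Aut}(F)$ be a non-simple automorphism. Then there exists a factorisation $$\Phi=\tau_n\tau_{n-1}\cdots\tau_1\sigma$$ where $n\ge1$, the automorphism $\sigma$ is simple, each $\tau_i$ is a Whitehead automorphism of the second kind, and $$L(\tau_{i-1}\cdots\tau_1\sigma)<L(\tau_i\tau_{i-1}\cdots\tau_1\sigma)\qquad\text{for } i=1,\dots,n.$$ -/

import Mathlib

namespace FreeGroupLength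

/-- The inverse of a letter of the alphabet `A = Σ ∪ Σ⁻¹`; the letter `(a, true)` is `a` and
`(a, false)` is `a⁻¹`. -/
def invLetter {α : Type*} (c : α × Bool) : α × Bool := (c.1, !c.2)

/-- The boundary at infinity `∂F` of the free group `F` on `α`: freely reduced right-infinite
words in the alphabet `A`. -/
@[ext]
structure Boundary (α : Type*) where
  letter : ℕ → α × Bool
  reduced : ∀ n, letter (n + 1) ≠ invLetter (letter n)

namespace Boundary

variable {α : Type*}

/-- The initial segment of length `n` of a ray, as a word. -/
def word (x : Boundary α) (n : ℕ) : List (α × Bool) := (List.range n).map x.letter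

/-- The vertex of the Cayley graph which the ray `x` (issued from `1`) visits at time `n`. -/
def pre (x : Boundary α) (n : ℕ) : FreeGroup α := FreeGroup.mk (x.word n)

@[simp] theorem length_word (x : Boundary α) (n : ℕ) : (x.word n).length = n := by simp [word]

theorem word_succ (x : Boundary α) (n : ℕ) : x.word (n + 1) = x.word n ++ [x.letter n] := by
  simp [word, List.range_succ]

theorem word_eq_iff (x y : Boundary α) (n : ℕ) : x.word n = y.word n ↔ ∀ i < n, x.letter i = y.letter i := by
  simp [word]

theorem getElem_word (x : Boundary α) (n i : ℕ) (h : i < (x.word n).length) :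
    (x.word n)[i] = x.letter i := by simp [word]

theorem take_word (x : Boundary α) {m n : ℕ} (h : m ≤ n) : (x.word n).take m = x.word m := by
  simp [word, ← List.map_take, List.take_range, h]

theorem ext_word {x y : Boundary α} (h : ∀ n, x.word n = y.word n) : x = y := by
  apply Boundary.ext
  funext n
  exact (word_eq_iff x y (n + 1)).1 (h (n + 1)) n (Nat.lt_succ_self n)

theorem isReduced_word (x : Boundary α) (n : ℕ) : FreeGroup.IsReduced (x.word n) := by
  unfold FreeGroup.IsReduced
  rw [List.isChain_iff_getElem]
  intro i hi h
  simp only [getElem_word] at h ⊢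
  by_contra hne
  refine x.reduced i (Prod.ext h.symm ?_)
  revert hne
  simp only [invLetter]
  cases (x.letter i).2 <;> cases (x.letter (i + 1)).2 <;> simp

end Boundary

section Extension

variable {α : Type*} [DecidableEq α]

theorem Boundary.toWord_pre (x : Boundary α) (n : ℕ) : (x.pre n).toWord = x.word n := by
  rw [Boundary.pre, FreeGroup.toWord_mk, (x.isReduced_word n).reduce_eq]

theorem toWord_mul_letter (u : FreeGroup α) (s : α × Bool) :
    (u * FreeGroup.mk [s]).toWord = u.toWord ++ [s] ∨
      u.toWord = (u * FreeGroup.mk [s]).toWord ++ [invLetter s] := by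
  by_cases h : FreeGroup.IsReduced (u.toWord ++ [s])
  · left
    rw [FreeGroup.toWord_mul, FreeGroup.toWord_mk, FreeGroup.reduce_singleton, h.reduce_eq]
  · right
    rcases List.eq_nil_or_concat u.toWord with h0 | ⟨l, t, ht⟩
    · exact absurd (by rw [h0]; simp) h
    · rw [List.concat_eq_append] at ht
      have hu : FreeGroup.IsReduced (l ++ [t]) := ht ▸ FreeGroup.isReduced_toWord
      have hts : t = invLetter s := by
        by_contra hne
        apply h
        rw [ht, List.append_assoc]
        unfold FreeGroup.IsReduced at hu ⊢
        rw [List.isChain_append] at hu ⊢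
        refine ⟨hu.1, ?_, by simpa using hu.2.2⟩
        simp only [List.singleton_append, List.isChain_cons_cons, List.IsChain.singleton, and_true]
        intro h1
        by_contra h2
        apply hne
        refine Prod.ext h1 ?_
        revert h2
        simp only [invLetter]
        cases t.2 <;> cases s.2 <;> simp
      have hl : FreeGroup.IsReduced l := by
        unfold FreeGroup.IsReduced at hu ⊢
        exact (List.isChain_append.1 hu).1
      have hmk : u * FreeGroup.mk [s] = FreeGroup.mk l := by
        have : u = FreeGroup.mk (l ++ [t]) := by rw [← ht, FreeGroup.mk_toWord]
        rw [this, FreeGroup.mul_mk]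
        apply FreeGroup.reduce.exact
        apply FreeGroup.reduce.Step.eq
        rw [hts]
        have := @FreeGroup.Red.Step.not α l [] s.1 (!s.2)
        simpa [invLetter] using this
      rw [hmk, FreeGroup.toWord_mk, hl.reduce_eq, ht, hts]

theorem take_toWord_mul (j : ℕ) (l : List (α × Bool)) (u : FreeGroup α)
    (h : j + l.length ≤ u.norm) : (u * FreeGroup.mk l).toWord.take j = u.toWord.take j := by
  induction l generalizing u with
  | nil =>
    rw [show (FreeGroup.mk [] : FreeGroup α) = 1 from rfl, mul_one]
  | cons s t ih =>
    have e : u * FreeGroup.mk (s :: t) = (u * FreeGroup.mk [s]) * FreeGroup.mk t := by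
      rw [mul_assoc, FreeGroup.mul_mk]; rfl
    simp only [List.length_cons, FreeGroup.norm] at h
    rcases toWord_mul_letter u s with h1 | h1
    · have hl := congrArg List.length h1
      simp only [List.length_append, List.length_singleton] at hl
      rw [e, ih _ (by simp only [FreeGroup.norm]; omega), h1, List.take_append_of_le_length (by omega)]
    · have hl := congrArg List.length h1
      simp only [List.length_append, List.length_singleton] at hl
      rw [e, ih _ (by simp only [FreeGroup.norm]; omega), h1, List.take_append_of_le_length (by omega)]

/-- A sequence of elements of `F` converges to the boundary point `y` if longer and longer
initial segments stabilise to those of `y`. -/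
def ConvergesTo (g : ℕ → FreeGroup α) (y : Boundary α) : Prop :=
  ∀ m, ∀ᶠ n in Filter.atTop, (g n).toWord.take m = y.word m

theorem ConvergesTo.unique {g : ℕ → FreeGroup α} {y z : Boundary α} (hy : ConvergesTo g y)
    (hz : ConvergesTo g z) : y = z := by
  apply Boundary.ext_word
  intro m
  obtain ⟨n, h1, h2⟩ := ((hy m).and (hz m)).exists
  rw [← h1, h2]

theorem convergesTo_pre (x : Boundary α) : ConvergesTo x.pre x := by
  intro m
  filter_upwards [Filter.eventually_ge_atTop m] with n hn
  rw [x.toWord_pre, x.take_word hn]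

theorem le_norm_of_take_eq {u : FreeGroup α} {y : Boundary α} {m : ℕ}
    (h : u.toWord.take m = y.word m) : m ≤ u.norm := by
  have := congrArg List.length h
  simp only [List.length_take, Boundary.length_word] at this
  simp only [FreeGroup.norm]
  omega

variable [Fintype α]

theorem exists_norm_le (Ψ : FreeGroup α →* FreeGroup α) :
    ∃ C, ∀ g, (Ψ g).norm ≤ C * g.norm := by
  refine ⟨∑ s : α × Bool, (Ψ (FreeGroup.mk [s])).norm, fun g => ?_⟩
  have key : ∀ l : List (α × Bool), (Ψ (FreeGroup.mk l)).norm ≤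
      (∑ s : α × Bool, (Ψ (FreeGroup.mk [s])).norm) * l.length := by
    intro l
    induction l with
    | nil => simp [← FreeGroup.one_eq_mk]
    | cons s t ih =>
      have e : FreeGroup.mk (s :: t) = FreeGroup.mk [s] * FreeGroup.mk t := by
        rw [FreeGroup.mul_mk]; rfl
      have h1 : (Ψ (FreeGroup.mk [s])).norm ≤ ∑ s : α × Bool, (Ψ (FreeGroup.mk [s])).norm :=
        Finset.single_le_sum (f := fun s => (Ψ (FreeGroup.mk [s])).norm) (fun _ _ => Nat.zero_le _)
          (Finset.mem_univ s)
      rw [e, map_mul, List.length_cons, Nat.mul_succ]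
      exact (FreeGroup.norm_mul_le _ _).trans (by omega)
  have := key g.toWord
  rwa [FreeGroup.mk_toWord] at this

/-- Uniform continuity of an automorphism with respect to the prefix topology. -/
theorem exists_take_eq (Ψ : MulAut (FreeGroup α)) (j : ℕ) :
    ∃ m, ∀ u v : FreeGroup α, m ≤ u.norm → m ≤ v.norm → u.toWord.take m = v.toWord.take m →
      j ≤ (Ψ u).norm ∧ (Ψ u).toWord.take j = (Ψ v).toWord.take j := by
  obtain ⟨C, hC⟩ := exists_norm_le (Ψ : FreeGroup α →* FreeGroup α)
  obtain ⟨D, hD⟩ := exists_norm_le ((Ψ⁻¹ : MulAut (FreeGroup α)) : FreeGroup α →* FreeGroup α)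
  have hlow : ∀ g : FreeGroup α, D * (j + C) + 1 ≤ g.norm → j + C ≤ (Ψ g).norm := by
    intro g hg
    by_contra hlt
    have h1 : g.norm ≤ D * (Ψ g).norm := by
      have := hD (Ψ g)
      simpa using this
    have h2 : D * (Ψ g).norm ≤ D * (j + C) := Nat.mul_le_mul_left _ (by omega)
    omega
  set m := D * (j + C) + 1 with hm
  have hpath : ∀ (t P : List (α × Bool)), m ≤ P.length → FreeGroup.IsReduced (P ++ t) →
      (Ψ (FreeGroup.mk (P ++ t))).toWord.take j = (Ψ (FreeGroup.mk P)).toWord.take j := by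
    intro t
    induction t with
    | nil => intro P _ _; simp
    | cons s t ih =>
      intro P hP hred
      have e : P ++ s :: t = (P ++ [s]) ++ t := by simp
      rw [e] at hred ⊢
      have hPs : FreeGroup.IsReduced (P ++ [s]) := by
        unfold FreeGroup.IsReduced at hred ⊢
        exact (List.isChain_append.1 hred).1
      have hPr : FreeGroup.IsReduced P := by
        unfold FreeGroup.IsReduced at hPs ⊢
        exact (List.isChain_append.1 hPs).1
      rw [ih (P ++ [s]) (by simp; omega) hred, ← FreeGroup.mul_mk, map_mul]
      have h1 := hlow (FreeGroup.mk P) (by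
        rw [FreeGroup.norm, FreeGroup.toWord_mk, hPr.reduce_eq]; exact hP)
      have h2 := hC (FreeGroup.mk [s])
      have h3 : (FreeGroup.mk [s]).norm ≤ 1 := FreeGroup.norm_mk_le
      have h4 : C * (FreeGroup.mk [s]).norm ≤ C * 1 := Nat.mul_le_mul_left _ h3
      have := take_toWord_mul j (Ψ (FreeGroup.mk [s])).toWord (Ψ (FreeGroup.mk P)) (by
        have : (Ψ (FreeGroup.mk [s])).toWord.length ≤ C := by
          have := h2.trans h4
          simpa [FreeGroup.norm] using this
        omega)
      rwa [FreeGroup.mk_toWord] at this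
  have hone : ∀ u : FreeGroup α, m ≤ u.norm →
      (Ψ u).toWord.take j = (Ψ (FreeGroup.mk (u.toWord.take m))).toWord.take j := by
    intro u hu
    have := hpath (u.toWord.drop m) (u.toWord.take m) (by
      rw [List.length_take]; exact le_min le_rfl hu) (by
      rw [List.take_append_drop]; exact FreeGroup.isReduced_toWord)
    rwa [List.take_append_drop, FreeGroup.mk_toWord] at this
  refine ⟨m, fun u v hu hv huv => ⟨?_, ?_⟩⟩
  · have := hlow u hu
    omega
  · rw [hone u hu, hone v hv, huv]

theorem exists_convergesTo (Ψ : MulAut (FreeGroup α)) (x : Boundary α) :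
    ∃ y : Boundary α, ConvergesTo (fun n => Ψ (x.pre n)) y := by
  have h1 : ∀ j, ∃ l : List (α × Bool), l.length = j ∧
      ∀ᶠ n in Filter.atTop, (Ψ (x.pre n)).toWord.take j = l := by
    intro j
    obtain ⟨m, hm⟩ := exists_take_eq Ψ j
    have hnorm : ∀ n, m ≤ n → m ≤ (x.pre n).norm := by
      intro n hn
      rw [FreeGroup.norm, x.toWord_pre]
      simpa using hn
    refine ⟨(Ψ (x.pre m)).toWord.take j, ?_, ?_⟩
    · have := (hm (x.pre m) (x.pre m) (hnorm m le_rfl) (hnorm m le_rfl) rfl).1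
      rw [List.length_take]
      exact min_eq_left this
    · filter_upwards [Filter.eventually_ge_atTop m] with n hn
      refine (hm (x.pre n) (x.pre m) (hnorm n hn) (hnorm m le_rfl) ?_).2
      rw [x.toWord_pre, x.toWord_pre, x.take_word hn, x.take_word le_rfl]
  choose l hl he using h1
  have hget : ∀ i j (hij : i < j), (l j)[i]'(by rw [hl]; exact hij) =
      (l (i + 1))[i]'(by rw [hl]; exact Nat.lt_succ_self i) := by
    intro i j hij
    obtain ⟨n, h1, h2⟩ := ((he j).and (he (i + 1))).exists
    simp only [← h1, ← h2, List.getElem_take]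
  have hred : ∀ j, FreeGroup.IsReduced (l j) := by
    intro j
    obtain ⟨n, h1⟩ := (he j).exists
    rw [← h1]
    exact FreeGroup.isReduced_toWord.infix (List.take_prefix _ _).isInfix
  refine ⟨⟨fun i => (l (i + 1))[i]'(by rw [hl]; exact Nat.lt_succ_self i), ?_⟩, ?_⟩
  · intro n h
    have := hred (n + 2)
    unfold FreeGroup.IsReduced at this
    rw [List.isChain_iff_getElem] at this
    have h2 := this n (by rw [hl]; omega)
    rw [hget n (n + 2) (by omega)] at h2
    have h' : (l (n + 2))[n + 1]'(by rw [hl]; omega) =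
      invLetter ((l (n + 1))[n]'(by rw [hl]; omega)) := h
    rw [h'] at h2
    simp [invLetter] at h2
  · intro m
    filter_upwards [he m] with n hn
    rw [hn]
    apply List.ext_getElem
    · rw [hl, Boundary.length_word]
    · intro i h1 h2
      rw [Boundary.getElem_word, hget i m (by rwa [hl] at h1)]

/-- The extension of an automorphism `Φ` of `F` to the boundary: `Φ(x)` is the limit of the
images under `Φ` of the vertices of the ray `x`. -/
noncomputable def boundaryMap (Φ : MulAut (FreeGroup α)) (x : Boundary α) : Boundary α :=
  Classical.choose (exists_convergesTo Φ x)

theorem boundaryMap_spec (Φ : MulAut (FreeGroup α)) (x : Boundary α) :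
    ConvergesTo (fun n => Φ (x.pre n)) (boundaryMap Φ x) :=
  Classical.choose_spec (exists_convergesTo Φ x)

theorem ConvergesTo.map (Φ : MulAut (FreeGroup α)) {g : ℕ → FreeGroup α} {y : Boundary α}
    (h : ConvergesTo g y) : ConvergesTo (fun n => Φ (g n)) (boundaryMap Φ y) := by
  intro j
  obtain ⟨m, hm⟩ := exists_take_eq Φ j
  filter_upwards [h m, boundaryMap_spec Φ y j, convergesTo_pre y m] with n h1 h2 h3
  rw [← h2]
  exact (hm _ _ (le_norm_of_take_eq h1) (le_norm_of_take_eq h3) (h1.trans h3.symm)).2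

theorem boundaryMap_one (x : Boundary α) : boundaryMap 1 x = x :=
  (boundaryMap_spec 1 x).unique (convergesTo_pre x)

theorem boundaryMap_mul (Φ Ψ : MulAut (FreeGroup α)) (x : Boundary α) :
    boundaryMap (Φ * Ψ) x = boundaryMap Φ (boundaryMap Ψ x) :=
  (boundaryMap_spec (Φ * Ψ) x).unique ((boundaryMap_spec Ψ x).map Φ)

theorem boundaryMap_injective (Φ : MulAut (FreeGroup α)) :
    Function.Injective (boundaryMap Φ) := by
  intro x y h
  have := congrArg (boundaryMap Φ⁻¹) h
  rwa [← boundaryMap_mul, ← boundaryMap_mul, inv_mul_cancel, boundaryMap_one,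
    boundaryMap_one] at this

end Extension

section DoubleBoundary

/-- `∂²F`, the pairs of distinct boundary points, that is, the oriented bi-infinite geodesics
of the Cayley graph: the geodesic `(p, q)` goes from `p` to `q`. -/
abbrev DoubleBoundary (α : Type*) : Type _ := {ξ : Boundary α × Boundary α // ξ.1 ≠ ξ.2}

variable {α : Type*}

/-- The length of the maximal initial segment shared by two distinct rays. -/
noncomputable def commonLength (p q : Boundary α) : ℕ := sInf {n | p.letter n ≠ q.letter n}

/-- The vertices of the geodesic `ξ = (p, q)` in the order in which it visits them; the vertex
with index `0` is the one closest to the base point `1`, where the rays `p` and `q` issued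
from `1` separate. -/
noncomputable def geodesicLine (ξ : DoubleBoundary α) (i : ℤ) : FreeGroup α :=
  if 0 ≤ i then ξ.1.2.pre (commonLength ξ.1.1 ξ.1.2 + i.toNat)
  else ξ.1.1.pre (commonLength ξ.1.1 ξ.1.2 + (-i).toNat)

/-- `Cyl([x, y])`: the geodesics that pass through the oriented segment from `x` to `y`. -/
def segmentCylinder (x y : FreeGroup α) : Set (DoubleBoundary α) :=
  {ξ | ∃ i j : ℤ, i ≤ j ∧ geodesicLine ξ i = x ∧ geodesicLine ξ j = y}

/-- The base-ball `B`: the geodesics that pass through the base point `1`. -/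
def baseBall (α : Type*) : Set (DoubleBoundary α) := {ξ | ∃ i : ℤ, geodesicLine ξ i = 1}

/-- The action `Φ × Φ` of an automorphism on `∂²F`. -/
noncomputable def doubleBoundaryMap [DecidableEq α] [Fintype α] (Φ : MulAut (FreeGroup α))
    (ξ : DoubleBoundary α) : DoubleBoundary α :=
  ⟨(boundaryMap Φ ξ.1.1, boundaryMap Φ ξ.1.2), fun h => ξ.2 (boundaryMap_injective Φ h)⟩

end DoubleBoundary

section Measures

open MeasureTheory ProbabilityTheory

variable {α : Type*}

/-- The rays which have the word `l` as initial segment. -/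
def prefixCylinder (l : List (α × Bool)) : Set (Boundary α) := {x | x.word l.length = l}

/-- `Cyl(v)`: the rays which have the freely reduced word `v` as initial segment. -/
def cylinder [DecidableEq α] (v : FreeGroup α) : Set (Boundary α) := prefixCylinder v.toWord

/-- The topology of `∂F` generated by the cylinders. -/
instance : TopologicalSpace (Boundary α) :=
  TopologicalSpace.generateFrom (Set.range (prefixCylinder (α := α)))

instance instMeasurableSpaceBoundary : MeasurableSpace (Boundary α) := borel _

instance : BorelSpace (Boundary α) := ⟨rfl⟩

instance [Countable α] : SecondCountableTopology (Boundary α) :=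
  ⟨⟨Set.range (prefixCylinder (α := α)), Set.countable_range _, rfl⟩⟩

theorem measurableSet_prefixCylinder (l : List (α × Bool)) :
    MeasurableSet (prefixCylinder l : Set (Boundary α)) :=
  (TopologicalSpace.isOpen_generateFrom_of_mem (Set.mem_range_self l)).measurableSet

/-- The alphabet `A = Σ ∪ Σ⁻¹`. -/
abbrev Letter (α : Type*) : Type _ := α × Bool

/-- The alphabet as a discrete measurable space. -/
abbrev letterMeasurableSpace (α : Type*) : MeasurableSpace (Letter α) := ⊤

attribute [local instance] letterMeasurableSpace

theorem letter_discrete (α : Type*) : DiscreteMeasurableSpace (Letter α) := ⟨fun _ => trivial⟩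

attribute [local instance] letter_discrete

theorem nonempty_choice (c : Letter α) : Nonempty {d : Letter α // d ≠ c} :=
  ⟨⟨(c.1, !c.2), fun h => by simpa using congrArg Prod.snd h⟩⟩

attribute [local instance] nonempty_choice

section Walk

variable [DecidableEq α]

/-- A non-backtracking path driven by a first letter and by a sequence of choices different
from a fixed letter `c₀`: the choice `c₀`, which is not allowed, is the one that would cause a
backtracking. -/
def walkLetter (c₀ : Letter α) (ω : Letter α × (ℕ → {d : Letter α // d ≠ c₀})) : ℕ → Letter α
  | 0 => ω.1
  | n + 1 => Equiv.swap c₀ (invLetter (walkLetter c₀ ω n)) (ω.2 n).1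

/-- The ray followed by the non-backtracking path. -/
def walk (c₀ : Letter α) (ω : Letter α × (ℕ → {d : Letter α // d ≠ c₀})) : Boundary α :=
  ⟨walkLetter c₀ ω, fun n h => (ω.2 n).2 (by
    have h1 : Equiv.swap c₀ (invLetter (walkLetter c₀ ω n)) (ω.2 n).1 =
      invLetter (walkLetter c₀ ω n) := h
    rwa [Equiv.swap_apply_eq_iff, Equiv.swap_apply_right] at h1)⟩

variable [Fintype α]

/-- The first letter is uniform in `A`, the choices are uniform among the `2k - 1` allowed ones,
and everything is independent. -/
noncomputable def walkMeasure (c₀ : Letter α) :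
    Measure (Letter α × (ℕ → {d : Letter α // d ≠ c₀})) :=
  (uniformOn Set.univ).prod (Measure.infinitePi fun _ => uniformOn Set.univ)

instance (c₀ : Letter α) : IsProbabilityMeasure (walkMeasure c₀) := by
  have : Nonempty (Letter α) := ⟨c₀⟩
  have : IsProbabilityMeasure (uniformOn (Set.univ : Set (Letter α))) :=
    isProbabilityMeasure_uniformOn Set.finite_univ Set.univ_nonempty
  unfold walkMeasure
  infer_instance

open Classical in
/-- The uniform frequency measure `μ_A`. -/
noncomputable def uniformFrequencyMeasure (α : Type*) [DecidableEq α] [Fintype α] :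
    Measure (Boundary α) :=
  if h : Nonempty α then (walkMeasure (h.some, true)).map (walk (h.some, true)) else 0

theorem measurable_walkLetter (c₀ : Letter α) (n : ℕ) :
    Measurable fun ω => walkLetter c₀ ω n := by
  induction n with
  | zero => exact measurable_fst
  | succ n ih =>
    have h : Measurable fun z : Letter α × {d : Letter α // d ≠ c₀} =>
        (Equiv.swap c₀ (invLetter z.1) z.2.1 : Letter α) := Measurable.of_discrete
    exact h.comp (ih.prodMk ((measurable_pi_apply n).comp measurable_snd))

theorem measurable_walk (c₀ : Letter α) : Measurable (walk c₀) := by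
  rw [show (instMeasurableSpaceBoundary : MeasurableSpace (Boundary α)) =
    MeasurableSpace.generateFrom (Set.range prefixCylinder) from
    borel_eq_generateFrom_of_subbasis rfl]
  refine measurable_generateFrom ?_
  rintro _ ⟨l, rfl⟩
  have : walk c₀ ⁻¹' prefixCylinder l =
      ⋂ i : Fin l.length, (fun ω => walkLetter c₀ ω i) ⁻¹' {l.get i} := by
    ext ω
    simp only [prefixCylinder, Set.mem_preimage, Set.mem_ofPred_eq, Set.mem_iInter,
      Set.mem_singleton_iff]
    constructor
    · intro h i
      have := Boundary.getElem_word (walk c₀ ω) l.length i (by simp)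
      simp only [h] at this
      exact this.symm
    · intro h
      apply List.ext_getElem (by simp)
      intro i h1 h2
      rw [Boundary.getElem_word]
      exact h ⟨i, h2⟩
  rw [this]
  exact MeasurableSet.iInter fun i => measurable_walkLetter c₀ i (MeasurableSet.of_discrete)

instance : IsFiniteMeasure (uniformFrequencyMeasure α) := by
  unfold uniformFrequencyMeasure
  split_ifs <;> infer_instance

theorem uniformFrequencyMeasure_univ [Nonempty α] :
    uniformFrequencyMeasure α Set.univ = 1 := by
  unfold uniformFrequencyMeasure
  rw [dif_pos ‹_›, Measure.map_apply (measurable_walk _) MeasurableSet.univ]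
  simp

theorem uniformFrequencyMeasure_prefixCylinder (l : List (α × Bool)) (hl : l ≠ [])
    (hred : FreeGroup.IsReduced l) :
    uniformFrequencyMeasure α (prefixCylinder l) = ENNReal.ofReal
      (1 / (2 * Fintype.card α * (2 * Fintype.card α - 1) ^ (l.length - 1))) := by
  have hne : Nonempty α := ⟨(l.head hl).1⟩
  have hk : 1 ≤ Fintype.card α := Fintype.card_pos
  unfold uniformFrequencyMeasure
  rw [dif_pos hne, Measure.map_apply (measurable_walk _) (measurableSet_prefixCylinder l)]
  generalize (hne.some, true) = c₀
  obtain ⟨n, hn⟩ : ∃ n, l.length = n + 1 :=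
    ⟨l.length - 1, by have := List.length_pos_iff.2 hl; omega⟩
  set f : ℕ → Letter α := fun i => l.getD i c₀ with hf
  set t : ℕ → Set {d : Letter α // d ≠ c₀} :=
    fun i => {d | d.1 = Equiv.swap c₀ (invLetter (f i)) (f (i + 1))} with ht
  have hpre : walk c₀ ⁻¹' prefixCylinder l =
      ({f 0} : Set (Letter α)) ×ˢ Set.pi (Finset.range n : Set ℕ) t := by
    ext ω
    have h1 : ω ∈ walk c₀ ⁻¹' prefixCylinder l ↔ ∀ i ≤ n, walkLetter c₀ ω i = f i := by
      simp only [prefixCylinder, Set.mem_preimage, Set.mem_ofPred_eq]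
      constructor
      · intro h i hi
        have := Boundary.getElem_word (walk c₀ ω) l.length i (by simp; omega)
        simp only [h] at this
        rw [hf]
        simp only
        rw [List.getD_eq_getElem _ _ (by omega), this]
        rfl
      · intro h
        apply List.ext_getElem (by simp)
        intro i h1 h2
        rw [Boundary.getElem_word]
        have := h i (by omega)
        rw [hf] at this
        simp only at this
        rw [List.getD_eq_getElem _ _ h2] at this
        exact this
    rw [h1]
    simp only [Set.mem_prod, Set.mem_singleton_iff, Set.mem_pi, Finset.coe_range, Set.mem_Iio]
    constructor
    · intro h
      refine ⟨h 0 (Nat.zero_le _), fun i hi => ?_⟩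
      have h2 := h (i + 1) hi
      rw [walkLetter, h i (by omega), Equiv.swap_apply_eq_iff] at h2
      exact h2
    · rintro ⟨h0, h⟩ i
      induction i with
      | zero => exact fun _ => h0
      | succ i ih =>
        intro hi
        rw [walkLetter, ih (by omega), Equiv.swap_apply_eq_iff]
        exact h i hi
  have hstep : ∀ i < n, f (i + 1) ≠ invLetter (f i) := by
    intro i hi h
    unfold FreeGroup.IsReduced at hred
    rw [List.isChain_iff_getElem] at hred
    have h1 := hred i (by omega)
    have e1 : f (i + 1) = l[i + 1]'(by omega) := List.getD_eq_getElem _ _ (by omega)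
    have e2 : f i = l[i]'(by omega) := List.getD_eq_getElem _ _ (by omega)
    rw [← e1, ← e2, h] at h1
    simp [invLetter] at h1
  have : Nonempty (Letter α) := ⟨c₀⟩
  have : IsProbabilityMeasure (uniformOn (Set.univ : Set (Letter α))) :=
    isProbabilityMeasure_uniformOn Set.finite_univ Set.univ_nonempty
  have hcard : Fintype.card (Letter α) = 2 * Fintype.card α := by
    rw [show Fintype.card (Letter α) = Fintype.card (α × Bool) from rfl, Fintype.card_prod,
      Fintype.card_bool, mul_comm]
  have hcard' : Fintype.card {d : Letter α // d ≠ c₀} = 2 * Fintype.card α - 1 := by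
    rw [← hcard, Fintype.card_subtype_compl, Fintype.card_subtype_eq]
  have hti : ∀ i < n, uniformOn Set.univ (t i) =
      ENNReal.ofReal (1 / (2 * Fintype.card α - 1)) := by
    intro i hi
    have hs : Equiv.swap c₀ (invLetter (f i)) (f (i + 1)) ≠ c₀ := by
      intro h
      rw [Equiv.swap_apply_eq_iff, Equiv.swap_apply_left] at h
      exact hstep i hi h
    have : t i = {⟨_, hs⟩} := by
      ext d
      simp [ht, Subtype.ext_iff]
    rw [this, uniformOn_univ, Measure.count_singleton, hcard', one_div, one_div,
      ENNReal.ofReal_inv_of_pos (by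
        have : (1 : ℝ) ≤ Fintype.card α := by exact_mod_cast hk
        linarith)]
    congr 1
    rw [← ENNReal.ofReal_natCast]
    congr 1
    push_cast [show 1 ≤ 2 * Fintype.card α by omega]
    ring
  have hk' : (1 : ℝ) ≤ Fintype.card α := by exact_mod_cast hk
  rw [hpre, walkMeasure, Measure.prod_prod,
    Measure.infinitePi_pi _ (fun i _ => MeasurableSet.of_discrete), uniformOn_univ,
    Measure.count_singleton, hcard, Finset.prod_congr rfl (fun i hi => hti i (Finset.mem_range.1 hi)),
    Finset.prod_const, Finset.card_range, ← ENNReal.ofReal_pow (by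
      apply one_div_nonneg.2; linarith), hn, Nat.add_sub_cancel]
  rw [show (1 : ENNReal) / ((2 * Fintype.card α : ℕ) : ENNReal) =
    ENNReal.ofReal (1 / (2 * Fintype.card α)) by
      rw [one_div, one_div, ENNReal.ofReal_inv_of_pos (by linarith)]
      congr 1
      rw [← ENNReal.ofReal_natCast]
      push_cast
      rfl]
  rw [← ENNReal.ofReal_mul (by positivity)]
  congr 1
  rw [one_div_pow]
  field_simp

/-- `μ_A(Cyl(v)) = 1 / (2k(2k-1)^(|v|-1))`. -/
theorem uniformFrequencyMeasure_cylinder (v : FreeGroup α) (hv : v ≠ 1) :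
    uniformFrequencyMeasure α (cylinder v) = ENNReal.ofReal
      (1 / (2 * Fintype.card α * (2 * Fintype.card α - 1) ^ (v.norm - 1))) :=
  uniformFrequencyMeasure_prefixCylinder v.toWord
    (fun h => hv (FreeGroup.toWord_eq_nil_iff.1 h)) FreeGroup.isReduced_toWord

end Walk

/-- The pairs of rays whose maximal common initial segment has length `n`. -/
def separationSet (α : Type*) (n : ℕ) : Set (Boundary α × Boundary α) :=
  {z | z.1.word n = z.2.word n ∧ z.1.letter n ≠ z.2.letter n}

/-- The measure on `∂F × ∂F` carried by the complement of the diagonal whose density with respect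
to `μ_A × μ_A` is `2k(2k-1)^(2n-1)` at the pairs of rays with a common initial segment of
length `n`. -/
noncomputable def uniformPairMeasure (α : Type*) [DecidableEq α] [Fintype α] :
    Measure (Boundary α × Boundary α) :=
  Measure.sum fun n : ℕ =>
    ENNReal.ofReal (2 * Fintype.card α * (2 * Fintype.card α - 1) ^ (2 * n) /
        (2 * Fintype.card α - 1)) •
      ((uniformFrequencyMeasure α).prod (uniformFrequencyMeasure α)).restrict (separationSet α n)

/-- The uniform current `η_A`: the Borel measure on `∂²F` with
`η_A(Cyl([x, y])) = μ_A(Cyl(x⁻¹y))` for all `x ≠ y`, see `uniformCurrent_segmentCylinder`. -/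
noncomputable def uniformCurrent (α : Type*) [DecidableEq α] [Fintype α] :
    Measure (DoubleBoundary α) :=
  (uniformPairMeasure α).comap Subtype.val

theorem separationSet_eq (n : ℕ) : separationSet α n =
    (⋃ l : {l : List (α × Bool) // l.length = n}, prefixCylinder l.1 ×ˢ prefixCylinder l.1) \
    ⋃ l : {l : List (α × Bool) // l.length = n + 1}, prefixCylinder l.1 ×ˢ prefixCylinder l.1 := by
  have key : ∀ (m : ℕ) (z : Boundary α × Boundary α),
      (z ∈ ⋃ l : {l : List (α × Bool) // l.length = m},
        (prefixCylinder l.1 ×ˢ prefixCylinder l.1 : Set (Boundary α × Boundary α))) ↔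
      z.1.word m = z.2.word m := by
    intro m z
    simp only [Set.mem_iUnion, Set.mem_prod, prefixCylinder, Set.mem_ofPred_eq]
    constructor
    · rintro ⟨⟨l, rfl⟩, h1, h2⟩
      exact h1.trans h2.symm
    · intro h
      exact ⟨⟨z.1.word m, by simp⟩, by simp, by simp [h]⟩
  ext z
  rw [Set.mem_sdiff, key, key]
  simp only [separationSet, Set.mem_ofPred_eq, Boundary.word_succ]
  constructor
  · rintro ⟨h1, h2⟩
    refine ⟨h1, fun h => h2 ?_⟩
    rw [h1] at h
    simpa using h
  · rintro ⟨h1, h2⟩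
    refine ⟨h1, fun h => h2 ?_⟩
    rw [h1, h]

theorem measurableSet_separationSet [Fintype α] (n : ℕ) : MeasurableSet (separationSet α n) := by
  rw [separationSet_eq]
  have h : ∀ m : ℕ, MeasurableSet (⋃ l : {l : List (α × Bool) // l.length = m},
      (prefixCylinder l.1 ×ˢ prefixCylinder l.1 : Set (Boundary α × Boundary α))) := fun m =>
    MeasurableSet.iUnion fun l =>
      (measurableSet_prefixCylinder l.1).prod (measurableSet_prefixCylinder l.1)
  exact (h n).diff (h (n + 1))

theorem commonLength_mem {p q : Boundary α} (h : p ≠ q) :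
    (p, q) ∈ separationSet α (commonLength p q) := by
  have hne : {n | p.letter n ≠ q.letter n}.Nonempty := by
    by_contra hemp
    rw [Set.not_nonempty_iff_eq_empty, Set.eq_empty_iff_forall_notMem] at hemp
    apply h
    apply Boundary.ext
    funext n
    by_contra h1
    exact hemp n h1
  refine ⟨?_, Nat.sInf_mem hne⟩
  rw [Boundary.word_eq_iff]
  intro i hi
  by_contra h1
  exact Nat.notMem_of_lt_sInf hi h1

theorem separationSet_unique {m n : ℕ} {z : Boundary α × Boundary α}
    (hm : z ∈ separationSet α m) (hn : z ∈ separationSet α n) : m = n := by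
  rcases lt_trichotomy m n with h | h | h
  · exact absurd ((Boundary.word_eq_iff _ _ _).1 hn.1 m h) hm.2
  · exact h
  · exact absurd ((Boundary.word_eq_iff _ _ _).1 hm.1 n h) hn.2

theorem commonLength_eq {n : ℕ} {p q : Boundary α} (h : (p, q) ∈ separationSet α n) :
    p ≠ q ∧ commonLength p q = n := by
  have hne : p ≠ q := by
    rintro rfl
    exact h.2 rfl
  exact ⟨hne, separationSet_unique (commonLength_mem hne) h⟩

theorem measurableSet_offDiag [Fintype α] : MeasurableSet {z : Boundary α × Boundary α | z.1 ≠ z.2} := by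
  have : {z : Boundary α × Boundary α | z.1 ≠ z.2} = ⋃ n, separationSet α n := by
    ext z
    rw [Set.mem_iUnion]
    exact ⟨fun h => ⟨_, commonLength_mem h⟩, fun ⟨n, h⟩ => (commonLength_eq h).1⟩
  rw [this]
  exact MeasurableSet.iUnion measurableSet_separationSet

theorem uniformCurrent_apply [DecidableEq α] [Fintype α] (S : Set (DoubleBoundary α)) :
    uniformCurrent α S = uniformPairMeasure α (Subtype.val '' S) :=
  comap_subtype_coe_apply measurableSet_offDiag _ S

theorem uniformPairMeasure_apply [DecidableEq α] [Fintype α] (S : Set (Boundary α × Boundary α)) :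
    uniformPairMeasure α S = ∑' n : ℕ,
      ENNReal.ofReal (2 * Fintype.card α * (2 * Fintype.card α - 1) ^ (2 * n) /
        (2 * Fintype.card α - 1)) *
      ((uniformFrequencyMeasure α).prod (uniformFrequencyMeasure α)) (S ∩ separationSet α n) := by
  rw [uniformPairMeasure, Measure.sum_apply_of_countable]
  congr 1
  funext n
  rw [Measure.smul_apply, Measure.restrict_apply' (measurableSet_separationSet n), smul_eq_mul]

theorem uniformPairMeasure_swap [DecidableEq α] [Fintype α] (S : Set (Boundary α × Boundary α)) :
    uniformPairMeasure α (Prod.swap ⁻¹' S) = uniformPairMeasure α S := by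
  rw [uniformPairMeasure_apply, uniformPairMeasure_apply]
  congr 1
  funext n
  congr 1
  have h : Prod.swap ⁻¹' S ∩ separationSet α n = Prod.swap ⁻¹' (S ∩ separationSet α n) := by
    ext z
    simp only [Set.mem_inter_iff, Set.mem_preimage, separationSet, Set.mem_ofPred_eq,
      Prod.fst_swap, Prod.snd_swap]
    rw [eq_comm, ne_comm]
  rw [h]
  exact (Measure.measurePreserving_swap (μ := uniformFrequencyMeasure α)
    (ν := uniformFrequencyMeasure α)).measure_preimage_equiv (f := MeasurableEquiv.prodComm) _

theorem geodesicLine_swap (ξ ζ : DoubleBoundary α) (h : ζ.1 = ξ.1.swap) (i : ℤ) :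
    geodesicLine ζ i = geodesicLine ξ (-i) := by
  have hc : commonLength ξ.1.2 ξ.1.1 = commonLength ξ.1.1 ξ.1.2 := by
    unfold commonLength
    congr 1
    ext n
    exact ne_comm
  unfold geodesicLine
  rw [h, Prod.fst_swap, Prod.snd_swap, hc]
  rcases lt_trichotomy i 0 with hi | rfl | hi
  · rw [if_neg (by omega), if_pos (by omega)]
  · have := (commonLength_mem ξ.2).1
    simp [Boundary.pre, this]
  · rw [if_pos (by omega), if_neg (by omega), neg_neg]

theorem segmentCylinder_swap (ξ ζ : DoubleBoundary α) (h : ζ.1 = ξ.1.swap) (x y : FreeGroup α) :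
    ζ ∈ segmentCylinder x y ↔ ξ ∈ segmentCylinder y x := by
  simp only [segmentCylinder, Set.mem_ofPred_eq, geodesicLine_swap ξ ζ h]
  constructor
  · rintro ⟨i, j, hij, hx, hy⟩
    exact ⟨-j, -i, by omega, hy, hx⟩
  · rintro ⟨i, j, hij, hx, hy⟩
    exact ⟨-j, -i, by omega, by simpa using hy, by simpa using hx⟩

theorem uniformCurrent_segmentCylinder_swap [DecidableEq α] [Fintype α] (x y : FreeGroup α) :
    uniformCurrent α (segmentCylinder x y) = uniformCurrent α (segmentCylinder y x) := by
  rw [uniformCurrent_apply, uniformCurrent_apply, ← uniformPairMeasure_swap]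
  congr 1
  ext z
  simp only [Set.mem_preimage, Set.mem_image]
  constructor
  · rintro ⟨ζ, hζ, hz⟩
    have hz' : z.1 ≠ z.2 := fun h => ζ.2 (by rw [hz]; exact h.symm)
    exact ⟨⟨z, hz'⟩, (segmentCylinder_swap ⟨z, hz'⟩ ζ hz x y).1 hζ, rfl⟩
  · rintro ⟨ξ, hξ, rfl⟩
    exact ⟨⟨ξ.1.swap, fun h => ξ.2 h.symm⟩, (segmentCylinder_swap ξ _ rfl x y).2 hξ, rfl⟩

theorem geodesicLine_toWord [DecidableEq α] (ξ : DoubleBoundary α) (i : ℤ) : (geodesicLine ξ i).toWord =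
    if 0 ≤ i then ξ.1.2.word (commonLength ξ.1.1 ξ.1.2 + i.toNat)
    else ξ.1.1.word (commonLength ξ.1.1 ξ.1.2 + (-i).toNat) := by
  unfold geodesicLine
  split_ifs <;> exact Boundary.toWord_pre _ _

theorem mem_segmentCylinder_of_prefix [DecidableEq α] (ξ : DoubleBoundary α) (x y : FreeGroup α)
    (b : List (α × Bool)) (hb : b ≠ []) (hy : y.toWord = x.toWord ++ b) :
    ξ ∈ segmentCylinder x y ↔ ξ.1.2 ∈ prefixCylinder y.toWord ∧
      commonLength ξ.1.1 ξ.1.2 ≤ x.toWord.length := by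
  have hbl := List.length_pos_iff.2 hb
  have hyl := congrArg List.length hy
  rw [List.length_append] at hyl
  obtain ⟨hc1, hc2⟩ := commonLength_mem ξ.2
  simp only at hc1 hc2
  simp only [segmentCylinder, Set.mem_ofPred_eq, prefixCylinder]
  set c := commonLength ξ.1.1 ξ.1.2 with hc
  constructor
  · rintro ⟨i, j, hij, hix, hjy⟩
    have hix := congrArg FreeGroup.toWord hix
    have hjy := congrArg FreeGroup.toWord hjy
    rw [geodesicLine_toWord, ← hc] at hix hjy
    have hlx := congrArg List.length hix
    have hly := congrArg List.length hjy
    by_cases hi : 0 ≤ i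
    · rw [if_pos hi] at hix hlx
      rw [if_pos (hi.trans hij)] at hjy hly
      simp only [Boundary.length_word] at hlx hly
      refine ⟨?_, by omega⟩
      rw [← hly]
      exact hjy
    · rw [if_neg hi] at hix hlx
      simp only [Boundary.length_word] at hlx
      by_cases hj : 0 ≤ j
      · rw [if_pos hj] at hjy hly
        simp only [Boundary.length_word] at hly
        exfalso
        have h1 : ξ.1.2.word x.toWord.length = x.toWord := by
          rw [← ξ.1.2.take_word (show x.toWord.length ≤ c + j.toNat by omega), hjy, hy]
          simp
        rw [← hlx, ← hix] at h1
        exact hc2 ((Boundary.word_eq_iff _ _ _).1 h1 c (by omega)).symm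
      · rw [if_neg hj] at hjy hly
        simp only [Boundary.length_word] at hly
        omega
  · rintro ⟨h1, h2⟩
    refine ⟨x.toWord.length - c, y.toWord.length - c, by omega, ?_, ?_⟩
    · apply FreeGroup.toWord_injective
      rw [geodesicLine_toWord, ← hc, if_pos (by omega),
        show c + ((x.toWord.length : ℤ) - c).toNat = x.toWord.length by omega,
        ← ξ.1.2.take_word (show x.toWord.length ≤ y.toWord.length by omega), h1, hy]
      simp
    · apply FreeGroup.toWord_injective
      rw [geodesicLine_toWord, ← hc, if_pos (by omega),
        show c + ((y.toWord.length : ℤ) - c).toNat = y.toWord.length by omega, h1]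

theorem mem_segmentCylinder_of_fork [DecidableEq α] (ξ : DoubleBoundary α) (x y : FreeGroup α)
    (P a b : List (α × Bool)) (s t : α × Bool) (hst : s ≠ t)
    (hx : x.toWord = P ++ s :: a) (hy : y.toWord = P ++ t :: b) :
    ξ ∈ segmentCylinder x y ↔
      ξ.1.1 ∈ prefixCylinder x.toWord ∧ ξ.1.2 ∈ prefixCylinder y.toWord := by
  have hxl := congrArg List.length hx
  have hyl := congrArg List.length hy
  rw [List.length_append, List.length_cons] at hxl hyl
  have hsx : ∀ p : Boundary α, p.word x.toWord.length = x.toWord →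
      p.word P.length = P ∧ p.letter P.length = s := by
    intro p hp
    constructor
    · rw [← p.take_word (show P.length ≤ x.toWord.length by omega), hp, hx]
      simp
    · rw [← p.getElem_word x.toWord.length P.length (by simp; omega),
        List.getElem_of_eq hp, List.getElem_of_eq hx]
      simp
  have hsy : ∀ p : Boundary α, p.word y.toWord.length = y.toWord →
      p.word P.length = P ∧ p.letter P.length = t := by
    intro p hp
    constructor
    · rw [← p.take_word (show P.length ≤ y.toWord.length by omega), hp, hy]
      simp
    · rw [← p.getElem_word y.toWord.length P.length (by simp; omega),
        List.getElem_of_eq hp, List.getElem_of_eq hy]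
      simp
  simp only [segmentCylinder, Set.mem_ofPred_eq, prefixCylinder]
  constructor
  · rintro ⟨i, j, hij, hix, hjy⟩
    have hix := congrArg FreeGroup.toWord hix
    have hjy := congrArg FreeGroup.toWord hjy
    rw [geodesicLine_toWord] at hix hjy
    set c := commonLength ξ.1.1 ξ.1.2 with hc
    have fin : ∀ (p : Boundary α) (n : ℕ) (u : FreeGroup α), p.word n = u.toWord →
        p.word u.toWord.length = u.toWord := by
      intro p n u h
      have := congrArg List.length h
      rw [Boundary.length_word] at this
      rw [← this, h]
    by_cases hi : 0 ≤ i
    · rw [if_pos hi] at hix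
      rw [if_pos (hi.trans hij)] at hjy
      exact absurd ((hsx _ (fin _ _ _ hix)).2.symm.trans (hsy _ (fin _ _ _ hjy)).2) hst
    · rw [if_neg hi] at hix
      by_cases hj : 0 ≤ j
      · rw [if_pos hj] at hjy
        exact ⟨fin _ _ _ hix, fin _ _ _ hjy⟩
      · rw [if_neg hj] at hjy
        exact absurd ((hsx _ (fin _ _ _ hix)).2.symm.trans (hsy _ (fin _ _ _ hjy)).2) hst
  · rintro ⟨h1, h2⟩
    have hc : commonLength ξ.1.1 ξ.1.2 = P.length := by
      refine (commonLength_eq ⟨?_, ?_⟩).2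
      · exact (hsx _ h1).1.trans (hsy _ h2).1.symm
      · change ξ.1.1.letter _ ≠ ξ.1.2.letter _
        rw [(hsx _ h1).2, (hsy _ h2).2]
        exact hst
    refine ⟨-(x.toWord.length - P.length), y.toWord.length - P.length, by omega, ?_, ?_⟩
    · apply FreeGroup.toWord_injective
      rw [geodesicLine_toWord, hc, if_neg (by omega),
        show P.length + (- -((x.toWord.length : ℤ) - P.length)).toNat = x.toWord.length by omega,
        h1]
    · apply FreeGroup.toWord_injective
      rw [geodesicLine_toWord, hc, if_pos (by omega),
        show P.length + ((y.toWord.length : ℤ) - P.length).toNat = y.toWord.length by omega, h2]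

theorem exists_fork {A : Type*} (l₁ l₂ : List A) : l₁ = l₂ ∨
    (∃ b, b ≠ [] ∧ l₂ = l₁ ++ b) ∨ (∃ b, b ≠ [] ∧ l₁ = l₂ ++ b) ∨
    ∃ P a b s t, s ≠ t ∧ l₁ = P ++ s :: a ∧ l₂ = P ++ t :: b := by
  induction l₁ generalizing l₂ with
  | nil =>
    cases l₂ with
    | nil => exact Or.inl rfl
    | cons t l => exact Or.inr (Or.inl ⟨t :: l, by simp, rfl⟩)
  | cons s l ih =>
    cases l₂ with
    | nil => exact Or.inr (Or.inr (Or.inl ⟨s :: l, by simp, rfl⟩))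
    | cons t l' =>
      by_cases hst : s = t
      · subst hst
        rcases ih l' with h | ⟨b, hb, h⟩ | ⟨b, hb, h⟩ | ⟨P, a, b, u, v, huv, h1, h2⟩
        · exact Or.inl (by rw [h])
        · exact Or.inr (Or.inl ⟨b, hb, by rw [h]; rfl⟩)
        · exact Or.inr (Or.inr (Or.inl ⟨b, hb, by rw [h]; rfl⟩))
        · exact Or.inr (Or.inr (Or.inr ⟨s :: P, a, b, u, v, huv, by rw [h1]; rfl, by rw [h2]; rfl⟩))
      · exact Or.inr (Or.inr (Or.inr ⟨[], l, l', s, t, hst, rfl, rfl⟩))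

theorem norm_of_prefix [DecidableEq α] (x y : FreeGroup α) (b : List (α × Bool))
    (hy : y.toWord = x.toWord ++ b) : (x⁻¹ * y).norm = b.length := by
  have hb : FreeGroup.IsReduced b := (FreeGroup.isReduced_toWord (x := y)).infix
    (hy ▸ (List.suffix_append _ _).isInfix)
  have : x⁻¹ * y = FreeGroup.mk b := by
    rw [inv_mul_eq_iff_eq_mul, ← FreeGroup.mk_toWord (x := y), hy, ← FreeGroup.mul_mk,
      FreeGroup.mk_toWord]
  rw [this, FreeGroup.norm, FreeGroup.toWord_mk, hb.reduce_eq]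

theorem norm_of_fork [DecidableEq α] (x y : FreeGroup α) (P a b : List (α × Bool)) (s t : α × Bool)
    (hst : s ≠ t) (hx : x.toWord = P ++ s :: a) (hy : y.toWord = P ++ t :: b) :
    (x⁻¹ * y).norm = a.length + b.length + 2 := by
  have ha : FreeGroup.IsReduced (s :: a) := (FreeGroup.isReduced_toWord (x := x)).infix
    (hx ▸ (List.suffix_append _ _).isInfix)
  have hb : FreeGroup.IsReduced (t :: b) := (FreeGroup.isReduced_toWord (x := y)).infix
    (hy ▸ (List.suffix_append _ _).isInfix)
  have ha' : FreeGroup.IsReduced (FreeGroup.invRev (s :: a)) := by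
    rw [FreeGroup.isReduced_iff_reduce_eq, FreeGroup.reduce_invRev, ha.reduce_eq]
  have e : x⁻¹ * y = FreeGroup.mk (FreeGroup.invRev (s :: a) ++ t :: b) := by
    rw [← FreeGroup.mul_mk, ← FreeGroup.inv_mk, inv_mul_eq_iff_eq_mul, ← mul_assoc,
      ← FreeGroup.mk_toWord (x := y), hy, ← FreeGroup.mul_mk, mul_left_inj,
      ← FreeGroup.mk_toWord (x := x), hx, ← FreeGroup.mul_mk, mul_inv_cancel_right]
  have hred : FreeGroup.IsReduced (FreeGroup.invRev (s :: a) ++ t :: b) := by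
    unfold FreeGroup.IsReduced at ha' hb ⊢
    rw [List.isChain_append]
    refine ⟨ha', hb, ?_⟩
    intro c hc d hd h1
    simp only [FreeGroup.invRev, List.map_cons, List.reverse_cons, List.getLast?_append,
      List.getLast?_singleton, Option.some_or, Option.mem_def, Option.some.injEq,
      List.head?_cons] at hc hd
    subst hc hd
    by_contra h2
    apply hst
    refine Prod.ext h1 ?_
    revert h2
    cases s.2 <;> cases t.2 <;> simp
  rw [e, FreeGroup.norm, FreeGroup.toWord_mk, hred.reduce_eq]
  simp
  ring

theorem uniformCurrent_of_prefix [DecidableEq α] [Fintype α] (x y : FreeGroup α) (b : List (α × Bool)) (hb : b ≠ [])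
    (hy : y.toWord = x.toWord ++ b) :
    uniformCurrent α (segmentCylinder x y) = ENNReal.ofReal
      (1 / (2 * Fintype.card α * (2 * Fintype.card α - 1) ^ (b.length - 1))) := by
  have hyne : y.toWord ≠ [] := by rw [hy]; simp [hb]
  have hne : Nonempty α := ⟨(b.head hb).1⟩
  have hk : (1 : ℝ) ≤ Fintype.card α := by exact_mod_cast (Fintype.card_pos : 0 < Fintype.card α)
  have hbl := List.length_pos_iff.2 hb
  have hyl := congrArg List.length hy
  rw [List.length_append] at hyl
  set k : ℝ := ((Fintype.card α : ℕ) : ℝ) with hkdef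
  set μ := uniformFrequencyMeasure α with hμ
  set m := x.toWord.length with hm
  set w : ℕ → ℝ := fun n => if n = 0 then 1 else 1 / (2 * k * (2 * k - 1) ^ (n - 1)) with hw
  have hwm : ∀ n ≤ y.toWord.length,
      μ (prefixCylinder (y.toWord.take n)) = ENNReal.ofReal (w n) := by
    intro n hn
    by_cases h0 : n = 0
    · subst h0
      have : (prefixCylinder (y.toWord.take 0) : Set (Boundary α)) = Set.univ := by
        ext p; simp [prefixCylinder, Boundary.word]
      rw [this, hμ, uniformFrequencyMeasure_univ]
      simp [hw]
    · have hl : (y.toWord.take n).length = n := by rw [List.length_take]; omega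
      rw [hμ, uniformFrequencyMeasure_prefixCylinder _ (by
        intro h; rw [h] at hl; exact h0 hl.symm)
        (FreeGroup.isReduced_toWord.infix (List.take_prefix _ _).isInfix), hl]
      simp only [hw, if_neg h0, hkdef]
  have hw0 : ∀ n, 0 ≤ w n := by
    intro n
    simp only [hw]
    split_ifs
    · exact zero_le_one
    · have : (0 : ℝ) ≤ 2 * k - 1 := by linarith
      positivity
  have hset : ∀ n, (Subtype.val '' segmentCylinder x y : Set (Boundary α × Boundary α)) ∩
      separationSet α n = if n ≤ m then
        (prefixCylinder (y.toWord.take n) \ prefixCylinder (y.toWord.take (n + 1))) ×ˢ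
          prefixCylinder y.toWord else ∅ := by
    intro n
    ext z
    have h1 : z ∈ (Subtype.val '' segmentCylinder x y : Set (Boundary α × Boundary α)) ∩
        separationSet α n ↔ z.2 ∈ prefixCylinder y.toWord ∧ n ≤ m ∧ z ∈ separationSet α n := by
      constructor
      · rintro ⟨⟨ξ, hξ, rfl⟩, hn⟩
        rw [mem_segmentCylinder_of_prefix ξ x y b hb hy, (commonLength_eq hn).2] at hξ
        exact ⟨hξ.1, hξ.2, hn⟩
      · rintro ⟨h1, h2, h3⟩
        have h4 := commonLength_eq h3
        refine ⟨⟨⟨z, h4.1⟩, ?_, rfl⟩, h3⟩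
        rw [mem_segmentCylinder_of_prefix _ x y b hb hy]
        exact ⟨h1, by simp only; rw [h4.2]; exact h2⟩
    rw [h1]
    split_ifs with hn
    · have htl : ∀ i ≤ y.toWord.length, (y.toWord.take i).length = i := by
        intro i hi
        rw [List.length_take]; omega
      simp only [hn, true_and, Set.mem_prod, Set.mem_sdiff, prefixCylinder, Set.mem_ofPred_eq,
        separationSet]
      rw [htl n (by omega), htl (n + 1) (by omega), and_comm]
      refine and_congr_left fun hz => ?_
      have e : ∀ i ≤ y.toWord.length, y.toWord.take i = z.2.word i := by
        intro i hi
        rw [← hz, z.2.take_word hi]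
      rw [e n (by omega), e (n + 1) (by omega), Boundary.word_succ, Boundary.word_succ]
      refine and_congr_right fun hz' => ?_
      rw [hz']
      simp
    · simp [hn]
  have hterm : ∀ n, ENNReal.ofReal (2 * k * (2 * k - 1) ^ (2 * n) / (2 * k - 1)) *
      (μ.prod μ) ((Subtype.val '' segmentCylinder x y : Set (Boundary α × Boundary α)) ∩
        separationSet α n) = if n ≤ m then ENNReal.ofReal
          ((if n = 0 then 1 else (2 * k - 1) ^ n - (2 * k - 1) ^ (n - 1)) * w y.toWord.length)
          else 0 := by
    intro n
    rw [hset]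
    split_ifs with hn h0
    all_goals try simp only [measure_empty, mul_zero]
    all_goals
      have hsub : (prefixCylinder (y.toWord.take (n + 1)) : Set (Boundary α)) ⊆
          prefixCylinder (y.toWord.take n) := by
        intro p hp
        simp only [prefixCylinder, Set.mem_ofPred_eq, List.length_take] at hp ⊢
        rw [min_eq_left (by omega)] at hp ⊢
        rw [← p.take_word (Nat.le_succ n), hp, List.take_take]
        simp
      have hylast := hwm y.toWord.length le_rfl
      rw [List.take_length] at hylast
      rw [Measure.prod_prod, measure_sdiff hsub (measurableSet_prefixCylinder _).nullMeasurableSet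
        (measure_ne_top _ _), hwm n (by omega), hwm (n + 1) (by omega), hylast,
        ← ENNReal.ofReal_sub _ (hw0 _), ← mul_assoc, ← ENNReal.ofReal_mul (by
          have : (0 : ℝ) ≤ 2 * k - 1 := by linarith
          positivity), ENNReal.ofReal_mul' (hw0 _)]
      congr 2
      have hk1 : (2 * k - 1) ≠ 0 := by linarith
      have hk0 : k ≠ 0 := by linarith
    · subst h0
      simp only [hw]
      simp
      field_simp
    · obtain ⟨i, rfl⟩ : ∃ i, n = i + 1 := ⟨n - 1, by omega⟩
      simp only [hw]
      simp
      field_simp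
      ring
  have hsum : ∀ M : ℕ, ∑ n ∈ Finset.range (M + 1),
      (if n = 0 then (1 : ℝ) else (2 * k - 1) ^ n - (2 * k - 1) ^ (n - 1)) = (2 * k - 1) ^ M := by
    intro M
    induction M with
    | zero => simp
    | succ M ih =>
      rw [Finset.sum_range_succ, ih]
      simp
  have hpow : ∀ i : ℕ, (2 * k - 1) ^ i ≤ (2 * k - 1) ^ (i + 1) := by
    intro i
    exact pow_le_pow_right₀ (by linarith) (Nat.le_succ i)
  rw [uniformCurrent_apply, uniformPairMeasure_apply]
  simp only [← hkdef, ← hμ, hterm]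
  rw [tsum_eq_sum (s := Finset.range (m + 1)) (by
    intro n hn
    rw [Finset.mem_range] at hn
    rw [if_neg (by omega)])]
  rw [Finset.sum_congr rfl (fun n hn => if_pos (by
    rw [Finset.mem_range] at hn; omega)), ← ENNReal.ofReal_sum_of_nonneg, ← Finset.sum_mul, hsum]
  · congr 1
    have hk1 : (2 * k - 1) ≠ 0 := by linarith
    have hk0 : k ≠ 0 := by linarith
    simp only [hw]
    rw [if_neg (by omega), hyl, show m + b.length - 1 = m + (b.length - 1) by omega, pow_add]
    field_simp
  · intro n _
    refine mul_nonneg ?_ (hw0 _)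
    split_ifs with h0
    · exact zero_le_one
    · obtain ⟨i, rfl⟩ : ∃ i, n = i + 1 := ⟨n - 1, by omega⟩
      have := hpow i
      simpa using this

theorem uniformCurrent_of_fork [DecidableEq α] [Fintype α] (x y : FreeGroup α) (P a b : List (α × Bool)) (s t : α × Bool)
    (hst : s ≠ t) (hx : x.toWord = P ++ s :: a) (hy : y.toWord = P ++ t :: b) :
    uniformCurrent α (segmentCylinder x y) = ENNReal.ofReal
      (1 / (2 * Fintype.card α * (2 * Fintype.card α - 1) ^ (a.length + b.length + 1))) := by
  have hne : Nonempty α := ⟨s.1⟩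
  have hk : (1 : ℝ) ≤ Fintype.card α := by exact_mod_cast (Fintype.card_pos : 0 < Fintype.card α)
  have hxl := congrArg List.length hx
  have hyl := congrArg List.length hy
  rw [List.length_append, List.length_cons] at hxl hyl
  have hset : (Subtype.val '' segmentCylinder x y : Set (Boundary α × Boundary α)) =
      prefixCylinder x.toWord ×ˢ prefixCylinder y.toWord ∧
      (prefixCylinder x.toWord ×ˢ prefixCylinder y.toWord : Set (Boundary α × Boundary α)) ⊆
        separationSet α P.length := by
    have hsub : (prefixCylinder x.toWord ×ˢ prefixCylinder y.toWord :
        Set (Boundary α × Boundary α)) ⊆ separationSet α P.length := by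
      rintro ⟨p, q⟩ ⟨hp, hq⟩
      simp only [prefixCylinder, Set.mem_ofPred_eq] at hp hq
      refine ⟨?_, ?_⟩
      · change p.word _ = q.word _
        rw [← p.take_word (show P.length ≤ x.toWord.length by omega),
          ← q.take_word (show P.length ≤ y.toWord.length by omega), hp, hq, hx, hy]
        simp
      · change p.letter _ ≠ q.letter _
        rw [← p.getElem_word x.toWord.length P.length (by simp; omega),
          ← q.getElem_word y.toWord.length P.length (by simp; omega),
          List.getElem_of_eq hp, List.getElem_of_eq hx,
          List.getElem_of_eq hq, List.getElem_of_eq hy]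
        simpa using hst
    refine ⟨?_, hsub⟩
    ext z
    constructor
    · rintro ⟨ξ, hξ, rfl⟩
      exact (mem_segmentCylinder_of_fork ξ x y P a b s t hst hx hy).1 hξ
    · intro hz
      refine ⟨⟨z, (commonLength_eq (hsub hz)).1⟩, ?_, rfl⟩
      exact (mem_segmentCylinder_of_fork _ x y P a b s t hst hx hy).2 hz
  rw [uniformCurrent_apply, uniformPairMeasure_apply, hset.1, tsum_eq_single P.length (by
    intro n hn
    have : (prefixCylinder x.toWord ×ˢ prefixCylinder y.toWord : Set (Boundary α × Boundary α)) ∩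
        separationSet α n = ∅ := by
      rw [Set.eq_empty_iff_forall_notMem]
      rintro z ⟨h1, h2⟩
      exact hn (separationSet_unique h2 (hset.2 h1))
    rw [this, measure_empty, mul_zero]), Set.inter_eq_left.2 hset.2, Measure.prod_prod,
    uniformFrequencyMeasure_prefixCylinder _ (by rw [hx]; simp) FreeGroup.isReduced_toWord,
    uniformFrequencyMeasure_prefixCylinder _ (by rw [hy]; simp) FreeGroup.isReduced_toWord]
  have hk2 : (0 : ℝ) < 2 * Fintype.card α - 1 := by linarith
  have hk0 : (Fintype.card α : ℝ) ≠ 0 := by linarith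
  rw [← ENNReal.ofReal_mul (by positivity), ← ENNReal.ofReal_mul (by positivity)]
  congr 1
  rw [hxl, hyl, show P.length + (a.length + 1) - 1 = P.length + a.length by omega,
    show P.length + (b.length + 1) - 1 = P.length + b.length by omega]
  generalize (Fintype.card α : ℝ) = k at *
  have hk1 : (2 * k - 1) ≠ 0 := hk2.ne'
  field_simp
  ring

/-- `η_A = α(μ_A)`: the uniform current gives the cylinder of the segment `[x, y]` the mass that the
uniform frequency measure gives to the cylinder of its label `x⁻¹y`. -/
theorem uniformCurrent_segmentCylinder [DecidableEq α] [Fintype α] (x y : FreeGroup α) (hxy : x ≠ y) :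
    uniformCurrent α (segmentCylinder x y) = uniformFrequencyMeasure α (cylinder (x⁻¹ * y)) := by
  rw [uniformFrequencyMeasure_cylinder _ (fun h => hxy (inv_mul_eq_one.1 h))]
  rcases exists_fork x.toWord y.toWord with h | ⟨b, hb, h⟩ | ⟨b, hb, h⟩ |
      ⟨P, a, b, s, t, hst, h1, h2⟩
  · exact absurd (FreeGroup.toWord_injective h) hxy
  · rw [uniformCurrent_of_prefix x y b hb h, norm_of_prefix x y b h]
  · rw [uniformCurrent_segmentCylinder_swap, uniformCurrent_of_prefix y x b hb h,
      ← FreeGroup.norm_inv_eq, mul_inv_rev, inv_inv, norm_of_prefix y x b h]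
  · rw [uniformCurrent_of_fork x y P a b s t hst h1 h2, norm_of_fork x y P a b s t hst h1 h2]
    rfl

end Measures

section Automorphisms

variable {α : Type*}

/-- The length `L(Φ) = L(Φ η_A) = η_A(Φ⁻¹(B))` of an automorphism. -/
noncomputable def autLength [DecidableEq α] [Fintype α] (Φ : MulAut (FreeGroup α)) : ENNReal :=
  uniformCurrent α (doubleBoundaryMap Φ ⁻¹' baseBall α)

/-- A relabeling automorphism: it permutes the alphabet `A = Σ ∪ Σ⁻¹`, that is, it sends each
`a ∈ Σ` to `e(a)` or `e(a)⁻¹` for a permutation `e` of `Σ`. -/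
def IsRelabeling (τ : MulAut (FreeGroup α)) : Prop :=
  ∃ e : Equiv.Perm α, ∀ a : α,
    τ (FreeGroup.of a) = FreeGroup.of (e a) ∨ τ (FreeGroup.of a) = (FreeGroup.of (e a))⁻¹

/-- A simple automorphism: the composition of an inner automorphism and a relabeling. -/
def IsSimpleAut (σ : MulAut (FreeGroup α)) : Prop :=
  ∃ (g : FreeGroup α) (π : MulAut (FreeGroup α)), IsRelabeling π ∧ σ = MulAut.conj g * π

/-- A Whitehead automorphism of the second kind. -/
def IsWhiteheadSecondKind (τ : MulAut (FreeGroup α)) : Prop :=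
  ∃ a : α, ∀ x : α, τ (FreeGroup.of x) ∈
    ({FreeGroup.of x, FreeGroup.of x * FreeGroup.of a, (FreeGroup.of a)⁻¹ * FreeGroup.of x,
      (FreeGroup.of a)⁻¹ * FreeGroup.of x * FreeGroup.of a} : Set (FreeGroup α))

/-- The product `τ_i τ_{i-1} ⋯ τ_1 σ`. -/
def partialProduct {G : Type*} [Mul G] (τ : ℕ → G) (σ : G) : ℕ → G
  | 0 => σ
  | i + 1 => τ (i + 1) * partialProduct τ σ i

end Automorphisms

end FreeGroupLength

/-! A geodesic (p, q) passes through 1 exactly when p and q have different first letters. Sorting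
the geodesics of Φ⁻¹(B) by the first letter b of Φ(p) gives L(Φ) = Σ_b cap(Φ⁻¹ `star {b}`), where
cap(C) is the mass of the geodesics from C to its complement (`autLength_eq_sum`). The capacity is
thus a function of the compact open cuts {C, Cᶜ} of ∂F. It is invariant under translations
(`capacity_smul`) and strictly submodular on crossing cuts, those with four nonempty corners
(`Crosses.capacity_inter_add_capacity_union_lt`). Every edge of the Cayley graph is such a cut, two
edges never cross, and by uncrossing the edges have the least capacity 1/(2k)
(`edgeCapacity_le_capacity`).

If a set R of letters contains e but not e⁻¹, some Whitehead automorphism ψ turns the cuts of e and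
e⁻¹ into translates of `star R` or its complement, and the cut of any other letter into a translate
of itself (`exists_isWhiteheadSecondKind`). Hence L(ψ⁻¹Φ) < L(Φ) as soon as Φ⁻¹ `star R` is cheaper
than Φ⁻¹ `star {e}`. A non-simple Φ always admits such an R.

Suppose that Φ maps some edge D to a cut that crosses an edge. At a suitable vertex Φ(D) crosses
exactly one edge e (`Crosses.exists_leaf`), and every other direction lies on one side of Φ(D). Up
to translation, a corner of the cuts Φ⁻¹ `star {e}` and D therefore has the form Φ⁻¹ `star R`, and
submodularity makes it cheaper than Φ⁻¹ `star {e}`.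

Suppose that there are no crossings. Then each Φ `star {c}` is a translate of some `star S`. If all
of these are edges, Φ is simple (`isSimpleAut_of_forall_mem_edgeCuts`). If one is not, take R = S:
the preimage Φ⁻¹ `star S` is an edge, so it suffices to find e in S with e⁻¹ outside S whose
preimage is not an edge (`exists_separated_letter`). This is a homological argument. The signed
number of edges with label c leading into a compact open set is additive, translation invariant and
odd under complements. It is 1 on Φ⁻¹ `star S`, but it would be 0 if the preimages of all separated
letters were edges.

A decrease of real lengths does not by itself give termination. The induction runs on
`autComplexity`: the edges crossed by the cuts Φ⁻¹ `star {b}`, plus the number of letters b for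
which this cut has non-minimal capacity. It drops in both cases. -/

open scoped Pointwise

namespace FreeGroupLength

/-! ### Letters, reduced words and rays. -/

section Letters

variable {α : Type*}

@[simp] theorem invLetter_invLetter (s : α × Bool) : invLetter (invLetter s) = s := by
  simp [invLetter]

theorem invLetter_ne (s : α × Bool) : invLetter s ≠ s := fun h => by
  simpa [invLetter] using congrArg Prod.snd h

theorem invLetter_eq_iff {s t : α × Bool} : invLetter s = t ↔ s = invLetter t :=
  ⟨fun h => by rw [← h, invLetter_invLetter], fun h => by rw [h, invLetter_invLetter]⟩

theorem reducedPair_iff {s t : α × Bool} : (s.1 = t.1 → s.2 = t.2) ↔ t ≠ invLetter s := by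
  constructor
  · rintro h rfl
    simp [invLetter] at h
  · intro h h1
    by_contra h2
    refine h (Prod.ext h1.symm ?_)
    revert h2
    simp only [invLetter]
    cases s.2 <;> cases t.2 <;> simp

theorem isReduced_cons_cons {s t : α × Bool} {l : List (α × Bool)} :
    FreeGroup.IsReduced (s :: t :: l) ↔ t ≠ invLetter s ∧ FreeGroup.IsReduced (t :: l) := by
  unfold FreeGroup.IsReduced
  rw [List.isChain_cons_cons, reducedPair_iff]

theorem isReduced_append_singleton {l : List (α × Bool)} {s t : α × Bool} :
    FreeGroup.IsReduced (l ++ [s] ++ [t]) ↔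
      FreeGroup.IsReduced (l ++ [s]) ∧ t ≠ invLetter s := by
  unfold FreeGroup.IsReduced
  rw [List.isChain_append (l₁ := l ++ [s]), ← reducedPair_iff]
  simp

theorem IsReduced.tail {s : α × Bool} {l : List (α × Bool)} (h : FreeGroup.IsReduced (s :: l)) :
    FreeGroup.IsReduced l := h.infix (List.suffix_cons _ _).isInfix

theorem eq_or_eq_invLetter {b e : α × Bool} (h : b.1 = e.1) : b = e ∨ b = invLetter e := by
  obtain ⟨x, _ | _⟩ := b <;> obtain ⟨y, _ | _⟩ := e <;> simp_all [invLetter]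

theorem mk_singleton_inv (s : α × Bool) :
    (FreeGroup.mk [s])⁻¹ = FreeGroup.mk [invLetter s] := by
  rw [FreeGroup.inv_mk]; rfl

theorem mk_cons (s : α × Bool) (l : List (α × Bool)) :
    FreeGroup.mk (s :: l) = FreeGroup.mk [s] * FreeGroup.mk l := by
  rw [FreeGroup.mul_mk]; rfl

theorem mk_singleton_injective : Function.Injective fun s : α × Bool => FreeGroup.mk [s] := by
  classical
  intro s t h
  have := congrArg FreeGroup.toWord h
  simpa [FreeGroup.toWord_mk] using this

end Letters

namespace Boundary

variable {α : Type*}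

/-- The ray `s x`. -/
def cons (s : α × Bool) (x : Boundary α) (h : x.letter 0 ≠ invLetter s) : Boundary α where
  letter
    | 0 => s
    | n + 1 => x.letter n
  reduced
    | 0 => h
    | n + 1 => x.reduced n

/-- The ray `x` without its first letter. -/
def tail (x : Boundary α) : Boundary α := ⟨fun n => x.letter (n + 1), fun n => x.reduced (n + 1)⟩

@[simp] theorem letter_cons_zero (s : α × Bool) (x : Boundary α) (h) :
    (cons s x h).letter 0 = s := rfl

@[simp] theorem tail_cons (s : α × Bool) (x : Boundary α) (h) : (cons s x h).tail = x := rfl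

theorem word_succ_eq_cons (x : Boundary α) (n : ℕ) :
    x.word (n + 1) = x.letter 0 :: x.tail.word n := by
  simp only [word, List.range_succ_eq_map, List.map_cons, List.map_map]
  rfl

theorem tail_letter_zero_ne (x : Boundary α) : x.tail.letter 0 ≠ invLetter (x.letter 0) :=
  x.reduced 0

/-- The ray `s s s ⋯`. -/
def const (s : α × Bool) : Boundary α := ⟨fun _ => s, fun _ h => invLetter_ne s h.symm⟩

theorem pre_succ_eq (x : Boundary α) (n : ℕ) :
    x.pre (n + 1) = FreeGroup.mk [x.letter 0] * x.tail.pre n := by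
  rw [pre, word_succ_eq_cons, mk_cons]; rfl

end Boundary

/-! ### The actions of Aut(F) and of F on the boundary. -/

section Action

variable {α : Type*} [DecidableEq α]

/-- Right multiplication by the fixed element g⁻¹ affects only a bounded number of final letters, so
it does not change the limit. This identifies the boundary extension of conjugation by g with left
translation by g. -/
theorem convergesTo_translation {g : FreeGroup α} {u : ℕ → FreeGroup α} {y : Boundary α}
    (h : ConvergesTo (fun n => g * u n) y) : ConvergesTo (fun n => MulAut.conj g (u n)) y := by
  intro m
  filter_upwards [h m, h (m + g.norm)] with n h1 h2
  rw [MulAut.conj_apply, ← h1, ← FreeGroup.mk_toWord (x := g⁻¹)]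
  apply take_toWord_mul
  have := le_norm_of_take_eq h2
  have h3 : (g⁻¹).toWord.length = g.norm := FreeGroup.norm_inv_eq
  omega

variable [Fintype α]

noncomputable instance instMulActionBoundary : MulAction (MulAut (FreeGroup α)) (Boundary α) where
  smul := boundaryMap
  one_smul := boundaryMap_one
  mul_smul := boundaryMap_mul

/-- The action of `F` on `∂F` by left translations. -/
noncomputable instance instTranslationBoundary : MulAction (FreeGroup α) (Boundary α) :=
  MulAction.compHom _ MulAut.conj

theorem conj_smul_set (g : FreeGroup α) (C : Set (Boundary α)) : MulAut.conj g • C = g • C := rfl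

/-- In Aut(F), Φ composed with conjugation by g is conjugation by Φ(g) composed with Φ. Translations
thus pass through Φ, which allows cuts to be treated up to translation. -/
theorem aut_smul_translation_smul (Φ : MulAut (FreeGroup α)) (g : FreeGroup α) (x : Boundary α) :
    Φ • g • x = Φ g • Φ • x := by
  change Φ • MulAut.conj g • x = MulAut.conj (Φ g) • Φ • x
  rw [smul_smul, smul_smul]
  congr 1
  ext h
  simp [MulAut.conj_apply]

theorem aut_smul_translation_smul_set (Φ : MulAut (FreeGroup α)) (g : FreeGroup α)
    (C : Set (Boundary α)) : Φ • g • C = Φ g • Φ • C := by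
  simp only [← Set.image_smul, Set.image_image, aut_smul_translation_smul]

theorem letter_smul_of_ne (s : α × Bool) (x : Boundary α) (h : x.letter 0 ≠ invLetter s) :
    FreeGroup.mk [s] • x = x.cons s h := by
  refine (boundaryMap_spec (MulAut.conj (FreeGroup.mk [s])) x).unique (convergesTo_translation ?_)
  intro m
  filter_upwards [Filter.eventually_ge_atTop m] with n hn
  rw [show FreeGroup.mk [s] * x.pre n = (x.cons s h).pre (n + 1) by
    rw [Boundary.pre_succ_eq]; simp, Boundary.toWord_pre, Boundary.take_word _ (by omega)]

theorem letter_smul_of_eq (s : α × Bool) (x : Boundary α) (h : x.letter 0 = invLetter s) :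
    FreeGroup.mk [s] • x = x.tail := by
  refine (boundaryMap_spec (MulAut.conj (FreeGroup.mk [s])) x).unique (convergesTo_translation ?_)
  intro m
  filter_upwards [Filter.eventually_ge_atTop (m + 1)] with n hn
  obtain ⟨n, rfl⟩ : ∃ i, n = i + 1 := ⟨n - 1, by omega⟩
  rw [Boundary.pre_succ_eq, h, ← mk_singleton_inv, mul_inv_cancel_left, Boundary.toWord_pre,
    Boundary.take_word _ (by omega)]

end Action

/-! ### Cylinders and stars under translation. -/

section Cylinders

variable {α : Type*}

/-- The rays with first letter in `S`. -/
def star (S : Set (α × Bool)) : Set (Boundary α) := {x | x.letter 0 ∈ S}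

@[simp] theorem mem_star {S : Set (α × Bool)} {x : Boundary α} : x ∈ star S ↔ x.letter 0 ∈ S :=
  Iff.rfl

theorem star_compl (S : Set (α × Bool)) : star Sᶜ = (star S)ᶜ := rfl

theorem prefixCylinder_singleton (b : α × Bool) : prefixCylinder [b] = star {b} := by
  ext x
  simp [prefixCylinder, Boundary.word]

theorem mem_prefixCylinder_cons {s : α × Bool} {l : List (α × Bool)} {x : Boundary α} :
    x ∈ prefixCylinder (s :: l) ↔ x.letter 0 = s ∧ x.tail ∈ prefixCylinder l := by
  simp only [prefixCylinder, Set.mem_ofPred_eq, List.length_cons, Boundary.word_succ_eq_cons,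
    List.cons.injEq]

theorem mem_prefixCylinder_append {l l' : List (α × Bool)} {x : Boundary α}
    (h : x ∈ prefixCylinder (l ++ l')) : x ∈ prefixCylinder l := by
  simp only [prefixCylinder, Set.mem_ofPred_eq] at h ⊢
  rw [← x.take_word (show l.length ≤ (l ++ l').length by simp), h]
  simp

theorem mem_prefixCylinder_concat {l : List (α × Bool)} {b : α × Bool} {x : Boundary α} :
    x ∈ prefixCylinder (l ++ [b]) ↔ x ∈ prefixCylinder l ∧ x.letter l.length = b := by
  simp only [prefixCylinder, Set.mem_ofPred_eq, List.length_append, List.length_singleton,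
    Boundary.word_succ]
  constructor
  · intro h
    have := List.append_inj h (by simp)
    exact ⟨this.1, by simpa using this.2⟩
  · rintro ⟨h1, h2⟩
    rw [h1, h2]

theorem star_singleton_nonempty (b : α × Bool) : (star {b}).Nonempty :=
  ⟨Boundary.const b, rfl⟩

theorem prefixCylinder_subset_star {t : α × Bool} {l : List (α × Bool)} :
    prefixCylinder (t :: l) ⊆ star {t} := fun _ hx => (mem_prefixCylinder_cons.1 hx).1

theorem star_singleton_compl_nonempty (b : α × Bool) : (star {b})ᶜ.Nonempty :=
  ⟨Boundary.const (invLetter b), fun h => invLetter_ne b h⟩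

theorem prefixCylinder_nil : prefixCylinder ([] : List (α × Bool)) = Set.univ := by
  ext x
  simp [prefixCylinder, Boundary.word]

theorem mem_prefixCylinder_word (x : Boundary α) (n : ℕ) : x ∈ prefixCylinder (x.word n) := by
  simp [prefixCylinder]

/-- Two cylinders are nested or disjoint. -/
theorem prefixCylinder_trichotomy (l l' : List (α × Bool)) :
    prefixCylinder l ⊆ prefixCylinder l' ∨ prefixCylinder l' ⊆ prefixCylinder l ∨
      Disjoint (prefixCylinder l) (prefixCylinder l') := by
  by_cases hd : Disjoint (prefixCylinder l) (prefixCylinder l')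
  · exact Or.inr (Or.inr hd)
  · obtain ⟨x, hx, hx'⟩ := Set.not_disjoint_iff.1 hd
    simp only [prefixCylinder, Set.mem_ofPred_eq] at hx hx'
    have key : ∀ {m n : ℕ}, m ≤ n →
        prefixCylinder (x.word n) ⊆ prefixCylinder (x.word m) := by
      intro m n hmn y hy
      simp only [prefixCylinder, Set.mem_ofPred_eq, Boundary.length_word] at hy ⊢
      rw [← y.take_word hmn, hy, x.take_word hmn]
    rw [← hx, ← hx']
    rcases le_total l.length l'.length with h | h
    · exact Or.inr (Or.inl (key h))
    · exact Or.inl (key h)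

variable [DecidableEq α] [Fintype α]

theorem mem_letter_smul {s : α × Bool} {x : Boundary α} {C : Set (Boundary α)} :
    x ∈ FreeGroup.mk [s] • C ↔ FreeGroup.mk [invLetter s] • x ∈ C := by
  rw [Set.mem_smul_set_iff_inv_smul_mem, mk_singleton_inv]

theorem letter_smul_prefixCylinder {s t : α × Bool} {l : List (α × Bool)} (h : t ≠ invLetter s) :
    FreeGroup.mk [s] • prefixCylinder (t :: l) = prefixCylinder (s :: t :: l) := by
  ext x
  rw [mem_letter_smul, mem_prefixCylinder_cons (s := s)]
  by_cases hx : x.letter 0 = s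
  · rw [letter_smul_of_eq _ _ (by rw [hx, invLetter_invLetter])]
    simp [hx]
  · rw [letter_smul_of_ne _ _ (by rwa [invLetter_invLetter]), mem_prefixCylinder_cons]
    simp [hx, h.symm]

/-- The edge between 1 and s, seen from its two endpoints. -/
theorem letter_smul_star_inv (s : α × Bool) :
    FreeGroup.mk [s] • star {invLetter s} = (star {s})ᶜ := by
  ext x
  rw [mem_letter_smul]
  by_cases hx : x.letter 0 = s
  · rw [letter_smul_of_eq _ _ (by rw [hx, invLetter_invLetter])]
    have := x.tail_letter_zero_ne
    rw [hx] at this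
    simp [hx, this]
  · rw [letter_smul_of_ne _ _ (by rwa [invLetter_invLetter])]
    simp [hx]

theorem star_compl_eq_smul (s : α × Bool) :
    (star {s})ᶜ = FreeGroup.mk [s] • star {invLetter s} := (letter_smul_star_inv s).symm

theorem mk_smul_star {l : List (α × Bool)} {b : α × Bool} (h : FreeGroup.IsReduced (l ++ [b])) :
    FreeGroup.mk l • star {b} = prefixCylinder (l ++ [b]) := by
  induction l with
  | nil =>
    rw [← FreeGroup.one_eq_mk, one_smul, List.nil_append, prefixCylinder_singleton]
  | cons s l ih =>
    rw [mk_cons, mul_smul, ih h.tail]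
    cases l with
    | nil => exact letter_smul_prefixCylinder (isReduced_cons_cons.1 h).1
    | cons t l => exact letter_smul_prefixCylinder (isReduced_cons_cons.1 h).1

theorem mk_smul_star_inv {l : List (α × Bool)} {b : α × Bool} (h : FreeGroup.IsReduced (l ++ [b])) :
    FreeGroup.mk (l ++ [b]) • star {invLetter b} = (prefixCylinder (l ++ [b]))ᶜ := by
  rw [← FreeGroup.mul_mk, mul_smul, letter_smul_star_inv, Set.smul_set_compl, mk_smul_star h]

theorem prefixCylinder_nonempty [Nonempty α] {l : List (α × Bool)} (h : FreeGroup.IsReduced l) :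
    (prefixCylinder l).Nonempty := by
  rcases List.eq_nil_or_concat l with rfl | ⟨l, b, rfl⟩
  · rw [prefixCylinder_nil]
    exact ⟨Boundary.const (Classical.arbitrary α, true), trivial⟩
  · rw [List.concat_eq_append] at h ⊢
    rw [← mk_smul_star h, Set.smul_set_nonempty]
    exact ⟨Boundary.const b, rfl⟩

end Cylinders

/-! ### Compact open subsets of the boundary. -/

section FinitelyDetermined

variable {α : Type*}

/-- Membership in `C` depends on the first `n` letters only. -/
def IsLevel (n : ℕ) (C : Set (Boundary α)) : Prop :=
  ∀ ⦃x y : Boundary α⦄, x.word n = y.word n → x ∈ C → y ∈ C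

/-- The compact open subsets of the boundary: membership depends on finitely many letters. -/
def FinitelyDetermined (C : Set (Boundary α)) : Prop := ∃ n, IsLevel n C

theorem IsLevel.mono {m n : ℕ} {C : Set (Boundary α)} (h : IsLevel m C) (hmn : m ≤ n) :
    IsLevel n C := fun x y hxy =>
  h (by rw [← x.take_word hmn, ← y.take_word hmn, hxy])

theorem IsLevel.compl {n : ℕ} {C : Set (Boundary α)} (h : IsLevel n C) : IsLevel n Cᶜ :=
  fun _ _ hxy hx hy => hx (h hxy.symm hy)

theorem IsLevel.inter {n : ℕ} {C D : Set (Boundary α)} (hC : IsLevel n C) (hD : IsLevel n D) :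
    IsLevel n (C ∩ D) := fun _ _ hxy hx => ⟨hC hxy hx.1, hD hxy hx.2⟩

theorem isLevel_prefixCylinder (l : List (α × Bool)) : IsLevel l.length (prefixCylinder l) :=
  fun _ _ hxy hx => hxy.symm.trans hx

theorem isLevel_star (S : Set (α × Bool)) : IsLevel 1 (star S) := by
  intro x y hxy hx
  rw [mem_star, ← (Boundary.word_eq_iff x y 1).1 hxy 0 one_pos]
  exact hx

theorem IsLevel.prefixCylinder_subset {l : List (α × Bool)} {C : Set (Boundary α)}
    (h : IsLevel l.length C) {x : Boundary α} (hx : x ∈ prefixCylinder l) (hxC : x ∈ C) :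
    prefixCylinder l ⊆ C := fun _ hy => h (hx.trans hy.symm) hxC

namespace FinitelyDetermined

theorem compl {C : Set (Boundary α)} (h : FinitelyDetermined C) : FinitelyDetermined Cᶜ :=
  h.imp fun _ => IsLevel.compl

theorem inter {C D : Set (Boundary α)} (hC : FinitelyDetermined C) (hD : FinitelyDetermined D) :
    FinitelyDetermined (C ∩ D) := by
  obtain ⟨m, hm⟩ := hC
  obtain ⟨n, hn⟩ := hD
  exact ⟨max m n, (hm.mono (le_max_left _ _)).inter (hn.mono (le_max_right _ _))⟩

theorem union {C D : Set (Boundary α)} (hC : FinitelyDetermined C) (hD : FinitelyDetermined D) :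
    FinitelyDetermined (C ∪ D) := by
  rw [← compl_compl (C ∪ D), Set.compl_union]
  exact (hC.compl.inter hD.compl).compl

theorem sdiff {C D : Set (Boundary α)} (hC : FinitelyDetermined C) (hD : FinitelyDetermined D) :
    FinitelyDetermined (C \ D) := hC.inter hD.compl

end FinitelyDetermined

theorem finitelyDetermined_star (S : Set (α × Bool)) : FinitelyDetermined (star S) :=
  ⟨1, isLevel_star S⟩

theorem finitelyDetermined_prefixCylinder (l : List (α × Bool)) :
    FinitelyDetermined (prefixCylinder l) := ⟨_, isLevel_prefixCylinder l⟩

variable [DecidableEq α] [Fintype α]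

/-- Uniform continuity of Φ⁻¹ for the prefix topology: the first m letters of a ray determine the
first j letters of its image. -/
theorem FinitelyDetermined.smul (Φ : MulAut (FreeGroup α)) {C : Set (Boundary α)}
    (h : FinitelyDetermined C) : FinitelyDetermined (Φ • C) := by
  obtain ⟨j, hj⟩ := h
  obtain ⟨m, hm⟩ := exists_take_eq Φ⁻¹ j
  refine ⟨m, fun x y hxy hx => ?_⟩
  rw [Set.mem_smul_set_iff_inv_smul_mem] at hx ⊢
  refine hj ?_ hx
  obtain ⟨n, ⟨h1, h2⟩, h3⟩ := (((boundaryMap_spec Φ⁻¹ x j).and (boundaryMap_spec Φ⁻¹ y j)).and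
    (Filter.eventually_ge_atTop m)).exists
  change (boundaryMap Φ⁻¹ x).word j = (boundaryMap Φ⁻¹ y).word j
  rw [← h1, ← h2]
  have hlen : ∀ z : Boundary α, m ≤ (z.pre n).norm := fun z => by
    rw [FreeGroup.norm, z.toWord_pre, z.length_word]; exact h3
  refine (hm _ _ (hlen x) (hlen y) ?_).2
  rw [x.toWord_pre, y.toWord_pre, x.take_word h3, y.take_word h3, hxy]

theorem FinitelyDetermined.translate (g : FreeGroup α) {C : Set (Boundary α)}
    (h : FinitelyDetermined C) : FinitelyDetermined (g • C) := h.smul (MulAut.conj g)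

end FinitelyDetermined

/-! ### Crossing cuts. -/

section Crossing

variable {β : Type*}

/-- The four corners of the pair of subsets `C`, `E` are nonempty. -/
def Crosses (C E : Set β) : Prop :=
  (C ∩ E).Nonempty ∧ (C ∩ Eᶜ).Nonempty ∧ (Cᶜ ∩ E).Nonempty ∧ (Cᶜ ∩ Eᶜ).Nonempty

theorem Crosses.symm {C E : Set β} (h : Crosses C E) : Crosses E C := by
  obtain ⟨h1, h2, h3, h4⟩ := h
  exact ⟨Set.inter_comm C E ▸ h1, Set.inter_comm Cᶜ E ▸ h3, Set.inter_comm C Eᶜ ▸ h2,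
    Set.inter_comm Cᶜ Eᶜ ▸ h4⟩

theorem Crosses.compl_right {C E : Set β} (h : Crosses C E) : Crosses C Eᶜ := by
  obtain ⟨h1, h2, h3, h4⟩ := h
  exact ⟨h2, by rwa [compl_compl], h4, by rwa [compl_compl]⟩

theorem Crosses.compl_left {C E : Set β} (h : Crosses C E) : Crosses Cᶜ E :=
  h.symm.compl_right.symm

theorem crosses_compl_right {C E : Set β} : Crosses C Eᶜ ↔ Crosses C E :=
  ⟨fun h => by simpa using h.compl_right, Crosses.compl_right⟩

theorem crosses_compl_left {C E : Set β} : Crosses Cᶜ E ↔ Crosses C E :=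
  ⟨fun h => by simpa using h.compl_left, Crosses.compl_left⟩

theorem crosses_smul {G : Type*} [Group G] [MulAction G β] (g : G) {C E : Set β} :
    Crosses (g • C) (g • E) ↔ Crosses C E := by
  unfold Crosses
  simp only [← Set.smul_set_compl, ← Set.smul_set_inter, Set.smul_set_nonempty]

theorem crosses_smul_left {G : Type*} [Group G] [MulAction G β] (g : G) {C E : Set β} :
    Crosses (g • C) E ↔ Crosses C (g⁻¹ • E) := by
  rw [← crosses_smul g (E := g⁻¹ • E), smul_inv_smul]

/-- If E met both C and Cᶜ, all four corners would be nonempty. -/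
theorem subset_or_subset_of_not_crosses {C E : Set β} (h : ¬ Crosses C E)
    (h1 : (C ∩ Eᶜ).Nonempty) (h2 : (Cᶜ ∩ Eᶜ).Nonempty) : E ⊆ C ∨ E ⊆ Cᶜ := by
  by_contra hne
  rw [not_or, Set.not_subset, Set.not_subset] at hne
  obtain ⟨⟨x, hx, hx'⟩, ⟨y, hy, hy'⟩⟩ := hne
  exact h ⟨⟨y, not_not.1 hy', hy⟩, h1, ⟨x, hx', hx⟩, h2⟩

/-- As E does not cross D while C ∩ D meets both E and Eᶜ, one of E, Eᶜ lies inside D. That side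
meets Cᶜ because it is not contained in C ∩ D, and the other side contains the point of Cᶜ ∩ Dᶜ. -/
theorem Crosses.of_inter {C D E : Set β} (hCD : Crosses C D) (hED : ¬ Crosses E D)
    (h : Crosses (C ∩ D) E) : Crosses C E := by
  obtain ⟨h1, h2, h3, h4⟩ := h
  obtain ⟨x, ⟨hxC, hxD⟩, hxE⟩ := h1
  obtain ⟨y, ⟨hyC, hyD⟩, hyE⟩ := h2
  obtain ⟨z, hzC, hzD⟩ := hCD.2.2.2
  refine ⟨⟨x, hxC, hxE⟩, ⟨y, hyC, hyE⟩, ?_⟩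
  by_cases hE : E ⊆ D
  · obtain ⟨w, hw, hwE⟩ := h3
    exact ⟨⟨w, fun hwC => hw ⟨hwC, hE hwE⟩, hwE⟩, ⟨z, hzC, fun hz => hzD (hE hz)⟩⟩
  · have hE' : Eᶜ ⊆ D := by
      intro u hu
      by_contra huD
      obtain ⟨v, hv, hvD⟩ := Set.not_subset.1 hE
      exact hED ⟨⟨x, hxE, hxD⟩, ⟨v, hv, hvD⟩, ⟨y, hyE, hyD⟩, ⟨u, hu, huD⟩⟩
    obtain ⟨w, hw, hwE⟩ := h4
    refine ⟨⟨z, hzC, ?_⟩, ⟨w, fun hwC => hw ⟨hwC, hE' hwE⟩, hwE⟩⟩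
    by_contra hz
    exact hzD (hE' hz)

end Crossing

section Words

variable {α : Type*}

theorem not_crosses_prefixCylinder (l l' : List (α × Bool)) :
    ¬ Crosses (prefixCylinder l) (prefixCylinder l') := by
  rintro ⟨⟨x, hx, hx'⟩, ⟨y, hy, hy'⟩, ⟨z, hz, hz'⟩, -⟩
  rcases prefixCylinder_trichotomy l l' with h | h | h
  · exact hy' (h hy)
  · exact hz (h hz')
  · exact Set.disjoint_left.1 h hx hx'

/-- A cylinder of level at least n lies on one side of a set of level n. -/
theorem length_lt_of_crosses {n : ℕ} {C : Set (Boundary α)} (hC : IsLevel n C)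
    {l : List (α × Bool)} (h : Crosses C (prefixCylinder l)) : l.length < n := by
  by_contra hn
  obtain ⟨⟨x, hxC, hx⟩, -, ⟨y, hyC, hy⟩, -⟩ := h
  exact hyC ((hC.mono (not_lt.1 hn)).prefixCylinder_subset hx hxC hy)

/-- Used to find a vertex beyond which a given cut becomes trivial in every forward direction. -/
theorem exists_maximal_word {p : List (α × Bool) → Prop} (n : ℕ) (hn : ∀ l, p l → l.length ≤ n)
    (h : ∃ l, p l) : ∃ l, p l ∧ ∀ b, ¬ p (l ++ [b]) := by
  by_contra hne
  push Not at hne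
  have : ∀ m, ∃ l, p l ∧ m ≤ l.length := by
    intro m
    induction m with
    | zero => exact h.imp fun l hl => ⟨hl, Nat.zero_le _⟩
    | succ m ih =>
      obtain ⟨l, hl, hm⟩ := ih
      obtain ⟨b, hb⟩ := hne l hl
      exact ⟨_, hb, by simpa using hm⟩
  obtain ⟨l, hl, hm⟩ := this (n + 1)
  have := hn l hl
  omega

theorem eq_star_of_forall_subset {C : Set (Boundary α)}
    (h : ∀ b : α × Bool, star {b} ⊆ C ∨ star {b} ⊆ Cᶜ) : C = star {b | star {b} ⊆ C} := by
  ext x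
  rw [mem_star, Set.mem_ofPred_eq]
  refine ⟨fun hx => (h _).resolve_right fun h' => ?_, fun hx => hx rfl⟩
  exact h' rfl hx

end Words

/-! ### Edges of the Cayley graph as cuts, and crossing numbers. -/

section EdgeCuts

variable {α : Type*} [DecidableEq α] [Fintype α]

/-- The two-sided partitions of the boundary given by the oriented edges of the Cayley graph. -/
def edgeCuts (α : Type*) [DecidableEq α] [Fintype α] : Set (Set (Boundary α)) :=
  {E | ∃ (g : FreeGroup α) (b : α × Bool), E = g • star {b}}

theorem star_mem_edgeCuts (b : α × Bool) : star {b} ∈ edgeCuts α := ⟨1, b, (one_smul _ _).symm⟩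

theorem smul_mem_edgeCuts (g : FreeGroup α) {E : Set (Boundary α)} (h : E ∈ edgeCuts α) :
    g • E ∈ edgeCuts α := by
  obtain ⟨g', b, rfl⟩ := h
  exact ⟨g * g', b, smul_smul _ _ _⟩

theorem smul_mem_edgeCuts_iff (g : FreeGroup α) {E : Set (Boundary α)} :
    g • E ∈ edgeCuts α ↔ E ∈ edgeCuts α :=
  ⟨fun h => by simpa using smul_mem_edgeCuts g⁻¹ h, smul_mem_edgeCuts g⟩

theorem compl_mem_edgeCuts {E : Set (Boundary α)} (h : E ∈ edgeCuts α) : Eᶜ ∈ edgeCuts α := by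
  obtain ⟨g, b, rfl⟩ := h
  rw [← Set.smul_set_compl, star_compl_eq_smul]
  exact smul_mem_edgeCuts _ (smul_mem_edgeCuts _ (star_mem_edgeCuts _))

/-- The half-space at a vertex in direction `b`. -/
theorem mk_smul_star_cases {l : List (α × Bool)} (hl : FreeGroup.IsReduced l) (b : α × Bool) :
    (FreeGroup.IsReduced (l ++ [b]) ∧ FreeGroup.mk l • star {b} = prefixCylinder (l ++ [b])) ∨
      (∃ l', l = l' ++ [invLetter b] ∧ FreeGroup.mk l • star {b} = (prefixCylinder l)ᶜ) := by
  rcases List.eq_nil_or_concat l with rfl | ⟨l, t, rfl⟩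
  · exact Or.inl ⟨by simp, mk_smul_star (by simp)⟩
  · rw [List.concat_eq_append] at hl ⊢
    by_cases hb : b = invLetter t
    · subst hb
      exact Or.inr ⟨l, by simp, mk_smul_star_inv hl⟩
    · have h := isReduced_append_singleton.2 ⟨hl, hb⟩
      exact Or.inl ⟨h, mk_smul_star h⟩

/-- An oriented edge points either away from 1, and is then a cylinder, or towards 1, and is then
the complement of one. -/
theorem exists_prefixCylinder_of_mem_edgeCuts {E : Set (Boundary α)} (h : E ∈ edgeCuts α) :
    ∃ l, l ≠ [] ∧ FreeGroup.IsReduced l ∧ (E = prefixCylinder l ∨ E = (prefixCylinder l)ᶜ) := by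
  obtain ⟨g, b, rfl⟩ := h
  have hg : FreeGroup.IsReduced g.toWord := FreeGroup.isReduced_toWord
  rcases mk_smul_star_cases hg b with ⟨h1, h2⟩ | ⟨l', h1, h2⟩
  · rw [FreeGroup.mk_toWord] at h2
    exact ⟨_, by simp, h1, Or.inl h2⟩
  · rw [FreeGroup.mk_toWord] at h2
    exact ⟨_, by rw [h1]; simp, hg, Or.inr h2⟩

theorem prefixCylinder_mem_edgeCuts {l : List (α × Bool)} (h0 : l ≠ [])
    (h : FreeGroup.IsReduced l) : prefixCylinder l ∈ edgeCuts α := by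
  rcases List.eq_nil_or_concat l with rfl | ⟨l, t, rfl⟩
  · exact absurd rfl h0
  · rw [List.concat_eq_append] at h ⊢
    exact ⟨FreeGroup.mk l, t, (mk_smul_star h).symm⟩

theorem finitelyDetermined_of_mem_edgeCuts {E : Set (Boundary α)} (h : E ∈ edgeCuts α) :
    FinitelyDetermined E := by
  obtain ⟨g, b, rfl⟩ := h
  exact (finitelyDetermined_star _).translate g

theorem not_crosses_of_mem_edgeCuts {D E : Set (Boundary α)} (hD : D ∈ edgeCuts α)
    (hE : E ∈ edgeCuts α) : ¬ Crosses D E := by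
  obtain ⟨l, -, -, hl⟩ := exists_prefixCylinder_of_mem_edgeCuts hD
  obtain ⟨l', -, -, hl'⟩ := exists_prefixCylinder_of_mem_edgeCuts hE
  rcases hl with rfl | rfl <;> rcases hl' with rfl | rfl <;>
    simpa only [crosses_compl_left, crosses_compl_right] using not_crosses_prefixCylinder l l'

/-- The number of edges of the Cayley graph crossed by a subset of the boundary. -/
noncomputable def crossingNumber (C : Set (Boundary α)) : ℕ :=
  {E | E ∈ edgeCuts α ∧ Crosses C E}.ncard

/-- A crossed edge comes from a word shorter than the level of C, and the alphabet is finite.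
Without this, `ncard` could take its default value 0. -/
theorem finite_crossing {C : Set (Boundary α)} (hC : FinitelyDetermined C) :
    {E | E ∈ edgeCuts α ∧ Crosses C E}.Finite := by
  obtain ⟨n, hn⟩ := hC
  have hfin := List.finite_length_lt (α × Bool) n
  refine ((hfin.image prefixCylinder).union (hfin.image fun l => (prefixCylinder l)ᶜ)).subset ?_
  rintro E ⟨hE, hCE⟩
  obtain ⟨l, -, -, rfl | rfl⟩ := exists_prefixCylinder_of_mem_edgeCuts hE
  · exact Or.inl ⟨l, length_lt_of_crosses hn hCE, rfl⟩
  · exact Or.inr ⟨l, length_lt_of_crosses hn (crosses_compl_right.1 hCE), rfl⟩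

theorem crossingNumber_compl (C : Set (Boundary α)) : crossingNumber Cᶜ = crossingNumber C := by
  simp only [crossingNumber, crosses_compl_left]

theorem crossingNumber_smul (g : FreeGroup α) (C : Set (Boundary α)) :
    crossingNumber (g • C) = crossingNumber C := by
  rw [crossingNumber, crossingNumber, ← Set.ncard_image_of_injective
    {E | E ∈ edgeCuts α ∧ Crosses C E} (MulAction.injective g)]
  congr 1
  ext E
  simp only [Set.mem_image, Set.mem_ofPred_eq]
  constructor
  · rintro ⟨h1, h2⟩
    exact ⟨g⁻¹ • E, ⟨smul_mem_edgeCuts _ h1, (crosses_smul_left g).1 h2⟩, smul_inv_smul _ _⟩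
  · rintro ⟨E, ⟨h1, h2⟩, rfl⟩
    exact ⟨smul_mem_edgeCuts _ h1, (crosses_smul g).2 h2⟩

theorem crossingNumber_eq_zero_of_mem_edgeCuts {C : Set (Boundary α)} (h : C ∈ edgeCuts α) :
    crossingNumber C = 0 := by
  have : {E | E ∈ edgeCuts α ∧ Crosses C E} = ∅ := by
    ext E
    simp only [Set.mem_ofPred_eq, Set.mem_empty_iff_false, iff_false, not_and]
    exact not_crosses_of_mem_edgeCuts h
  rw [crossingNumber, this, Set.ncard_empty]

/-- By `Crosses.of_inter`, every edge crossed by C ∩ D is crossed by C. The edge D itself is crossed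
by C but not by its subset C ∩ D. -/
theorem crossingNumber_inter_lt {C D : Set (Boundary α)} (hC : FinitelyDetermined C)
    (hD : D ∈ edgeCuts α) (h : Crosses C D) : crossingNumber (C ∩ D) < crossingNumber C := by
  refine Set.ncard_lt_ncard ⟨?_, fun hsub => ?_⟩ (finite_crossing hC)
  · rintro E ⟨hE, hCE⟩
    exact ⟨hE, h.of_inter (not_crosses_of_mem_edgeCuts hE hD) hCE⟩
  · obtain ⟨-, -, ⟨x, hx, -⟩, -⟩ := hsub ⟨hD, h⟩
    obtain ⟨-, ⟨y, ⟨-, hy⟩, hy'⟩, -⟩ := (hsub ⟨hD, h⟩).2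
    exact hy' hy

/-- A compact open set which crosses an edge of the Cayley graph crosses exactly one edge at
a suitable vertex. -/
theorem Crosses.exists_leaf {C E : Set (Boundary α)} (hC : FinitelyDetermined C)
    (hE : E ∈ edgeCuts α) (h : Crosses C E) : ∃ (g : FreeGroup α) (e : α × Bool),
      Crosses (g • C) (star {e}) ∧ ∀ b ≠ e, star {b} ⊆ g • C ∨ star {b} ⊆ (g • C)ᶜ := by
  obtain ⟨n, hn⟩ := hC
  -- A longest word whose cylinder is crossed; the vertex at its end is the required one.
  obtain ⟨l, ⟨hl0, hl, hCl⟩, hmax⟩ := exists_maximal_word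
    (p := fun l => l ≠ [] ∧ FreeGroup.IsReduced l ∧ Crosses C (prefixCylinder l)) n
    (fun l hl => (length_lt_of_crosses hn hl.2.2).le) (by
      obtain ⟨l, h0, h1, h2⟩ := exists_prefixCylinder_of_mem_edgeCuts hE
      refine ⟨l, h0, h1, ?_⟩
      rcases h2 with rfl | rfl
      · exact h
      · exact crosses_compl_right.1 h)
  rcases List.eq_nil_or_concat l with rfl | ⟨l, t, rfl⟩
  · exact absurd rfl hl0
  rw [List.concat_eq_append] at *
  set g := FreeGroup.mk (l ++ [t])
  -- Seen from the end of the word, the crossed edge points back in the direction t⁻¹.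
  have hcr : Crosses (g⁻¹ • C) (star {invLetter t}) := by
    rw [crosses_smul_left, inv_inv, mk_smul_star_inv hl]
    exact hCl.compl_right
  refine ⟨g⁻¹, invLetter t, hcr, fun b hb => ?_⟩
  have hlb := isReduced_append_singleton.2 ⟨hl, hb⟩
  have hsub : star {invLetter t} ⊆ (star {b})ᶜ := by
    rintro x (hx : _ = _) (hx' : _ = _)
    exact hb (hx'.symm.trans hx)
  -- Direction b leads into a longer cylinder, which is uncrossed by maximality. The two corners
  -- outside `star {b}` are inherited from the crossed direction t⁻¹.
  refine subset_or_subset_of_not_crosses (fun hcb => hmax b ⟨by simp, hlb, ?_⟩)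
    (hcr.1.mono (Set.inter_subset_inter_right _ hsub))
    (hcr.2.2.1.mono (Set.inter_subset_inter_right _ hsub))
  rwa [← mk_smul_star hlb, ← crosses_smul g⁻¹, inv_smul_smul]

/-- A compact open set which crosses no edge of the Cayley graph comes from a partition of the
edges at some vertex. -/
theorem exists_eq_smul_star {C : Set (Boundary α)} (hC : FinitelyDetermined C)
    (h0 : C.Nonempty) (h1 : Cᶜ.Nonempty) (h : ∀ E ∈ edgeCuts α, ¬ Crosses C E) :
    ∃ (g : FreeGroup α) (S : Set (α × Bool)), C = g • star S := by
  obtain ⟨n, hn⟩ := hC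
  -- A longest word whose cylinder meets both C and Cᶜ; the empty word qualifies because neither set
  -- is empty.
  obtain ⟨l, ⟨hl, hl1, hl2⟩, hmax⟩ := exists_maximal_word
    (p := fun l => FreeGroup.IsReduced l ∧ (C ∩ prefixCylinder l).Nonempty ∧
      (Cᶜ ∩ prefixCylinder l).Nonempty) n (by
      rintro l ⟨-, ⟨x, hxC, hx⟩, ⟨y, hyC, hy⟩⟩
      by_contra hln
      exact hyC ((hn.mono (not_le.1 hln).le).prefixCylinder_subset hx hxC hy))
      ⟨[], by simp, by simpa [prefixCylinder_nil], by simpa [prefixCylinder_nil]⟩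
  set g := FreeGroup.mk l with hg
  have key : ∀ b : α × Bool, g • star {b} ⊆ C ∨ g • star {b} ⊆ Cᶜ := by
    intro b
    rcases mk_smul_star_cases hl b with ⟨h3, h4⟩ | ⟨l', h3, h4⟩
    · rw [h4]
      by_contra hne
      rw [not_or, Set.not_subset, Set.not_subset] at hne
      obtain ⟨⟨x, hx, hx'⟩, ⟨y, hy, hy'⟩⟩ := hne
      exact hmax b ⟨h3, ⟨y, not_not.1 hy', hy⟩, ⟨x, hx', hx⟩⟩
    · rw [h4]
      -- In the direction back to 1, maximality says nothing; here the hypothesis that C crosses no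
      -- edge is used.
      refine subset_or_subset_of_not_crosses (fun hc => h _ ?_ (crosses_compl_right.1 hc))
        (by rwa [compl_compl]) (by rwa [compl_compl])
      exact prefixCylinder_mem_edgeCuts (by rw [h3]; simp) hl
  refine ⟨g, {b | star {b} ⊆ g⁻¹ • C}, ?_⟩
  rw [← inv_smul_eq_iff]
  refine eq_star_of_forall_subset fun b => ?_
  rw [← Set.smul_set_compl, Set.subset_smul_set_iff, Set.subset_smul_set_iff, inv_inv]
  exact key b

end EdgeCuts

/-! ### Finitely additive functions on compact open sets. -/

section Words

variable {α : Type*}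

theorem eq_of_mem_prefixCylinder {l l' : List (α × Bool)} (h : l.length = l'.length)
    {x : Boundary α} (hx : x ∈ prefixCylinder l) (hx' : x ∈ prefixCylinder l') : l = l' := by
  simp only [prefixCylinder, Set.mem_ofPred_eq] at hx hx'
  rw [← hx, ← hx', h]

theorem finitelyDetermined_biUnion (s : Finset (List (α × Bool))) :
    FinitelyDetermined (⋃ l ∈ s, prefixCylinder l) := by
  classical
  induction s using Finset.induction_on with
  | empty => exact ⟨0, fun x y _ hx => by simp at hx⟩
  | insert l s _ ih =>
    rw [Finset.set_biUnion_insert]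
    exact (finitelyDetermined_prefixCylinder l).union ih

theorem star_insert (b : α × Bool) (S : Set (α × Bool)) : star (insert b S) = star {b} ∪ star S :=
  rfl

theorem disjoint_star {S T : Set (α × Bool)} (h : Disjoint S T) : Disjoint (star S) (star T) := by
  rw [Set.disjoint_left]
  exact fun x hx hx' => Set.disjoint_left.1 h hx hx'

theorem cylinder_mk [DecidableEq α] {l : List (α × Bool)} (h : FreeGroup.IsReduced l) :
    cylinder (FreeGroup.mk l) = prefixCylinder l := by
  rw [cylinder, FreeGroup.toWord_mk, h.reduce_eq]

variable [Fintype α]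

/-- The freely reduced words of length `n`. -/
noncomputable def reducedWords (α : Type*) [Fintype α] (n : ℕ) : Finset (List (α × Bool)) :=
  ((List.finite_length_eq (α × Bool) n).sep FreeGroup.IsReduced).toFinset

@[simp] theorem mem_reducedWords {n : ℕ} {l : List (α × Bool)} :
    l ∈ reducedWords α n ↔ l.length = n ∧ FreeGroup.IsReduced l := by
  simp [reducedWords]

open Classical in
/-- The maximal cylinders of level `n` contained in `C`. -/
noncomputable def wordsInside (n : ℕ) (C : Set (Boundary α)) : Finset (List (α × Bool)) :=
  (reducedWords α n).filter fun l => prefixCylinder l ⊆ C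

@[simp] theorem mem_wordsInside {n : ℕ} {C : Set (Boundary α)} {l : List (α × Bool)} :
    l ∈ wordsInside n C ↔ (l.length = n ∧ FreeGroup.IsReduced l) ∧ prefixCylinder l ⊆ C := by
  simp [wordsInside]

theorem eq_biUnion_wordsInside {n : ℕ} {C : Set (Boundary α)} (hC : IsLevel n C) :
    C = ⋃ l ∈ wordsInside n C, prefixCylinder l := by
  ext x
  simp only [Set.mem_iUnion, mem_wordsInside, exists_prop]
  constructor
  · intro hx
    refine ⟨x.word n, ⟨⟨x.length_word n, x.isReduced_word n⟩, ?_⟩, mem_prefixCylinder_word x n⟩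
    exact (hC.mono (x.length_word n).ge).prefixCylinder_subset (mem_prefixCylinder_word x n) hx
  · rintro ⟨l, ⟨-, hl⟩, hx⟩
    exact hl hx

/-- A finitely additive function of compact open sets is determined by its values on cylinders. -/
theorem eq_sum_wordsInside {M : Type*} [AddCommMonoid M] (m : Set (Boundary α) → M)
    (h0 : m ∅ = 0) (hadd : ∀ A B, FinitelyDetermined A → FinitelyDetermined B → Disjoint A B →
      m (A ∪ B) = m A + m B) {n : ℕ} {C : Set (Boundary α)} (hC : IsLevel n C) :
    m C = ∑ l ∈ wordsInside n C, m (prefixCylinder l) := by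
  classical
  have key : ∀ s : Finset (List (α × Bool)), (∀ l ∈ s, l.length = n) →
      m (⋃ l ∈ s, prefixCylinder l) = ∑ l ∈ s, m (prefixCylinder l) := by
    intro s
    induction s using Finset.induction_on with
    | empty => intro _; simpa using h0
    | insert l s hl ih =>
      intro hs
      rw [Finset.set_biUnion_insert, Finset.sum_insert hl, hadd _ _
        (finitelyDetermined_prefixCylinder l) (finitelyDetermined_biUnion s),
        ih fun l hl => hs l (Finset.mem_insert_of_mem hl)]
      rw [Set.disjoint_left]
      intro x hx hx'
      simp only [Set.mem_iUnion, exists_prop] at hx'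
      obtain ⟨l', hl', hx'⟩ := hx'
      refine hl (eq_of_mem_prefixCylinder ?_ hx hx' ▸ hl')
      rw [hs l (Finset.mem_insert_self _ _), hs l' (Finset.mem_insert_of_mem hl')]
  rw [← key _ fun l hl => (mem_wordsInside.1 hl).1.1, ← eq_biUnion_wordsInside hC]

theorem FinitelyDetermined.measurableSet {C : Set (Boundary α)} (h : FinitelyDetermined C) :
    MeasurableSet C := by
  obtain ⟨n, hn⟩ := h
  rw [eq_biUnion_wordsInside hn]
  exact Finset.measurableSet_biUnion _ fun l _ => measurableSet_prefixCylinder l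

/-- Compact open sets are finite disjoint unions of cylinders of a common level, so a biadditive
function of them is determined by pairs of cylinders. -/
theorem eq_sum_sum_wordsInside (m : Set (Boundary α) → Set (Boundary α) → ENNReal)
    (h0 : ∀ D, m ∅ D = 0) (h0' : ∀ D, m D ∅ = 0)
    (hl : ∀ A B D, FinitelyDetermined A → FinitelyDetermined B → FinitelyDetermined D →
      Disjoint A B → m (A ∪ B) D = m A D + m B D)
    (hr : ∀ A C D, FinitelyDetermined A → FinitelyDetermined C → FinitelyDetermined D →
      Disjoint C D → m A (C ∪ D) = m A C + m A D)
    {n : ℕ} {C D : Set (Boundary α)} (hC : IsLevel n C) (hD : IsLevel n D) :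
    m C D = ∑ u ∈ wordsInside n C, ∑ v ∈ wordsInside n D,
      m (prefixCylinder u) (prefixCylinder v) := by
  rw [eq_sum_wordsInside (fun C => m C D) (h0 D) (fun A B hA hB h => hl A B D hA hB ⟨n, hD⟩ h) hC]
  refine Finset.sum_congr rfl fun u _ => ?_
  exact eq_sum_wordsInside (m (prefixCylinder u)) (h0' _)
    (fun A B hA hB h => hr _ A B (finitelyDetermined_prefixCylinder u) hA hB h) hD

theorem disjoint_of_mem_wordsInside {n : ℕ} {C D : Set (Boundary α)} (h : Disjoint C D)
    {u v : List (α × Bool)} (hu : u ∈ wordsInside n C) (hv : v ∈ wordsInside n D) :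
    Disjoint (prefixCylinder u) (prefixCylinder v) :=
  h.mono (mem_wordsInside.1 hu).2 (mem_wordsInside.1 hv).2

end Words

/-! ### The mass of the geodesics between two sets. -/

section PairMass

open MeasureTheory

variable {α : Type*} [DecidableEq α] [Fintype α]

/-- The mass that the uniform current gives to the geodesics from `C` to `D`. -/
noncomputable def pairMass (C D : Set (Boundary α)) : ENNReal := uniformPairMeasure α (C ×ˢ D)

theorem pairMass_comm (C D : Set (Boundary α)) : pairMass C D = pairMass D C := by
  rw [pairMass, ← uniformPairMeasure_swap, Set.preimage_swap_prod]
  rfl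

theorem pairMass_empty_left (D : Set (Boundary α)) : pairMass ∅ D = 0 := by
  simp [pairMass]

theorem pairMass_union_left {A B : Set (Boundary α)} (D : Set (Boundary α))
    (hB : FinitelyDetermined B) (hD : FinitelyDetermined D) (h : Disjoint A B) :
    pairMass (A ∪ B) D = pairMass A D + pairMass B D := by
  rw [pairMass, Set.union_prod, measure_union _ (hB.measurableSet.prod hD.measurableSet)]
  · rfl
  · exact Set.Disjoint.set_prod_left h _ _

theorem pairMass_union_right (A : Set (Boundary α)) {C D : Set (Boundary α)}
    (hA : FinitelyDetermined A) (hD : FinitelyDetermined D) (h : Disjoint C D) :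
    pairMass A (C ∪ D) = pairMass A C + pairMass A D := by
  rw [pairMass_comm, pairMass_union_left A hD hA h, pairMass_comm C, pairMass_comm D]

/-- Two disjoint cylinders form the cylinder of a segment. -/
theorem pairMass_cylinder [Nonempty α] {x y : FreeGroup α}
    (h : Disjoint (cylinder x) (cylinder y)) :
    x ≠ y ∧ pairMass (cylinder x) (cylinder y) = uniformFrequencyMeasure α (cylinder (x⁻¹ * y)) := by
  have hne : x ≠ y := by
    rintro rfl
    exact (prefixCylinder_nonempty (FreeGroup.isReduced_toWord (x := x))).ne_empty
      (disjoint_self.1 h)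
  refine ⟨hne, ?_⟩
  have hpre : ∀ {l b : List (α × Bool)}, FreeGroup.IsReduced (l ++ b) →
      ¬ Disjoint (prefixCylinder l) (prefixCylinder (l ++ b)) := by
    intro l b hl hd
    obtain ⟨z, hz⟩ := prefixCylinder_nonempty hl
    exact Set.disjoint_left.1 hd (mem_prefixCylinder_append hz) hz
  have hx : FreeGroup.IsReduced x.toWord := FreeGroup.isReduced_toWord
  have hy : FreeGroup.IsReduced y.toWord := FreeGroup.isReduced_toWord
  unfold cylinder at h
  -- Disjoint cylinders come from words neither of which is a prefix of the other. Only the fork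
  -- survives, and there the product of the cylinders is the cylinder of the segment from x to y.
  rcases exists_fork x.toWord y.toWord with h' | ⟨b, -, h'⟩ | ⟨b, -, h'⟩ |
      ⟨P, a, b, s, t, hst, h1, h2⟩
  · exact absurd (FreeGroup.toWord_injective h') hne
  · rw [h'] at h hy
    exact absurd h (hpre hy)
  · rw [h'] at h hx
    exact absurd h.symm (hpre hx)
  · rw [← uniformCurrent_segmentCylinder x y hne, uniformCurrent_apply, pairMass]
    congr 1
    ext z
    constructor
    · rintro ⟨hz1, hz2⟩
      refine ⟨⟨z, fun he => ?_⟩, (mem_segmentCylinder_of_fork _ x y P a b s t hst h1 h2).2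
        ⟨hz1, hz2⟩, rfl⟩
      exact Set.disjoint_left.1 h hz1 (he ▸ hz2)
    · rintro ⟨ξ, hξ, rfl⟩
      exact (mem_segmentCylinder_of_fork ξ x y P a b s t hst h1 h2).1 hξ

/-- The letter s is prepended to the word of g or cancels its first letter. The identity is excluded
because its cylinder is the whole boundary. -/
theorem letter_smul_cylinder {s : α × Bool} {g : FreeGroup α} (h1 : g ≠ 1)
    (h2 : FreeGroup.mk [s] * g ≠ 1) :
    FreeGroup.mk [s] • cylinder g = cylinder (FreeGroup.mk [s] * g) := by
  obtain ⟨l, hl, rfl⟩ : ∃ l, FreeGroup.IsReduced l ∧ g = FreeGroup.mk l :=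
    ⟨g.toWord, FreeGroup.isReduced_toWord, FreeGroup.mk_toWord.symm⟩
  rw [cylinder_mk hl]
  cases l with
  | nil => exact absurd FreeGroup.one_eq_mk.symm h1
  | cons t l =>
    by_cases ht : t = invLetter s
    · subst ht
      rw [mk_cons (invLetter s), ← mk_singleton_inv, mul_inv_cancel_left] at h2 ⊢
      cases l with
      | nil => exact absurd FreeGroup.one_eq_mk.symm h2
      | cons t l =>
        rw [cylinder_mk (IsReduced.tail hl), ← letter_smul_prefixCylinder (isReduced_cons_cons.1 hl).1,
          ← mk_singleton_inv, smul_inv_smul]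
    · rw [letter_smul_prefixCylinder ht, ← mk_cons, cylinder_mk (isReduced_cons_cons.2 ⟨ht, hl⟩)]

theorem pairMass_empty_right (D : Set (Boundary α)) : pairMass D ∅ = 0 := by
  simp [pairMass]

/-- Both sides are biadditive, so it is enough to compare disjoint cylinders of x and y. Their mass
depends on x⁻¹y only, which left multiplication does not change. -/
theorem pairMass_letter_smul [Nonempty α] (s : α × Bool) {C D : Set (Boundary α)}
    (hC : FinitelyDetermined C) (hD : FinitelyDetermined D) (h : Disjoint C D) :
    pairMass (FreeGroup.mk [s] • C) (FreeGroup.mk [s] • D) = pairMass C D := by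
  obtain ⟨m, hm⟩ := hC
  obtain ⟨n, hn⟩ := hD
  -- A common level of at least 2, so that a reduced word w of this length satisfies w ≠ 1 and s w ≠
  -- 1.
  have hC := hm.mono (show m ≤ m + n + 2 by omega)
  have hD := hn.mono (show n ≤ m + n + 2 by omega)
  rw [eq_sum_sum_wordsInside (fun C D => pairMass (FreeGroup.mk [s] • C) (FreeGroup.mk [s] • D))
      (by simp [pairMass_empty_left]) (by simp [pairMass_empty_right])
      (fun A B D _ hB hD h => by
        rw [Set.smul_set_union, pairMass_union_left _ (hB.translate _) (hD.translate _)
          (Set.disjoint_smul_set.2 h)])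
      (fun A C D hA _ hD h => by
        rw [Set.smul_set_union, pairMass_union_right _ (hA.translate _) (hD.translate _)
          (Set.disjoint_smul_set.2 h)]) hC hD,
    eq_sum_sum_wordsInside pairMass pairMass_empty_left pairMass_empty_right
      (fun A B D _ hB hD h => pairMass_union_left _ hB hD h)
      (fun A C D hA _ hD h => pairMass_union_right _ hA hD h) hC hD]
  refine Finset.sum_congr rfl fun u hu => Finset.sum_congr rfl fun v hv => ?_
  have hd := disjoint_of_mem_wordsInside h hu hv
  have hlen : ∀ {w : List (α × Bool)}, w.length = m + n + 2 → FreeGroup.IsReduced w →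
      FreeGroup.mk w ≠ 1 ∧ FreeGroup.mk [s] * FreeGroup.mk w ≠ 1 := by
    intro w hw hr
    have hnorm : (FreeGroup.mk w).norm = m + n + 2 := by
      rw [FreeGroup.norm, FreeGroup.toWord_mk, hr.reduce_eq, hw]
    constructor
    · intro h1
      rw [h1] at hnorm
      simp at hnorm
    · intro h1
      rw [← inv_eq_of_mul_eq_one_right h1, FreeGroup.norm_inv_eq] at hnorm
      have : (FreeGroup.mk [s]).norm ≤ 1 := FreeGroup.norm_mk_le
      omega
  obtain ⟨⟨hu1, hu2⟩, -⟩ := mem_wordsInside.1 hu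
  obtain ⟨⟨hv1, hv2⟩, -⟩ := mem_wordsInside.1 hv
  have hu3 := hlen hu1 hu2
  have hv3 := hlen hv1 hv2
  rw [← cylinder_mk hu2, ← cylinder_mk hv2] at hd ⊢
  have hd' := Set.disjoint_smul_set (a := FreeGroup.mk [s]) |>.2 hd
  rw [letter_smul_cylinder hu3.1 hu3.2, letter_smul_cylinder hv3.1 hv3.2] at hd' ⊢
  rw [(pairMass_cylinder hd).2, (pairMass_cylinder hd').2]
  congr 2
  group

theorem pairMass_smul [Nonempty α] (g : FreeGroup α) {C D : Set (Boundary α)}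
    (hC : FinitelyDetermined C) (hD : FinitelyDetermined D) (h : Disjoint C D) :
    pairMass (g • C) (g • D) = pairMass C D := by
  rw [← FreeGroup.mk_toWord (x := g)]
  induction g.toWord with
  | nil => rw [← FreeGroup.one_eq_mk, one_smul, one_smul]
  | cons s l ih =>
    rw [mk_cons, mul_smul, mul_smul, pairMass_letter_smul s (hC.translate _) (hD.translate _)
      (Set.disjoint_smul_set.2 h), ih]

theorem pairMass_ne_top [Nonempty α] {C D : Set (Boundary α)} (hC : FinitelyDetermined C)
    (hD : FinitelyDetermined D) (h : Disjoint C D) : pairMass C D ≠ ⊤ := by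
  obtain ⟨m, hm⟩ := hC
  obtain ⟨n, hn⟩ := hD
  rw [eq_sum_sum_wordsInside pairMass pairMass_empty_left pairMass_empty_right
      (fun A B D _ hB hD h => pairMass_union_left _ hB hD h)
      (fun A C D hA _ hD h => pairMass_union_right _ hA hD h)
      (hm.mono (le_max_left m n)) (hn.mono (le_max_right m n))]
  refine ENNReal.sum_ne_top.2 fun u hu => ENNReal.sum_ne_top.2 fun v hv => ?_
  have hd := disjoint_of_mem_wordsInside h hu hv
  rw [← cylinder_mk (mem_wordsInside.1 hu).1.2, ← cylinder_mk (mem_wordsInside.1 hv).1.2] at hd ⊢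
  rw [(pairMass_cylinder hd).2]
  exact measure_ne_top _ _

/-- The product of C and D contains a product of two disjoint cylinders, and every nontrivial
segment has a cylinder of positive mass. This is what makes submodularity strict. -/
theorem pairMass_pos [Nonempty α] {C D : Set (Boundary α)} (hC : FinitelyDetermined C)
    (hD : FinitelyDetermined D) (h : Disjoint C D) (hC0 : C.Nonempty) (hD0 : D.Nonempty) :
    0 < pairMass C D := by
  obtain ⟨m, hm⟩ := hC
  obtain ⟨n, hn⟩ := hD
  obtain ⟨x, hx⟩ := hC0
  obtain ⟨y, hy⟩ := hD0
  have hxC := (hm.mono (x.length_word m).ge).prefixCylinder_subset (mem_prefixCylinder_word x m) hx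
  have hyD := (hn.mono (y.length_word n).ge).prefixCylinder_subset (mem_prefixCylinder_word y n) hy
  have hd := h.mono hxC hyD
  refine lt_of_lt_of_le ?_ (measure_mono (Set.prod_mono hxC hyD))
  change 0 < pairMass _ _
  rw [← cylinder_mk (x.isReduced_word m), ← cylinder_mk (y.isReduced_word n)] at hd ⊢
  obtain ⟨hne, he⟩ := pairMass_cylinder hd
  rw [he, uniformFrequencyMeasure_cylinder _ fun h => hne (inv_mul_eq_one.1 h)]
  have hk : (1 : ℝ) ≤ Fintype.card α := by exact_mod_cast (Fintype.card_pos : 0 < Fintype.card α)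
  have hk' : (0 : ℝ) < 2 * Fintype.card α - 1 := by linarith
  rw [ENNReal.ofReal_pos]
  positivity

/-- The segment from b to c goes through 1 and has length 2. -/
theorem pairMass_star_singleton {b c : α × Bool} (h : b ≠ c) :
    pairMass (star {b}) (star {c}) =
      ENNReal.ofReal (1 / (2 * Fintype.card α * (2 * Fintype.card α - 1))) := by
  have : Nonempty α := ⟨b.1⟩
  have hw : ∀ b : α × Bool, star {b} = cylinder (FreeGroup.mk [b]) := fun b => by
    rw [cylinder_mk (by simp), prefixCylinder_singleton]
  have hd : Disjoint (star {b}) (star {c}) := by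
    rw [Set.disjoint_left]
    rintro x (hx : _ = _) (hx' : _ = _)
    exact h (hx.symm.trans hx')
  rw [hw b, hw c] at hd ⊢
  obtain ⟨hne, he⟩ := pairMass_cylinder hd
  rw [he, uniformFrequencyMeasure_cylinder _ fun h => hne (inv_mul_eq_one.1 h),
    norm_of_fork _ _ [] [] [] b c h (by simp) (by simp)]
  simp

theorem pairMass_star_singleton_left {b : α × Bool} {T : Finset (α × Bool)} (h : b ∉ T) :
    pairMass (star {b}) (star (T : Set (α × Bool))) = T.card *
      ENNReal.ofReal (1 / (2 * Fintype.card α * (2 * Fintype.card α - 1))) := by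
  induction T using Finset.induction_on with
  | empty =>
    rw [Finset.coe_empty, show star (∅ : Set (α × Bool)) = ∅ from rfl, pairMass_empty_right]
    simp
  | insert c T hc ih =>
    rw [Finset.mem_insert, not_or] at h
    rw [Finset.coe_insert, star_insert, pairMass_union_right _ (finitelyDetermined_star _)
      (finitelyDetermined_star _) (disjoint_star (by simpa using hc)),
      pairMass_star_singleton h.1, Finset.card_insert_of_notMem hc, ih h.2]
    push_cast
    ring

theorem pairMass_star {S T : Finset (α × Bool)} (h : Disjoint S T) :
    pairMass (star (S : Set (α × Bool))) (star T) = S.card * T.card *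
      ENNReal.ofReal (1 / (2 * Fintype.card α * (2 * Fintype.card α - 1))) := by
  induction S using Finset.induction_on with
  | empty =>
    rw [Finset.coe_empty, show star (∅ : Set (α × Bool)) = ∅ from rfl, pairMass_empty_left]
    simp
  | insert b S hb ih =>
    rw [Finset.disjoint_insert_left] at h
    rw [Finset.coe_insert, star_insert, pairMass_union_left _ (finitelyDetermined_star _)
      (finitelyDetermined_star _) (disjoint_star (by simpa using hb)), ih h.2,
      Finset.card_insert_of_notMem hb]
    rw [pairMass_star_singleton_left h.1]
    push_cast
    ring

end PairMass

/-! ### The capacity of a cut: submodularity and minimality of edges. -/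

section Capacity

variable {α : Type*} [DecidableEq α] [Fintype α]

/-- The capacity of the cut `{C, Cᶜ}` of the boundary. -/
noncomputable def capacity (C : Set (Boundary α)) : ℝ := (pairMass C Cᶜ).toReal

theorem capacity_compl (C : Set (Boundary α)) : capacity Cᶜ = capacity C := by
  rw [capacity, compl_compl, pairMass_comm, capacity]

theorem capacity_star (S : Finset (α × Bool)) : capacity (star (S : Set (α × Bool))) =
    S.card * (Sᶜ : Finset (α × Bool)).card *
      (1 / (2 * Fintype.card α * (2 * Fintype.card α - 1))) := by
  rw [capacity, ← star_compl, ← Finset.coe_compl, pairMass_star disjoint_compl_right]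
  rcases isEmpty_or_nonempty α with h | h
  · simp
  have hk : (1 : ℝ) ≤ Fintype.card α := by exact_mod_cast (Fintype.card_pos : 0 < Fintype.card α)
  have hk' : (0 : ℝ) < 2 * Fintype.card α - 1 := by linarith
  rw [ENNReal.toReal_mul, ENNReal.toReal_mul, ENNReal.toReal_ofReal (by positivity)]
  simp

/-- The capacity of the cut given by an edge of the Cayley graph. -/
noncomputable def edgeCapacity (α : Type*) [Fintype α] : ℝ := 1 / (2 * Fintype.card α)

theorem card_compl_letters (S : Finset (α × Bool)) :
    ((Sᶜ : Finset (α × Bool)).card : ℝ) = 2 * Fintype.card α - S.card := by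
  rw [Finset.card_compl, Nat.cast_sub (Finset.card_le_univ S), Fintype.card_prod, Fintype.card_bool]
  push_cast
  ring

variable [Nonempty α]

theorem capacity_smul (g : FreeGroup α) {C : Set (Boundary α)} (hC : FinitelyDetermined C) :
    capacity (g • C) = capacity C := by
  rw [capacity, ← Set.smul_set_compl, pairMass_smul g hC hC.compl disjoint_compl_right, capacity]

theorem toReal_pairMass_union_left {A B D : Set (Boundary α)} (hA : FinitelyDetermined A)
    (hB : FinitelyDetermined B) (hD : FinitelyDetermined D) (hAB : Disjoint A B)
    (hAD : Disjoint A D) (hBD : Disjoint B D) :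
    (pairMass (A ∪ B) D).toReal = (pairMass A D).toReal + (pairMass B D).toReal := by
  rw [pairMass_union_left D hB hD hAB,
    ENNReal.toReal_add (pairMass_ne_top hA hD hAD) (pairMass_ne_top hB hD hBD)]

theorem toReal_pairMass_union_right {A C D : Set (Boundary α)} (hA : FinitelyDetermined A)
    (hC : FinitelyDetermined C) (hD : FinitelyDetermined D) (hAC : Disjoint A C)
    (hAD : Disjoint A D) (hCD : Disjoint C D) :
    (pairMass A (C ∪ D)).toReal = (pairMass A C).toReal + (pairMass A D).toReal := by
  rw [pairMass_comm, toReal_pairMass_union_left hC hD hA hCD hAC.symm hAD.symm, pairMass_comm C,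
    pairMass_comm D]

/-- Uncrossing of two cuts. -/
theorem capacity_inter_add_capacity_union {C D : Set (Boundary α)} (hC : FinitelyDetermined C)
    (hD : FinitelyDetermined D) :
    capacity (C ∩ D) + capacity (C ∪ D) + 2 * (pairMass (C \ D) (D \ C)).toReal =
      capacity C + capacity D := by
  -- With the four corners as atoms, each capacity is the sum of the masses between the atoms that
  -- the cut separates.
  obtain ⟨A₁, h₁⟩ : ∃ A, A = C ∩ D := ⟨_, rfl⟩
  obtain ⟨A₂, h₂⟩ : ∃ A, A = C \ D := ⟨_, rfl⟩
  obtain ⟨A₃, h₃⟩ : ∃ A, A = D \ C := ⟨_, rfl⟩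
  obtain ⟨A₄, h₄⟩ : ∃ A, A = (C ∪ D)ᶜ := ⟨_, rfl⟩
  have f₁ : FinitelyDetermined A₁ := h₁ ▸ hC.inter hD
  have f₂ : FinitelyDetermined A₂ := h₂ ▸ hC.sdiff hD
  have f₃ : FinitelyDetermined A₃ := h₃ ▸ hD.sdiff hC
  have f₄ : FinitelyDetermined A₄ := h₄ ▸ (hC.union hD).compl
  have d₁₂ : Disjoint A₁ A₂ := by
    rw [h₁, h₂]; exact Set.disjoint_left.2 fun x hx hx' => hx'.2 hx.2
  have d₁₃ : Disjoint A₁ A₃ := by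
    rw [h₁, h₃]; exact Set.disjoint_left.2 fun x hx hx' => hx'.2 hx.1
  have d₁₄ : Disjoint A₁ A₄ := by
    rw [h₁, h₄]; exact Set.disjoint_left.2 fun x hx hx' => hx' (Or.inl hx.1)
  have d₂₃ : Disjoint A₂ A₃ := by
    rw [h₂, h₃]; exact Set.disjoint_left.2 fun x hx hx' => hx'.2 hx.1
  have d₂₄ : Disjoint A₂ A₄ := by
    rw [h₂, h₄]; exact Set.disjoint_left.2 fun x hx hx' => hx' (Or.inl hx.1)
  have d₃₄ : Disjoint A₃ A₄ := by
    rw [h₃, h₄]; exact Set.disjoint_left.2 fun x hx hx' => hx' (Or.inr hx.1)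
  have e₁ : C = A₁ ∪ A₂ := by rw [h₁, h₂, Set.inter_union_sdiff]
  have e₂ : Cᶜ = A₃ ∪ A₄ := by
    ext x; by_cases hx : x ∈ C <;> by_cases hy : x ∈ D <;> simp [h₃, h₄, hx, hy]
  have e₃ : D = A₁ ∪ A₃ := by rw [h₁, h₃, Set.inter_comm, Set.inter_union_sdiff]
  have e₄ : Dᶜ = A₂ ∪ A₄ := by
    ext x; by_cases hx : x ∈ C <;> by_cases hy : x ∈ D <;> simp [h₂, h₄, hx, hy]
  have e₅ : A₁ᶜ = A₂ ∪ (A₃ ∪ A₄) := by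
    ext x; by_cases hx : x ∈ C <;> by_cases hy : x ∈ D <;> simp [h₁, h₂, h₃, h₄, hx, hy]
  have e₆ : C ∪ D = A₁ ∪ (A₂ ∪ A₃) := by
    ext x; by_cases hx : x ∈ C <;> by_cases hy : x ∈ D <;> simp [h₁, h₂, h₃, hx, hy]
  rw [← h₁, ← h₂, ← h₃]
  have c₁ : capacity C = (pairMass A₁ A₃).toReal + (pairMass A₁ A₄).toReal +
      ((pairMass A₂ A₃).toReal + (pairMass A₂ A₄).toReal) := by
    rw [capacity, e₂]
    nth_rewrite 1 [e₁]
    rw [toReal_pairMass_union_left f₁ f₂ (f₃.union f₄) d₁₂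
      (d₁₃.union_right d₁₄) (d₂₃.union_right d₂₄),
      toReal_pairMass_union_right f₁ f₃ f₄ d₁₃ d₁₄ d₃₄,
      toReal_pairMass_union_right f₂ f₃ f₄ d₂₃ d₂₄ d₃₄]
  have c₂ : capacity D = (pairMass A₁ A₂).toReal + (pairMass A₁ A₄).toReal +
      ((pairMass A₂ A₃).toReal + (pairMass A₃ A₄).toReal) := by
    rw [capacity, e₄]
    nth_rewrite 1 [e₃]
    rw [toReal_pairMass_union_left f₁ f₃ (f₂.union f₄) d₁₃
      (d₁₂.union_right d₁₄) (d₂₃.symm.union_right d₃₄),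
      toReal_pairMass_union_right f₁ f₂ f₄ d₁₂ d₁₄ d₂₄,
      toReal_pairMass_union_right f₃ f₂ f₄ d₂₃.symm d₃₄ d₂₄, pairMass_comm A₃ A₂]
  have c₃ : capacity A₁ = (pairMass A₁ A₂).toReal + ((pairMass A₁ A₃).toReal +
      (pairMass A₁ A₄).toReal) := by
    rw [capacity, e₅, toReal_pairMass_union_right f₁ f₂ (f₃.union f₄) d₁₂
      (d₁₃.union_right d₁₄) (d₂₃.union_right d₂₄),
      toReal_pairMass_union_right f₁ f₃ f₄ d₁₃ d₁₄ d₃₄]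
  have c₄ : capacity (C ∪ D) = (pairMass A₁ A₄).toReal + ((pairMass A₂ A₄).toReal +
      (pairMass A₃ A₄).toReal) := by
    rw [capacity, ← h₄, e₆, toReal_pairMass_union_left f₁ (f₂.union f₃) f₄
      (d₁₂.union_right d₁₃) d₁₄ (d₂₄.union_left d₃₄),
      toReal_pairMass_union_left f₂ f₃ f₄ d₂₃ d₂₄ d₃₄]
  rw [c₁, c₂, c₃, c₄]
  ring

/-- The corners C \ D and D \ C are nonempty, so the term between them in the uncrossing identity is
positive. -/
theorem Crosses.capacity_inter_add_capacity_union_lt {C D : Set (Boundary α)}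
    (hC : FinitelyDetermined C) (hD : FinitelyDetermined D) (h : Crosses C D) :
    capacity (C ∩ D) + capacity (C ∪ D) < capacity C + capacity D := by
  rw [← capacity_inter_add_capacity_union hC hD]
  have hd : Disjoint (C \ D) (D \ C) := Set.disjoint_left.2 fun x hx hx' => hx.2 hx'.1
  have := ENNReal.toReal_pos (pairMass_pos (hC.sdiff hD) (hD.sdiff hC) hd h.2.1
    (by rw [Set.sdiff_eq, Set.inter_comm]; exact h.2.2.1)).ne'
    (pairMass_ne_top (hC.sdiff hD) (hD.sdiff hC) hd)
  linarith

/-- For s letters, s(2k - s) = (2k - 1) + (s - 1)(2k - s - 1). In this form the excess over an edge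
is visibly nonnegative when S and its complement are nonempty. -/
theorem capacity_star_sub (S : Finset (α × Bool)) : capacity (star (S : Set (α × Bool))) =
    edgeCapacity α + (S.card - 1) * ((Sᶜ : Finset (α × Bool)).card - 1) *
      (1 / (2 * Fintype.card α * (2 * Fintype.card α - 1))) := by
  have hk : (1 : ℝ) ≤ Fintype.card α := by exact_mod_cast (Fintype.card_pos : 0 < Fintype.card α)
  have hk' : (2 * Fintype.card α - 1 : ℝ) ≠ 0 := by linarith
  rw [capacity_star, card_compl_letters, edgeCapacity]
  field_simp
  ring

theorem capacity_of_mem_edgeCuts {E : Set (Boundary α)} (h : E ∈ edgeCuts α) :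
    capacity E = edgeCapacity α := by
  obtain ⟨g, b, rfl⟩ := h
  rw [capacity_smul g (finitelyDetermined_star _), ← Finset.coe_singleton, capacity_star_sub]
  simp

/-- Such a cut is a translate of `star S` with S and Sᶜ nonempty. By `capacity_star_sub` its excess
over an edge vanishes only if S or Sᶜ is a single letter. -/
theorem edgeCapacity_le_capacity_of_not_crosses {C : Set (Boundary α)} (hC : FinitelyDetermined C)
    (h0 : C.Nonempty) (h1 : Cᶜ.Nonempty) (h : ∀ E ∈ edgeCuts α, ¬ Crosses C E) :
    edgeCapacity α ≤ capacity C ∧ (capacity C = edgeCapacity α → C ∈ edgeCuts α) := by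
  classical
  obtain ⟨g, S, rfl⟩ := exists_eq_smul_star hC h0 h1 h
  rw [capacity_smul g (finitelyDetermined_star _), smul_mem_edgeCuts_iff]
  rw [Set.smul_set_nonempty] at h0
  rw [← Set.smul_set_compl, Set.smul_set_nonempty] at h1
  obtain ⟨T, rfl⟩ : ∃ T : Finset (α × Bool), S = T := ⟨S.toFinset, by simp⟩
  obtain ⟨x, hx⟩ := h0
  obtain ⟨y, hy⟩ := h1
  have hT : 0 < T.card := Finset.card_pos.2 ⟨_, hx⟩
  have hT' : 0 < (Tᶜ : Finset (α × Bool)).card := Finset.card_pos.2 ⟨_, Finset.mem_compl.2 hy⟩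
  have hTr : (1 : ℝ) ≤ T.card := by exact_mod_cast hT
  have hTr' : (1 : ℝ) ≤ (Tᶜ : Finset (α × Bool)).card := by exact_mod_cast hT'
  have hk : (1 : ℝ) ≤ Fintype.card α := by exact_mod_cast (Fintype.card_pos : 0 < Fintype.card α)
  have hk' : (0 : ℝ) < 2 * Fintype.card α - 1 := by linarith
  have hpos : (0 : ℝ) < 1 / (2 * Fintype.card α * (2 * Fintype.card α - 1)) := by positivity
  rw [capacity_star_sub]
  refine ⟨le_add_of_nonneg_right (mul_nonneg (mul_nonneg (by linarith) (by linarith)) hpos.le), ?_⟩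
  intro he
  rw [add_eq_left, mul_eq_zero, mul_eq_zero, or_iff_left hpos.ne', sub_eq_zero, sub_eq_zero,
    Nat.cast_eq_one, Nat.cast_eq_one, Finset.card_eq_one, Finset.card_eq_one] at he
  obtain ⟨b, hb⟩ | ⟨b, hb⟩ := he
  · rw [hb, Finset.coe_singleton]
    exact star_mem_edgeCuts b
  · rw [← compl_compl (star (T : Set (α × Bool))), ← star_compl, ← Finset.coe_compl, hb,
      Finset.coe_singleton]
    exact compl_mem_edgeCuts (star_mem_edgeCuts b)

/-- Edges of the Cayley graph are cuts of least capacity. -/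
theorem edgeCapacity_le_capacity {C : Set (Boundary α)} (hC : FinitelyDetermined C)
    (h0 : C.Nonempty) (h1 : Cᶜ.Nonempty) : edgeCapacity α ≤ capacity C := by
  induction hn : crossingNumber C using Nat.strong_induction_on generalizing C with
  | _ n ih =>
    by_cases hcr : ∀ E ∈ edgeCuts α, ¬ Crosses C E
    · exact (edgeCapacity_le_capacity_of_not_crosses hC h0 h1 hcr).1
    -- If C crosses E, then C ∩ E and C ∪ E have fewer crossings, so each costs at least one edge by
    -- induction. As E costs exactly one edge, strict submodularity gives the bound for C.
    · push Not at hcr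
      obtain ⟨E, hE, hCE⟩ := hcr
      have hEf := finitelyDetermined_of_mem_edgeCuts hE
      have hlt := hCE.capacity_inter_add_capacity_union_lt hC hEf
      rw [capacity_of_mem_edgeCuts hE] at hlt
      have i1 := ih _ (hn ▸ crossingNumber_inter_lt hC hE hCE) (hC.inter hEf) hCE.1
        (hCE.2.2.1.mono fun x hx hx' => hx.1 hx'.1) rfl
      have hc : Cᶜ ∩ Eᶜ = (C ∪ E)ᶜ := (Set.compl_union C E).symm
      -- The union is treated through its complement Cᶜ ∩ Eᶜ, to which the lemma on intersections
      -- applies.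
      have i2 := ih _ (by
        have := crossingNumber_inter_lt hC.compl (compl_mem_edgeCuts hE)
          hCE.compl_left.compl_right
        rwa [crossingNumber_compl C, hn] at this) (hC.compl.inter hEf.compl) hCE.2.2.2
        (hCE.1.mono fun x hx hx' => hx'.1 hx.1) rfl
      rw [hc, capacity_compl] at i2
      linarith

/-- Cutting off along an edge decreases the capacity. -/
theorem Crosses.capacity_inter_lt {C E : Set (Boundary α)} (hC : FinitelyDetermined C)
    (hE : E ∈ edgeCuts α) (h : Crosses C E) : capacity (C ∩ E) < capacity C := by
  have hEf := finitelyDetermined_of_mem_edgeCuts hE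
  have h1 := h.capacity_inter_add_capacity_union_lt hC hEf
  -- The union costs at least one edge, which is all that E contributes on the other side.
  have h2 := edgeCapacity_le_capacity (hC.union hEf) (h.1.mono fun x hx => Or.inl hx.1)
    (by rw [Set.compl_union]; exact h.2.2.2)
  rw [capacity_of_mem_edgeCuts hE] at h1
  linarith

end Capacity

/-! ### The length of an automorphism as a sum of capacities. -/

section Length

open MeasureTheory

variable {α : Type*} [DecidableEq α]

/-- The vertex of the geodesic closest to 1 is the point where the two rays separate; it is 1
exactly when they separate at once. -/
theorem mem_baseBall_iff (ξ : DoubleBoundary α) :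
    ξ ∈ baseBall α ↔ ξ.1.1.letter 0 ≠ ξ.1.2.letter 0 := by
  have hc := commonLength_mem ξ.2
  constructor
  · rintro ⟨i, hi⟩
    have h := congrArg (fun g => (FreeGroup.toWord g).length) hi
    simp only [geodesicLine_toWord, FreeGroup.toWord_one, List.length_nil] at h
    have h0 : commonLength ξ.1.1 ξ.1.2 = 0 := by
      split_ifs at h <;> rw [Boundary.length_word] at h <;> omega
    rw [h0] at hc
    exact hc.2
  · intro h
    have h0 : (ξ.1.1, ξ.1.2) ∈ separationSet α 0 := ⟨by simp [Boundary.word], h⟩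
    refine ⟨0, ?_⟩
    rw [geodesicLine, separationSet_unique hc h0]
    simp [Boundary.pre, Boundary.word, FreeGroup.one_eq_mk]

variable [Fintype α]

/-- A pair (p, q) lies in Φ⁻¹(B) when Φ(p) and Φ(q) have different first letters. The summand at b
collects the pairs for which Φ(p) starts with b. -/
theorem autLength_eq_sum (Φ : MulAut (FreeGroup α)) :
    autLength Φ = ∑ b : α × Bool, pairMass (Φ⁻¹ • star {b}) (Φ⁻¹ • star {b})ᶜ := by
  have hmem : ∀ (x : Boundary α) (b : α × Bool), x ∈ Φ⁻¹ • star {b} ↔ (Φ • x).letter 0 = b := by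
    intro x b
    rw [Set.mem_smul_set_iff_inv_smul_mem, inv_inv]
    rfl
  have hset : (Subtype.val '' (doubleBoundaryMap Φ ⁻¹' baseBall α) :
      Set (Boundary α × Boundary α)) =
      ⋃ b ∈ (Finset.univ : Finset (α × Bool)), (Φ⁻¹ • star {b}) ×ˢ (Φ⁻¹ • star {b})ᶜ := by
    ext z
    simp only [Set.mem_image, Set.mem_preimage, mem_baseBall_iff, Finset.mem_univ, Set.iUnion_true,
      Set.mem_iUnion, Set.mem_prod, Set.mem_compl_iff, hmem]
    constructor
    · rintro ⟨ξ, hξ, rfl⟩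
      exact ⟨_, rfl, fun h => hξ h.symm⟩
    · rintro ⟨b, h1, h2⟩
      refine ⟨⟨z, fun h => h2 (by rw [← h]; exact h1)⟩, fun h => h2 ?_, rfl⟩
      rw [← h1]
      exact h.symm
  have hf : ∀ b, FinitelyDetermined (Φ⁻¹ • star {b}) := fun b => (finitelyDetermined_star _).smul _
  rw [autLength, uniformCurrent_apply, hset, measure_biUnion_finset]
  · rfl
  · intro b _ c _ hbc
    refine Set.Disjoint.set_prod_left (Set.disjoint_left.2 fun x hx hx' => hbc ?_) _ _
    rw [hmem] at hx hx'
    rw [← hx, ← hx']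
  · exact fun b _ => (hf b).measurableSet.prod (hf b).compl.measurableSet

theorem autLength_lt_autLength [Nonempty α] {Φ Ψ : MulAut (FreeGroup α)}
    (h : ∑ b : α × Bool, capacity (Φ⁻¹ • star {b}) < ∑ b : α × Bool, capacity (Ψ⁻¹ • star {b})) :
    autLength Φ < autLength Ψ := by
  have hf : ∀ (Φ : MulAut (FreeGroup α)) (b : α × Bool), FinitelyDetermined (Φ⁻¹ • star {b}) :=
    fun Φ b => (finitelyDetermined_star _).smul _
  have hne : ∀ (Φ : MulAut (FreeGroup α)) (b : α × Bool),
      pairMass (Φ⁻¹ • star {b}) (Φ⁻¹ • star {b})ᶜ ≠ ⊤ := fun Φ b =>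
    pairMass_ne_top (hf Φ b) (hf Φ b).compl disjoint_compl_right
  have hL : ∀ Φ : MulAut (FreeGroup α), autLength Φ ≠ ⊤ ∧
      (autLength Φ).toReal = ∑ b : α × Bool, capacity (Φ⁻¹ • star {b}) := by
    intro Φ
    rw [autLength_eq_sum]
    exact ⟨ENNReal.sum_ne_top.2 fun b _ => hne Φ b, ENNReal.toReal_sum fun b _ => hne Φ b⟩
  rwa [← ENNReal.toReal_lt_toReal (hL Φ).1 (hL Ψ).1, (hL Φ).2, (hL Ψ).2]

end Length

/-! ### First letters of elements and of their limits. -/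

section Heads

variable {α : Type*} [DecidableEq α]

theorem toWord_letter_mul_of_ne {s : α × Bool} {g : FreeGroup α}
    (h : g.toWord.head? ≠ some (invLetter s)) :
    (FreeGroup.mk [s] * g).toWord = s :: g.toWord := by
  have hr : FreeGroup.IsReduced (s :: g.toWord) := by
    have hg : FreeGroup.IsReduced g.toWord := FreeGroup.isReduced_toWord
    revert h hg
    cases g.toWord with
    | nil => intro _ _; simp
    | cons t l =>
      intro h hg
      exact isReduced_cons_cons.2 ⟨fun ht => h (by rw [ht]; rfl), hg⟩
  conv_lhs => rw [← FreeGroup.mk_toWord (x := g), ← mk_cons, FreeGroup.toWord_mk, hr.reduce_eq]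

theorem head?_letter_mul_of_ne {s : α × Bool} {g : FreeGroup α}
    (h : g.toWord.head? ≠ some (invLetter s)) :
    (FreeGroup.mk [s] * g).toWord.head? = some s := by
  rw [toWord_letter_mul_of_ne h]; rfl

theorem ConvergesTo.head? {g : ℕ → FreeGroup α} {y : Boundary α} (h : ConvergesTo g y) :
    ∀ᶠ n in Filter.atTop, (g n).toWord.head? = some (y.letter 0) := by
  filter_upwards [h 1] with n hn
  have : (g n).toWord.head? = ((g n).toWord.take 1).head? := by cases (g n).toWord <;> rfl
  rw [this, hn]
  simp [Boundary.word]

theorem ConvergesTo.translate [Fintype α] {g : ℕ → FreeGroup α} {y : Boundary α}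
    (h : ConvergesTo g y) (u : FreeGroup α) : ConvergesTo (fun n => u * g n) (u • y) := by
  have h1 := h.map (MulAut.conj u)
  intro m
  filter_upwards [h1 m, h1 (m + u.norm)] with n h2 h3
  change _ = (boundaryMap (MulAut.conj u) y).word m
  have h4 := le_norm_of_take_eq h3
  rw [← h2, ← take_toWord_mul m u.toWord (MulAut.conj u (g n)) h4, FreeGroup.mk_toWord,
    MulAut.conj_apply, inv_mul_cancel_right]

end Heads

/-! ### Whitehead automorphisms and ping-pong on the boundary. -/

section Whitehead

variable {α : Type*} (c : α) (R : Set (α × Bool)) [DecidablePred (· ∈ R)]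

/-- The element by which a Whitehead automorphism multiplies in the direction `b`. -/
def whiteheadFactor (b : α × Bool) : FreeGroup α := if b ∈ R then FreeGroup.mk [(c, true)] else 1

theorem map_whiteheadFactor {f : FreeGroup α →* FreeGroup α}
    (hf : f (FreeGroup.of c) = FreeGroup.of c) (b : α × Bool) :
    f (whiteheadFactor c R b) = whiteheadFactor c R b := by
  unfold whiteheadFactor
  split_ifs
  · exact hf
  · exact map_one f

variable [DecidableEq α]

/-- The endomorphism which fixes `c` and sends every other letter `x` to
`c^(-[x ∈ R]) x c^[x⁻¹ ∈ R]`. -/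
def whiteheadHom : FreeGroup α →* FreeGroup α :=
  FreeGroup.lift fun x => if x = c then FreeGroup.of c else
    (whiteheadFactor c R (x, true))⁻¹ * FreeGroup.of x * whiteheadFactor c R (x, false)

/-- The inverse of `whiteheadHom`. -/
def whiteheadInvHom : FreeGroup α →* FreeGroup α :=
  FreeGroup.lift fun x => if x = c then FreeGroup.of c else
    whiteheadFactor c R (x, true) * FreeGroup.of x * (whiteheadFactor c R (x, false))⁻¹

theorem whiteheadHom_of_self : whiteheadHom c R (FreeGroup.of c) = FreeGroup.of c := by
  simp [whiteheadHom]

theorem whiteheadInvHom_of_self : whiteheadInvHom c R (FreeGroup.of c) = FreeGroup.of c := by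
  simp [whiteheadInvHom]

theorem whiteheadHom_of {x : α} (hx : x ≠ c) : whiteheadHom c R (FreeGroup.of x) =
    (whiteheadFactor c R (x, true))⁻¹ * FreeGroup.of x * whiteheadFactor c R (x, false) := by
  simp [whiteheadHom, hx]

theorem whiteheadInvHom_of {x : α} (hx : x ≠ c) : whiteheadInvHom c R (FreeGroup.of x) =
    whiteheadFactor c R (x, true) * FreeGroup.of x * (whiteheadFactor c R (x, false))⁻¹ := by
  simp [whiteheadInvHom, hx]

/-- The Whitehead automorphism of the set of letters `R`, which separates `c` and `c⁻¹`. -/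
def whiteheadAut : MulAut (FreeGroup α) :=
  MonoidHom.toMulEquiv (whiteheadHom c R) (whiteheadInvHom c R)
    (by
      ext x
      by_cases hx : x = c
      · subst hx
        simp [whiteheadHom_of_self, whiteheadInvHom_of_self]
      · rw [MonoidHom.comp_apply, whiteheadHom_of c R hx, map_mul, map_mul, map_inv,
          map_whiteheadFactor c R (whiteheadInvHom_of_self c R),
          map_whiteheadFactor c R (whiteheadInvHom_of_self c R), whiteheadInvHom_of c R hx,
          MonoidHom.id_apply]
        group)
    (by
      ext x
      by_cases hx : x = c
      · subst hx
        simp [whiteheadHom_of_self, whiteheadInvHom_of_self]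
      · rw [MonoidHom.comp_apply, whiteheadInvHom_of c R hx, map_mul, map_mul, map_inv,
          map_whiteheadFactor c R (whiteheadHom_of_self c R),
          map_whiteheadFactor c R (whiteheadHom_of_self c R), whiteheadHom_of c R hx,
          MonoidHom.id_apply]
        group)

theorem whiteheadAut_apply (g : FreeGroup α) : whiteheadAut c R g = whiteheadHom c R g := rfl

theorem whiteheadAut_isWhiteheadSecondKind : IsWhiteheadSecondKind (whiteheadAut c R) := by
  refine ⟨c, fun x => ?_⟩
  by_cases hx : x = c
  · subst hx
    exact Or.inl (whiteheadHom_of_self x R)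
  · rw [whiteheadAut_apply, whiteheadHom_of c R hx]
    have : FreeGroup.mk [(c, true)] = FreeGroup.of c := rfl
    unfold whiteheadFactor
    split_ifs <;> simp [this]

theorem whiteheadAut_self (ε : Bool) :
    whiteheadAut c R (FreeGroup.mk [(c, ε)]) = FreeGroup.mk [(c, ε)] := by
  cases ε
  · rw [show FreeGroup.mk [(c, false)] = (FreeGroup.of c)⁻¹ from (mk_singleton_inv (c, true)).symm,
      map_inv, whiteheadAut_apply, whiteheadHom_of_self]
  · exact whiteheadHom_of_self c R

theorem whiteheadAut_letter {b : α × Bool} (hb : b.1 ≠ c) :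
    whiteheadAut c R (FreeGroup.mk [b]) =
      (whiteheadFactor c R b)⁻¹ * FreeGroup.mk [b] * whiteheadFactor c R (invLetter b) := by
  obtain ⟨x, _ | _⟩ := b
  · rw [show FreeGroup.mk [(x, false)] = (FreeGroup.of x)⁻¹ from (mk_singleton_inv (x, true)).symm,
      map_inv, whiteheadAut_apply, whiteheadHom_of c R hb]
    simp [invLetter, mul_assoc]
  · exact whiteheadHom_of c R hb

/-- The elements of `F` whose image under the inverse of a Whitehead automorphism starts with the
letter `b`, up to finitely many. -/
def WhiteheadSide (b : α × Bool) (h : FreeGroup α) : Prop :=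
  if b = (c, true) then ∃ s ∈ R, h.toWord.head? = some s
  else if b = (c, false) then ¬ ∃ s ∈ R, (FreeGroup.mk [(c, true)] * h).toWord.head? = some s
  else (whiteheadFactor c R b * h).toWord.head? = some b

variable {c R}

theorem whiteheadSide_true {h : FreeGroup α} :
    WhiteheadSide c R (c, true) h ↔ ∃ s ∈ R, h.toWord.head? = some s := by
  simp [WhiteheadSide]

theorem whiteheadSide_false {h : FreeGroup α} : WhiteheadSide c R (c, false) h ↔
    ¬ ∃ s ∈ R, (FreeGroup.mk [(c, true)] * h).toWord.head? = some s := by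
  simp [WhiteheadSide]

theorem whiteheadSide_of_ne {b : α × Bool} (hb : b.1 ≠ c) {h : FreeGroup α} :
    WhiteheadSide c R b h ↔ (whiteheadFactor c R b * h).toWord.head? = some b := by
  rw [WhiteheadSide, if_neg (by rintro rfl; exact hb rfl), if_neg (by rintro rfl; exact hb rfl)]

theorem eq_true_or_eq_false_or_ne (c : α) (b : α × Bool) :
    b = (c, true) ∨ b = (c, false) ∨ b.1 ≠ c := by
  obtain ⟨x, _ | _⟩ := b <;> by_cases h : x = c <;> simp [h]

/-- The head of an element of a side: it is `c⁻¹` or an element of `R` or the letter itself. -/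
theorem WhiteheadSide.head?_eq (h1 : (c, true) ∈ R) {b : α × Bool} {h : FreeGroup α}
    (hb : WhiteheadSide c R b h) (hc : h.toWord.head? ≠ some (c, false)) :
    (b = (c, true) ∧ ∃ s ∈ R, h.toWord.head? = some s) ∨
      (b.1 ≠ c ∧ b ∉ R ∧ h.toWord.head? = some b) := by
  have hh : (FreeGroup.mk [(c, true)] * h).toWord.head? = some (c, true) :=
    head?_letter_mul_of_ne hc
  rcases eq_true_or_eq_false_or_ne c b with rfl | rfl | hbc
  · exact Or.inl ⟨rfl, whiteheadSide_true.1 hb⟩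
  · exact absurd ⟨_, h1, hh⟩ (whiteheadSide_false.1 hb)
  · rw [whiteheadSide_of_ne hbc, whiteheadFactor] at hb
    split_ifs at hb with hR
    · rw [hh] at hb
      exact absurd (Option.some.inj hb) (by rintro rfl; exact hbc rfl)
    · rw [one_mul] at hb
      exact Or.inr ⟨hbc, hR, hb⟩

/-- When h starts with c⁻¹, multiplication by c deletes this letter, and the side of h is read off
from the next one. -/
theorem WhiteheadSide.head?_mul_eq (h2 : (c, false) ∉ R) {b : α × Bool} {h : FreeGroup α}
    (hb : WhiteheadSide c R b h) (hc : h.toWord.head? = some (c, false)) :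
    (b = (c, false) ∧ ¬ ∃ s ∈ R, (FreeGroup.mk [(c, true)] * h).toWord.head? = some s) ∨
      (b ∈ R ∧ (FreeGroup.mk [(c, true)] * h).toWord.head? = some b) := by
  rcases eq_true_or_eq_false_or_ne c b with rfl | rfl | hbc
  · obtain ⟨s, hs, hs'⟩ := whiteheadSide_true.1 hb
    rw [hc] at hs'
    exact absurd hs (Option.some.inj hs' ▸ h2)
  · exact Or.inl ⟨rfl, whiteheadSide_false.1 hb⟩
  · rw [whiteheadSide_of_ne hbc, whiteheadFactor] at hb
    split_ifs at hb with hR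
    · exact Or.inr ⟨hR, hb⟩
    · rw [one_mul, hc] at hb
      exact absurd (Option.some.inj hb) (by rintro rfl; exact hbc rfl)

/-- If h does not start with c⁻¹, heads in R all give the side of c and any other head gives its own
side. If h starts with c⁻¹, the head of c h plays this role: in R it gives its own side, otherwise
the side is that of c⁻¹. -/
theorem WhiteheadSide.unique (h1 : (c, true) ∈ R) (h2 : (c, false) ∉ R) {b b' : α × Bool}
    {h : FreeGroup α} (hb : WhiteheadSide c R b h) (hb' : WhiteheadSide c R b' h) : b = b' := by
  by_cases hc : h.toWord.head? = some (c, false)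
  · rcases hb.head?_mul_eq h2 hc with ⟨rfl, h3⟩ | ⟨h3, h4⟩ <;>
      rcases hb'.head?_mul_eq h2 hc with ⟨rfl, h5⟩ | ⟨h5, h6⟩
    · rfl
    · exact absurd ⟨_, h5, h6⟩ h3
    · exact absurd ⟨_, h3, h4⟩ h5
    · exact Option.some.inj (h4.symm.trans h6)
  · rcases hb.head?_eq h1 hc with ⟨rfl, s, h3, h4⟩ | ⟨-, h3, h4⟩ <;>
      rcases hb'.head?_eq h1 hc with ⟨rfl, t, h5, h6⟩ | ⟨-, h5, h6⟩
    · rfl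
    · exact absurd h3 (Option.some.inj (h4.symm.trans h6) ▸ h5)
    · exact absurd h5 (Option.some.inj (h4.symm.trans h6) ▸ h3)
    · exact Option.some.inj (h4.symm.trans h6)

theorem not_whiteheadSide_one (h1 : (c, true) ∈ R) (b : α × Bool) :
    ¬ WhiteheadSide c R b 1 := by
  intro hb
  rcases hb.head?_eq h1 (by simp) with ⟨-, s, -, h⟩ | ⟨-, -, h⟩ <;> simp at h

/-- The ping-pong step. For b = c or c⁻¹ it holds by the definition of the side of c⁻¹. For other
letters the factors in the image of b cancel against those in the two sides, and plain
multiplication by b remains. -/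
theorem whiteheadSide_letter_mul {b : α × Bool} {h : FreeGroup α}
    (hb : ¬ WhiteheadSide c R (invLetter b) h) :
    WhiteheadSide c R b (whiteheadAut c R (FreeGroup.mk [b]) * h) := by
  rcases eq_true_or_eq_false_or_ne c b with rfl | rfl | hbc
  · rw [whiteheadAut_self, whiteheadSide_true]
    rwa [show invLetter (c, true) = (c, false) from rfl, whiteheadSide_false, not_not] at hb
  · rw [whiteheadAut_self, whiteheadSide_false, ← mul_assoc,
      show FreeGroup.mk [(c, true)] * FreeGroup.mk [(c, false)] = 1 by
        rw [show FreeGroup.mk [(c, false)] = (FreeGroup.mk [(c, true)])⁻¹ from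
          (mk_singleton_inv (c, true)).symm, mul_inv_cancel], one_mul]
    rwa [show invLetter (c, false) = (c, true) from rfl, whiteheadSide_true] at hb
  · rw [whiteheadAut_letter c R hbc, whiteheadSide_of_ne hbc]
    rw [whiteheadSide_of_ne (b := invLetter b) hbc] at hb
    rw [mul_assoc, mul_assoc, mul_inv_cancel_left]
    exact head?_letter_mul_of_ne hb

/-- Ping-pong along the word: the image of the tail lies on the side of its first letter t ≠ b⁻¹,
hence not on the side of b⁻¹, and the image of b moves it to the side of b. -/
theorem whiteheadSide_aut (h1 : (c, true) ∈ R) (h2 : (c, false) ∉ R) {b : α × Bool}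
    {l : List (α × Bool)} (hl : FreeGroup.IsReduced (b :: l)) :
    WhiteheadSide c R b (whiteheadAut c R (FreeGroup.mk (b :: l))) := by
  induction l generalizing b with
  | nil =>
    rw [← mul_one (whiteheadAut c R _)]
    exact whiteheadSide_letter_mul (not_whiteheadSide_one h1 _)
  | cons t l ih =>
    obtain ⟨h3, h4⟩ := isReduced_cons_cons.1 hl
    rw [mk_cons, map_mul]
    exact whiteheadSide_letter_mul fun h => h3 ((ih h4).unique h1 h2 h)

variable (c R) [Fintype α]

/-- The rays on a side of a Whitehead automorphism. -/
noncomputable def whiteheadSideSet (b : α × Bool) : Set (Boundary α) :=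
  if b = (c, true) then star R
  else if b = (c, false) then (FreeGroup.mk [(c, true)])⁻¹ • (star R)ᶜ
  else (whiteheadFactor c R b)⁻¹ • star {b}

variable {c R}

/-- A side is defined by first letters of h and of its translates, and these stabilise along a
convergent sequence. -/
theorem eventually_whiteheadSide {g : ℕ → FreeGroup α} {y : Boundary α} (h : ConvergesTo g y)
    (b : α × Bool) :
    ∀ᶠ n in Filter.atTop, (WhiteheadSide c R b (g n) ↔ y ∈ whiteheadSideSet c R b) := by
  filter_upwards [h.head?, (h.translate (FreeGroup.mk [(c, true)])).head?,
    (h.translate (whiteheadFactor c R b)).head?] with n e1 e2 e3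
  unfold WhiteheadSide whiteheadSideSet
  rw [e1, e2, e3]
  split_ifs
  · simp
  · simp [Set.mem_smul_set_iff_inv_smul_mem]
  · simp [Set.mem_smul_set_iff_inv_smul_mem]

/-- Ping-pong on the vertices of rays maps each star into its side. The sides are disjoint and the
images of the stars cover the boundary, so the inclusions are equalities. -/
theorem whiteheadAut_smul_star (h1 : (c, true) ∈ R) (h2 : (c, false) ∉ R) (b : α × Bool) :
    whiteheadAut c R • star {b} = whiteheadSideSet c R b := by
  have hsub : ∀ x : Boundary α, whiteheadAut c R • x ∈ whiteheadSideSet c R (x.letter 0) := by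
    intro x
    obtain ⟨n, h, hn⟩ := ((eventually_whiteheadSide (c := c) (R := R)
      (boundaryMap_spec (whiteheadAut c R) x) (x.letter 0)).and (Filter.eventually_ge_atTop 1)).exists
    refine h.1 ?_
    obtain ⟨m, rfl⟩ : ∃ m, n = m + 1 := ⟨n - 1, by omega⟩
    have hr := x.isReduced_word (m + 1)
    rw [Boundary.word_succ_eq_cons] at hr
    simp only [Boundary.pre, Boundary.word_succ_eq_cons]
    exact whiteheadSide_aut h1 h2 hr
  have hdisj : ∀ (y : Boundary α) (b b' : α × Bool), y ∈ whiteheadSideSet c R b →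
      y ∈ whiteheadSideSet c R b' → b = b' := by
    intro y b b' hb hb'
    obtain ⟨n, h, h'⟩ := ((eventually_whiteheadSide (c := c) (R := R) (convergesTo_pre y) b).and
      (eventually_whiteheadSide (c := c) (R := R) (convergesTo_pre y) b')).exists
    exact (h.2 hb).unique h1 h2 (h'.2 hb')
  ext y
  obtain ⟨x, rfl⟩ := MulAction.surjective (whiteheadAut c R) y
  rw [Set.smul_mem_smul_set_iff]
  constructor
  · rintro (rfl : _ = _)
    exact hsub x
  · exact fun h => hdisj _ _ _ (hsub x) h

end Whitehead

/-! ### Replacing the cut of a letter by a prescribed one. -/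

section Cuts

variable {α : Type*} [DecidableEq α] [Fintype α]

/-- A set of letters which separates the letter `e` from its inverse defines a Whitehead
automorphism, which replaces the edges with label `e` by this cut. -/
theorem exists_isWhiteheadSecondKind {e : α × Bool} {R : Set (α × Bool)} (h1 : e ∈ R)
    (h2 : invLetter e ∉ R) : ∃ ψ : MulAut (FreeGroup α), IsWhiteheadSecondKind ψ ∧
      (∀ b : α × Bool, b.1 ≠ e.1 → ∃ g : FreeGroup α, ψ • star {b} = g • star {b}) ∧
      ∀ b : α × Bool, b.1 = e.1 → ∃ g : FreeGroup α,
        ψ • star {b} = g • star R ∨ ψ • star {b} = g • (star R)ᶜ := by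
  classical
  have key : ∀ (c : α) (R : Set (α × Bool)), (c, true) ∈ R → (c, false) ∉ R →
      ∃ ψ : MulAut (FreeGroup α), IsWhiteheadSecondKind ψ ∧
      (∀ b : α × Bool, b.1 ≠ c → ∃ g : FreeGroup α, ψ • star {b} = g • star {b}) ∧
      ∀ b : α × Bool, b.1 = c → ∃ g : FreeGroup α,
        ψ • star {b} = g • star R ∨ ψ • star {b} = g • (star R)ᶜ := by
    intro c R h1 h2
    refine ⟨whiteheadAut c R, whiteheadAut_isWhiteheadSecondKind c R, fun b hb => ?_, ?_⟩
    · rw [whiteheadAut_smul_star h1 h2, whiteheadSideSet,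
        if_neg (by rintro rfl; exact hb rfl), if_neg (by rintro rfl; exact hb rfl)]
      exact ⟨_, rfl⟩
    · rintro ⟨x, _ | _⟩ rfl
      · rw [whiteheadAut_smul_star h1 h2, whiteheadSideSet]
        exact ⟨_, Or.inr (by simp; rfl)⟩
      · rw [whiteheadAut_smul_star h1 h2, whiteheadSideSet]
        exact ⟨1, Or.inl (by simp)⟩
  obtain ⟨c, _ | _⟩ := e
  -- For e = c⁻¹ it is Rᶜ that contains c and not c⁻¹; taking complements merely exchanges the two
  -- alternatives.
  · obtain ⟨ψ, hψ, h3, h4⟩ := key c Rᶜ h2 (not_not.2 h1)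
    refine ⟨ψ, hψ, h3, fun b hb => ?_⟩
    obtain ⟨g, h | h⟩ := h4 b hb
    · exact ⟨g, Or.inr h⟩
    · refine ⟨g, Or.inl ?_⟩
      rw [h, ← star_compl, compl_compl]
  · exact key c R h1 h2

end Cuts

/-! ### The signed count of edges with a given label. -/

section SignedCount

open Filter

variable {α : Type*} [DecidableEq α]

/-- The exponent of the letter `e` in the letter `b`. -/
def letterSign (e b : α × Bool) : ℤ := if b = e then 1 else if b = invLetter e then -1 else 0

theorem letterSign_inv (e b : α × Bool) : letterSign e (invLetter b) = -letterSign e b := by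
  unfold letterSign
  simp only [invLetter_eq_iff, invLetter_invLetter]
  by_cases h : b = e
  · subst h
    simp [(invLetter_ne b).symm]
  · by_cases h' : b = invLetter e
    · simp [h', invLetter_ne]
    · simp [h, h']

/-- The exponent of the letter `e` in the last letter of a word. -/
def lastSign (e : α × Bool) (l : List (α × Bool)) : ℤ := (l.getLast?.map (letterSign e)).getD 0

@[simp] theorem lastSign_concat (e b : α × Bool) (l : List (α × Bool)) :
    lastSign e (l ++ [b]) = letterSign e b := by simp [lastSign]

@[simp] theorem lastSign_cons_cons (e b b' : α × Bool) (l : List (α × Bool)) :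
    lastSign e (b :: b' :: l) = lastSign e (b' :: l) := by simp [lastSign]

variable [Fintype α]

theorem sum_letterSign (e : α × Bool) : ∑ b, letterSign e b = 0 := by
  have h : ∑ b, letterSign e b = ∑ b, letterSign e (invLetter b) :=
    (Equiv.sum_comp (Function.Involutive.toPerm invLetter invLetter_invLetter) _).symm
  simp only [letterSign_inv, Finset.sum_neg_distrib] at h
  omega

/-- The letters that may follow t are all letters but t⁻¹. Since the signs of all letters add up to
0, those of the successors add up to the sign of t; refining a cylinder therefore preserves the sum.
-/
theorem sum_wordsInside_prefixCylinder (e : α × Bool) (d : ℕ) {l : List (α × Bool)} (h0 : l ≠ [])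
    (hl : FreeGroup.IsReduced l) :
    ∑ w ∈ wordsInside (l.length + d) (prefixCylinder l), lastSign e w = lastSign e l := by
  have : Nonempty α := ⟨e.1⟩
  induction d generalizing l with
  | zero =>
    have : wordsInside (l.length + 0) (prefixCylinder l) = {l} := by
      ext w
      rw [mem_wordsInside, Finset.mem_singleton]
      constructor
      · rintro ⟨⟨h1, h2⟩, h3⟩
        obtain ⟨x, hx⟩ := prefixCylinder_nonempty h2
        exact eq_of_mem_prefixCylinder h1 hx (h3 hx)
      · rintro rfl
        exact ⟨⟨rfl, hl⟩, subset_rfl⟩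
    rw [this, Finset.sum_singleton]
  | succ d ih =>
    rcases List.eq_nil_or_concat l with rfl | ⟨l, t, rfl⟩
    · exact absurd rfl h0
    rw [List.concat_eq_append] at *
    -- Words are grouped by the letter that follows l ++ [t].
    have hfib : ∀ b : α × Bool, (wordsInside ((l ++ [t]).length + (d + 1))
        (prefixCylinder (l ++ [t]))).filter (fun w => w.getD (l ++ [t]).length e = b) =
        wordsInside ((l ++ [t] ++ [b]).length + d) (prefixCylinder (l ++ [t] ++ [b])) := by
      intro b
      have hN : (l ++ [t]).length + (d + 1) = (l ++ [t] ++ [b]).length + d := by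
        rw [List.length_append (bs := [b]), List.length_singleton]; omega
      have hlt : (l ++ [t]).length < (l ++ [t]).length + (d + 1) := by omega
      rw [← hN]
      generalize l ++ [t] = l at *
      ext w
      rw [Finset.mem_filter, mem_wordsInside, mem_wordsInside, and_assoc]
      refine and_congr_right fun ⟨h1, h2⟩ => ?_
      have hlet : ∀ x ∈ prefixCylinder w, w.getD l.length e = x.letter l.length := by
        intro x hx
        simp only [prefixCylinder, Set.mem_ofPred_eq] at hx
        rw [List.getD_eq_getElem _ _ (by omega), ← List.getElem_of_eq hx (by simp; omega),
          Boundary.getElem_word]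
      constructor
      · rintro ⟨h3, h4⟩ x hx
        exact mem_prefixCylinder_concat.2 ⟨h3 hx, (hlet x hx).symm.trans h4⟩
      · intro h3
        obtain ⟨x, hx⟩ := prefixCylinder_nonempty h2
        exact ⟨fun y hy => (mem_prefixCylinder_concat.1 (h3 hy)).1,
          (hlet x hx).trans (mem_prefixCylinder_concat.1 (h3 hx)).2⟩
    -- The group of t⁻¹ is empty, as no reduced word continues t by t⁻¹; the induction hypothesis
    -- evaluates the others.
    have hterm : ∀ b : α × Bool,
        ∑ w ∈ wordsInside ((l ++ [t] ++ [b]).length + d) (prefixCylinder (l ++ [t] ++ [b])),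
          lastSign e w = letterSign e b - if b = invLetter t then letterSign e b else 0 := by
      intro b
      split_ifs with hb
      · rw [sub_self]
        refine Finset.sum_eq_zero fun w hw => ?_
        obtain ⟨⟨-, h2⟩, h3⟩ := mem_wordsInside.1 hw
        obtain ⟨x, hx⟩ := prefixCylinder_nonempty h2
        have hr := x.isReduced_word (l ++ [t] ++ [b]).length
        rw [show x.word _ = _ from h3 hx] at hr
        exact absurd hb (isReduced_append_singleton.1 hr).2
      · rw [ih (by simp) (isReduced_append_singleton.2 ⟨hl, hb⟩), lastSign_concat, sub_zero]
    rw [← Finset.sum_fiberwise _ (fun w : List (α × Bool) => w.getD (l ++ [t]).length e)]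
    simp only [hfib, hterm]
    rw [Finset.sum_sub_distrib, sum_letterSign, Finset.sum_ite_eq' Finset.univ]
    simp [letterSign_inv]

/-- The signed number of edges with label `e` that lead into a compact open set, computed from its
cylinders of level `n` for all large `n`. -/
noncomputable def signedCount (e : α × Bool) (C : Set (Boundary α)) : (atTop : Filter ℕ).Germ ℤ :=
  ((fun n => ∑ w ∈ wordsInside n C, lastSign e w : ℕ → ℤ) : (atTop : Filter ℕ).Germ ℤ)

theorem signedCount_empty (e : α × Bool) : signedCount e ∅ = 0 := by
  have : Nonempty α := ⟨e.1⟩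
  refine Germ.coe_eq.2 (Eventually.of_forall fun n => Finset.sum_eq_zero fun w hw => ?_)
  obtain ⟨⟨-, h2⟩, h3⟩ := mem_wordsInside.1 hw
  exact absurd (Set.subset_empty_iff.1 h3) (prefixCylinder_nonempty h2).ne_empty

theorem signedCount_union (e : α × Bool) {A B : Set (Boundary α)} (hA : FinitelyDetermined A)
    (hB : FinitelyDetermined B) (h : Disjoint A B) :
    signedCount e (A ∪ B) = signedCount e A + signedCount e B := by
  have : Nonempty α := ⟨e.1⟩
  obtain ⟨m, hm⟩ := hA
  obtain ⟨m', hm'⟩ := hB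
  refine Germ.coe_eq.2 ?_
  filter_upwards [eventually_ge_atTop (max m m')] with n hn
  have hA := hm.mono ((le_max_left m m').trans hn)
  have hB := hm'.mono ((le_max_right m m').trans hn)
  have hd : Disjoint (wordsInside n A) (wordsInside n B) := by
    rw [Finset.disjoint_left]
    intro w hw hw'
    obtain ⟨x, hx⟩ := prefixCylinder_nonempty (mem_wordsInside.1 hw).1.2
    exact Set.disjoint_left.1 h ((mem_wordsInside.1 hw).2 hx) ((mem_wordsInside.1 hw').2 hx)
  have hu : wordsInside n (A ∪ B) = wordsInside n A ∪ wordsInside n B := by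
    ext w
    simp only [mem_wordsInside, Finset.mem_union]
    rw [← and_or_left]
    refine and_congr_right fun ⟨h1, h2⟩ => ⟨fun h3 => ?_, ?_⟩
    · obtain ⟨x, hx⟩ := prefixCylinder_nonempty h2
      rw [← h1] at hA hB
      exact (h3 hx).imp (hA.prefixCylinder_subset hx) (hB.prefixCylinder_subset hx)
    · rintro (h3 | h3)
      · exact h3.trans Set.subset_union_left
      · exact h3.trans Set.subset_union_right
  change ∑ w ∈ wordsInside n (A ∪ B), lastSign e w = _
  rw [hu, Finset.sum_union hd]

/-- The sum is constant from the level of l on. Working with germs at infinity avoids the choice of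
a level. -/
theorem signedCount_prefixCylinder (e : α × Bool) {l : List (α × Bool)} (h0 : l ≠ [])
    (hl : FreeGroup.IsReduced l) :
    signedCount e (prefixCylinder l) = ((lastSign e l : ℤ) : (atTop : Filter ℕ).Germ ℤ) := by
  refine Germ.coe_eq.2 ?_
  filter_upwards [eventually_ge_atTop l.length] with n hn
  obtain ⟨d, rfl⟩ := Nat.exists_eq_add_of_le hn
  exact sum_wordsInside_prefixCylinder e d h0 hl

theorem signedCount_star_singleton (e b : α × Bool) :
    signedCount e (star {b}) = ((letterSign e b : ℤ) : (atTop : Filter ℕ).Germ ℤ) := by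
  rw [← prefixCylinder_singleton, signedCount_prefixCylinder e (by simp) (by simp)]
  simp [lastSign]

/-- On cylinders of words with at least two letters, s is prepended or cancels the first letter; the
last letter stays the same. -/
theorem signedCount_letter_smul (e s : α × Bool) {C : Set (Boundary α)}
    (hC : FinitelyDetermined C) : signedCount e (FreeGroup.mk [s] • C) = signedCount e C := by
  obtain ⟨n, hn⟩ := hC
  have hC := hn.mono (show n ≤ n + 2 by omega)
  rw [eq_sum_wordsInside (fun C => signedCount e (FreeGroup.mk [s] • C))
      (by simp [signedCount_empty])
      (fun A B hA hB h => by
        rw [Set.smul_set_union, signedCount_union e (hA.translate _) (hB.translate _)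
          (Set.disjoint_smul_set.2 h)]) hC,
    eq_sum_wordsInside (signedCount e) (signedCount_empty e)
      (fun A B hA hB h => signedCount_union e hA hB h) hC]
  refine Finset.sum_congr rfl fun l hl => ?_
  obtain ⟨⟨h1, h2⟩, -⟩ := mem_wordsInside.1 hl
  match l with
  | [] => simp at h1
  | [t] => simp at h1
  | t :: t' :: l =>
    by_cases ht : t = invLetter s
    · subst ht
      rw [← letter_smul_prefixCylinder (isReduced_cons_cons.1 h2).1, ← mk_singleton_inv,
        smul_inv_smul, mk_singleton_inv, letter_smul_prefixCylinder (isReduced_cons_cons.1 h2).1,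
        signedCount_prefixCylinder e (by simp) h2,
        signedCount_prefixCylinder e (by simp) (IsReduced.tail h2), lastSign_cons_cons]
    · rw [letter_smul_prefixCylinder ht, signedCount_prefixCylinder e (by simp) h2,
        signedCount_prefixCylinder e (by simp) (isReduced_cons_cons.2 ⟨ht, h2⟩), lastSign_cons_cons]

theorem signedCount_smul (e : α × Bool) (g : FreeGroup α) {C : Set (Boundary α)}
    (hC : FinitelyDetermined C) : signedCount e (g • C) = signedCount e C := by
  rw [← FreeGroup.mk_toWord (x := g)]
  induction g.toWord with
  | nil => rw [← FreeGroup.one_eq_mk, one_smul]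
  | cons s l ih => rw [mk_cons, mul_smul, signedCount_letter_smul e s (hC.translate _), ih]

/-- By additivity the sum is the count of the whole boundary, whatever C is. For C = `star {e}` the
complement is a translate of the star of e⁻¹, and the two signs cancel. -/
theorem signedCount_add_compl (e : α × Bool) {C : Set (Boundary α)} (hC : FinitelyDetermined C) :
    signedCount e C + signedCount e Cᶜ = 0 := by
  have key : ∀ {C : Set (Boundary α)}, FinitelyDetermined C →
      signedCount e C + signedCount e Cᶜ = signedCount e Set.univ := fun hC => by
    rw [← signedCount_union e hC hC.compl disjoint_compl_right, Set.union_compl_self]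
  rw [key hC, ← key (finitelyDetermined_star {e}), star_compl_eq_smul,
    signedCount_smul e _ (finitelyDetermined_star _), signedCount_star_singleton,
    signedCount_star_singleton, letterSign_inv, Int.cast_neg,
    add_neg_cancel]

end SignedCount

/-! ### Recognising simple automorphisms. -/

section Simple

variable {α : Type*}

/-- An automorphism that permutes the letters is a relabeling. -/
theorem isRelabeling_of_letters [Finite α] {Ψ : MulAut (FreeGroup α)} {f : α × Bool → α × Bool}
    (h : ∀ c, Ψ (FreeGroup.mk [c]) = FreeGroup.mk [f c]) : IsRelabeling Ψ := by
  have hinv : ∀ c, f (invLetter c) = invLetter (f c) := by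
    intro c
    apply mk_singleton_injective
    simp only
    rw [← h, ← mk_singleton_inv, ← mk_singleton_inv, map_inv, h]
  have hinj : Function.Injective f := by
    intro c c' hc
    apply mk_singleton_injective
    apply Ψ.injective
    simp only
    rw [h, h, hc]
  have he : Function.Injective fun a => (f (a, true)).1 := by
    intro a a' haa
    by_cases h2 : (f (a, true)).2 = (f (a', true)).2
    · exact congrArg Prod.fst (hinj (Prod.ext haa h2))
    · have : f (a, true) = f (invLetter (a', true)) := by
        rw [hinv]
        refine Prod.ext haa ?_
        revert h2
        simp only [invLetter]
        cases (f (a, true)).2 <;> cases (f (a', true)).2 <;> simp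
      exact absurd (congrArg Prod.snd (hinj this)) (by simp [invLetter])
  refine ⟨Equiv.ofBijective _ (Finite.injective_iff_bijective.1 he), fun a => ?_⟩
  have ha : Ψ (FreeGroup.of a) = FreeGroup.mk [f (a, true)] := h (a, true)
  rw [ha, Equiv.ofBijective_apply]
  obtain ⟨x, hx⟩ : ∃ x, x = f (a, true) := ⟨_, rfl⟩
  rw [← hx]
  obtain ⟨x, _ | _⟩ := x
  · exact Or.inr (mk_singleton_inv (x, true)).symm
  · exact Or.inl rfl

/-- F is trivial or infinite cyclic, and in the latter case the exponent n with Φ(a) = aⁿ is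
invertible in ℤ. -/
theorem isSimpleAut_of_subsingleton [Subsingleton α] (Φ : MulAut (FreeGroup α)) :
    IsSimpleAut Φ := by
  refine ⟨1, Φ, ⟨Equiv.refl α, fun a => ?_⟩, by simp⟩
  have hpow : ∀ g : FreeGroup α, ∃ n : ℤ, g = FreeGroup.of a ^ n := by
    intro g
    induction g using FreeGroup.induction_on with
    | C1 => exact ⟨0, by simp⟩
    | of x => exact ⟨1, by rw [Subsingleton.elim x a, zpow_one]⟩
    | inv_of x _ => exact ⟨-1, by rw [Subsingleton.elim x a, zpow_neg_one]⟩
    | mul x y hx hy =>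
      obtain ⟨m, rfl⟩ := hx
      obtain ⟨n, rfl⟩ := hy
      exact ⟨m + n, by rw [zpow_add]⟩
  obtain ⟨n, hn⟩ := hpow (Φ (FreeGroup.of a))
  obtain ⟨m, hm⟩ := hpow (Φ⁻¹ (FreeGroup.of a))
  have h1 : FreeGroup.of a = FreeGroup.of a ^ (n * m) := by
    rw [zpow_mul, ← hn, ← map_zpow, ← hm, MulAut.apply_inv_self]
  have h2 := congrArg (FreeGroup.lift fun _ : α => Multiplicative.ofAdd (1 : ℤ)) h1
  rw [map_zpow, FreeGroup.lift_apply_of, ← ofAdd_zsmul] at h2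
  have h3 : n * m = 1 := by
    have := congrArg Multiplicative.toAdd h2
    simpa [mul_comm] using this.symm
  rcases Int.eq_one_or_neg_one_of_mul_eq_one h3 with rfl | rfl
  · exact Or.inl (by simpa using hn)
  · exact Or.inr (by simpa using hn)

variable [DecidableEq α] [Fintype α]

/-- In rank at least 2 there are at least four letters. -/
theorem exists_letter_ne_ne [Nontrivial α] (s t : α × Bool) : ∃ b, b ≠ s ∧ b ≠ t := by
  by_contra! h
  have hsub : (Finset.univ : Finset (α × Bool)) ⊆ {s, t} := fun b _ => by
    simp only [Finset.mem_insert, Finset.mem_singleton]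
    by_contra hb
    rw [not_or] at hb
    exact hb.2 (h b hb.1)
  have h1 := (Finset.card_le_card hsub).trans Finset.card_le_two
  rw [Finset.card_univ, Fintype.card_prod, Fintype.card_bool] at h1
  have : 1 < Fintype.card α := Fintype.one_lt_card
  omega

/-- For g ≠ 1 the translate is either the cylinder of a word with at least two letters, too small to
be a star, or the complement of a cylinder, too large. Both comparisons need a spare letter, hence
rank at least 2. -/
theorem eq_one_of_smul_star_eq [Nontrivial α] {g : FreeGroup α} {d b : α × Bool}
    (h : g • star {d} = star {b}) : g = 1 := by
  have hg : FreeGroup.IsReduced g.toWord := FreeGroup.isReduced_toWord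
  rw [← FreeGroup.mk_toWord (x := g)] at h
  by_contra hg1
  have hne : g.toWord ≠ [] := fun h => hg1 (FreeGroup.toWord_eq_nil_iff.1 h)
  generalize g.toWord = l at h hg hne
  rcases List.eq_nil_or_concat l with rfl | ⟨l, t, rfl⟩
  · exact hne rfl
  rw [List.concat_eq_append] at *
  rcases mk_smul_star_cases hg d with ⟨h1, h2⟩ | ⟨-, -, h2⟩
  · rw [h2] at h
    obtain ⟨d', hd', hdt⟩ := exists_letter_ne_ne d (invLetter t)
    have h3 := isReduced_append_singleton.2 ⟨hg, hdt⟩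
    obtain ⟨x, hx⟩ := prefixCylinder_nonempty h3
    obtain ⟨y, hy⟩ := prefixCylinder_nonempty h1
    have hxy : x.letter 0 = y.letter 0 := by
      have h4 := mem_prefixCylinder_append hx
      have h5 := mem_prefixCylinder_append hy
      exact (Boundary.word_eq_iff x y _).1 (h4.trans h5.symm) 0 (by simp)
    have hyb : y ∈ star {b} := h ▸ hy
    have hx' : x ∈ prefixCylinder (l ++ [t] ++ [d]) := by
      rw [h]
      exact hxy.trans hyb
    exact hd' ((mem_prefixCylinder_concat.1 hx).2.symm.trans (mem_prefixCylinder_concat.1 hx').2)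
  · rw [h2] at h
    obtain ⟨s, l', hl'⟩ : ∃ s l', l ++ [t] = s :: l' := List.exists_cons_of_ne_nil hne
    rw [hl'] at h
    obtain ⟨d', hd', hdt⟩ := exists_letter_ne_ne b s
    obtain ⟨x, hx⟩ := star_singleton_nonempty d'
    have : x ∈ (prefixCylinder (s :: l'))ᶜ := fun hx' =>
      hdt ((show _ = _ from hx).symm.trans (prefixCylinder_subset_star hx'))
    rw [h] at this
    exact hd' ((show _ = _ from hx).symm.trans this)

theorem smul_star_disjoint (Ψ : MulAut (FreeGroup α)) {b c : α × Bool} (h : b ≠ c) :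
    Disjoint (Ψ • star {b}) (Ψ • star {c}) :=
  Set.disjoint_smul_set.2 (disjoint_star (by simpa using h))

/-- An automorphism which maps the edges at the base point to edges of the Cayley graph,
one of them to an edge at the base point, permutes the edges at the base point. -/
theorem exists_smul_star_eq_star [Nontrivial α] {Ψ : MulAut (FreeGroup α)}
    (h : ∀ c : α × Bool, Ψ • star {c} ∈ edgeCuts α) {c₀ b₀ : α × Bool} (h0 : Ψ • star {c₀} = star {b₀}) :
    ∃ f : α × Bool → α × Bool, ∀ c, Ψ • star {c} = star {f c} := by
  have hcyl : ∀ c : α × Bool, ∃ b, Ψ • star {c} ⊆ star {b} := by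
    intro c
    by_cases hc : c = c₀
    · exact ⟨b₀, hc ▸ h0.subset⟩
    obtain ⟨l, hl, -, he | he⟩ := exists_prefixCylinder_of_mem_edgeCuts (h c)
    · obtain ⟨s, l', rfl⟩ := List.exists_cons_of_ne_nil hl
      exact ⟨s, he ▸ prefixCylinder_subset_star⟩
    -- If the image of c were the complement of a cylinder, this cylinder would contain, hence
    -- equal, the image of c₀. The two images would fill the boundary and leave no room for the
    -- image of a third letter.
    · exfalso
      obtain ⟨s, l', rfl⟩ := List.exists_cons_of_ne_nil hl
      have hd := smul_star_disjoint Ψ hc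
      have h1 : Ψ • star {c₀} ⊆ prefixCylinder (s :: l') := fun x hx => by
        by_contra hx'
        exact Set.disjoint_left.1 hd (he ▸ hx') hx
      have h2 : prefixCylinder (s :: l') ⊆ Ψ • star {c₀} := by
        intro x hx
        obtain ⟨y, hy⟩ := star_singleton_nonempty b₀
        have hyl := prefixCylinder_subset_star (h1 (h0 ▸ hy))
        rw [h0]
        exact (prefixCylinder_subset_star hx).trans ((show _ = _ from hyl).symm.trans hy)
      obtain ⟨d, hd1, hd2⟩ := exists_letter_ne_ne c c₀
      obtain ⟨x, hx⟩ := (star_singleton_nonempty d).smul_set (a := Ψ)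
      have hxc := Set.disjoint_left.1 (smul_star_disjoint Ψ hd1) hx
      rw [he, Set.mem_compl_iff, not_not] at hxc
      exact Set.disjoint_left.1 (smul_star_disjoint Ψ hd2) hx (h2 hxc)
  choose f hf using hcyl
  have hcover : ∀ x : Boundary α, ∃ c, x ∈ Ψ • star {c} := fun x => by
    refine ⟨(Ψ⁻¹ • x).letter 0, ?_⟩
    rw [Set.mem_smul_set_iff_inv_smul_mem]
    rfl
  -- The images cover the boundary, so f is onto, hence injective by finiteness, and each inclusion
  -- becomes an equality.
  have hsurj : Function.Surjective f := by
    intro b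
    obtain ⟨x, hx⟩ := star_singleton_nonempty b
    obtain ⟨c, hc⟩ := hcover x
    exact ⟨c, (show _ = _ from hf c hc).symm.trans hx⟩
  have hinj := Finite.injective_iff_surjective.2 hsurj
  refine ⟨f, fun c => (hf c).antisymm fun x hx => ?_⟩
  obtain ⟨c', hc'⟩ := hcover x
  have : f c' = f c := (show _ = _ from hf c' hc').symm.trans hx
  exact hinj this ▸ hc'

/-- An automorphism which maps edges of the Cayley graph to edges is simple. -/
theorem isSimpleAut_of_forall_mem_edgeCuts [Nontrivial α] {Φ : MulAut (FreeGroup α)}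
    (h : ∀ c : α × Bool, Φ • star {c} ∈ edgeCuts α) : IsSimpleAut Φ := by
  obtain ⟨a⟩ : Nonempty α := inferInstance
  obtain ⟨g, b₀, h0⟩ := h (a, true)
  have hΨ : ∀ c : α × Bool, (MulAut.conj g⁻¹ * Φ) • star {c} = g⁻¹ • Φ • star {c} := fun c => by
    rw [mul_smul, conj_smul_set]
  -- After translation by g⁻¹ one of the image edges starts at the base point.
  obtain ⟨f, hf⟩ := exists_smul_star_eq_star (Ψ := MulAut.conj g⁻¹ * Φ)
    (fun c => by rw [hΨ]; exact smul_mem_edgeCuts _ (h c)) (c₀ := (a, true)) (b₀ := b₀)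
    (by rw [hΨ, h0, inv_smul_smul])
  refine ⟨g, MulAut.conj g⁻¹ * Φ, isRelabeling_of_letters (f := f) fun c => ?_, by simp⟩
  generalize MulAut.conj g⁻¹ * Φ = Ψ at hf
  -- The image of the edge between 1 and c, seen from both ends: Ψ(c) and the letter f c carry stars
  -- at the base point to the same half-space, so they coincide.
  have h1 : Ψ (FreeGroup.mk [c]) • star {f (invLetter c)} =
      FreeGroup.mk [f c] • star {invLetter (f c)} := by
    rw [← hf, ← aut_smul_translation_smul_set, letter_smul_star_inv, letter_smul_star_inv,
      Set.smul_set_compl, hf]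
  rw [← inv_smul_eq_iff, smul_smul] at h1
  exact (inv_mul_eq_one.1 (eq_one_of_smul_star_eq h1)).symm

end Simple

/-! ### Shortening a non-simple automorphism. -/

section Reduction

variable {α : Type*} [DecidableEq α] [Fintype α]

open Classical in
/-- A measure of the complexity of a cut of the boundary, which vanishes at the edges of the
Cayley graph. -/
noncomputable def cutComplexity (C : Set (Boundary α)) : ℕ :=
  crossingNumber C + if capacity C = edgeCapacity α then 0 else 1

/-- A measure of the complexity of an automorphism. -/
noncomputable def autComplexity (Φ : MulAut (FreeGroup α)) : ℕ :=
  ∑ b : α × Bool, cutComplexity (Φ⁻¹ • star {b})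

theorem cutComplexity_compl (C : Set (Boundary α)) : cutComplexity Cᶜ = cutComplexity C := by
  simp only [cutComplexity, crossingNumber_compl, capacity_compl]

theorem cutComplexity_smul [Nonempty α] (g : FreeGroup α) {C : Set (Boundary α)}
    (hC : FinitelyDetermined C) : cutComplexity (g • C) = cutComplexity C := by
  simp only [cutComplexity, crossingNumber_smul, capacity_smul g hC]

theorem cutComplexity_eq_zero_of_mem_edgeCuts [Nonempty α] {C : Set (Boundary α)}
    (h : C ∈ edgeCuts α) : cutComplexity C = 0 := by
  simp [cutComplexity, crossingNumber_eq_zero_of_mem_edgeCuts h, capacity_of_mem_edgeCuts h]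

/-- A cut which separates the letter `e` from its inverse and is better than the edges with label
`e` gives a Whitehead automorphism which shortens `Φ`. -/
theorem exists_shortening_of_cut [Nonempty α] (Φ : MulAut (FreeGroup α)) {e : α × Bool}
    {R : Set (α × Bool)} (h1 : e ∈ R) (h2 : invLetter e ∉ R)
    (hcap : ∀ b : α × Bool, b.1 = e.1 → capacity (Φ⁻¹ • star R) < capacity (Φ⁻¹ • star {b}))
    (hcom : ∀ b : α × Bool, b.1 = e.1 →
      cutComplexity (Φ⁻¹ • star R) < cutComplexity (Φ⁻¹ • star {b})) :
    ∃ ψ : MulAut (FreeGroup α), IsWhiteheadSecondKind ψ ∧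
      autLength (ψ⁻¹ * Φ) < autLength Φ ∧ autComplexity (ψ⁻¹ * Φ) < autComplexity Φ := by
  obtain ⟨ψ, hψ, h3, h4⟩ := exists_isWhiteheadSecondKind h1 h2
  have hf : ∀ S : Set (α × Bool), FinitelyDetermined (Φ⁻¹ • star S) := fun S =>
    (finitelyDetermined_star S).smul _
  -- Passing from Φ to ψ⁻¹Φ replaces each `star {b}` by its image under ψ before pulling back by Φ.
  have hsmul : ∀ b : α × Bool, (ψ⁻¹ * Φ)⁻¹ • star {b} = Φ⁻¹ • ψ • star {b} := fun b => by
    rw [mul_inv_rev, inv_inv, mul_smul]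
  have hne : ∀ b : α × Bool, b.1 ≠ e.1 →
      capacity ((ψ⁻¹ * Φ)⁻¹ • star {b}) = capacity (Φ⁻¹ • star {b}) ∧
      cutComplexity ((ψ⁻¹ * Φ)⁻¹ • star {b}) = cutComplexity (Φ⁻¹ • star {b}) := by
    intro b hb
    obtain ⟨g, hg⟩ := h3 b hb
    rw [hsmul, hg, aut_smul_translation_smul_set]
    exact ⟨capacity_smul _ (hf _), cutComplexity_smul _ (hf _)⟩
  have heq : ∀ b : α × Bool, b.1 = e.1 →
      capacity ((ψ⁻¹ * Φ)⁻¹ • star {b}) = capacity (Φ⁻¹ • star R) ∧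
      cutComplexity ((ψ⁻¹ * Φ)⁻¹ • star {b}) = cutComplexity (Φ⁻¹ • star R) := by
    intro b hb
    obtain ⟨g, hg | hg⟩ := h4 b hb
    · rw [hsmul, hg, aut_smul_translation_smul_set]
      exact ⟨capacity_smul _ (hf _), cutComplexity_smul _ (hf _)⟩
    · rw [hsmul, hg, aut_smul_translation_smul_set, Set.smul_set_compl,
        capacity_smul _ (hf _).compl, cutComplexity_smul _ (hf _).compl]
      exact ⟨capacity_compl _, cutComplexity_compl _⟩
  refine ⟨ψ, hψ, autLength_lt_autLength (Finset.sum_lt_sum (fun b _ => ?_)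
    ⟨e, Finset.mem_univ e, ?_⟩), Finset.sum_lt_sum (fun b _ => ?_) ⟨e, Finset.mem_univ e, ?_⟩⟩
  · by_cases hb : b.1 = e.1
    · rw [(heq b hb).1]; exact (hcap b hb).le
    · exact (hne b hb).1.le
  · rw [(heq e rfl).1]; exact hcap e rfl
  · by_cases hb : b.1 = e.1
    · rw [(heq b hb).2]; exact (hcom b hb).le
    · exact (hne b hb).2.le
  · rw [(heq e rfl).2]; exact hcom e rfl

/-- The letters e and e⁻¹ define the same cut up to translation and complement, so capacities and
complexities depend on the underlying generator only. -/
theorem smul_star_inv (Φ : MulAut (FreeGroup α)) (e : α × Bool) :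
    Φ • star {invLetter e} = Φ (FreeGroup.mk [invLetter e]) • (Φ • star {e})ᶜ := by
  rw [← Set.smul_set_compl, star_compl_eq_smul, aut_smul_translation_smul_set, smul_smul,
    ← mk_singleton_inv, map_inv, inv_mul_cancel, one_smul]

theorem capacity_smul_star_of_fst_eq [Nonempty α] (Φ : MulAut (FreeGroup α)) {b e : α × Bool}
    (h : b.1 = e.1) : capacity (Φ • star {b}) = capacity (Φ • star {e}) := by
  rcases eq_or_eq_invLetter h with rfl | rfl
  · rfl
  · rw [smul_star_inv, capacity_smul _ ((finitelyDetermined_star _).smul Φ).compl, capacity_compl]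

theorem cutComplexity_smul_star_of_fst_eq [Nonempty α] (Φ : MulAut (FreeGroup α)) {b e : α × Bool}
    (h : b.1 = e.1) : cutComplexity (Φ • star {b}) = cutComplexity (Φ • star {e}) := by
  rcases eq_or_eq_invLetter h with rfl | rfl
  · rfl
  · rw [smul_star_inv, cutComplexity_smul _ ((finitelyDetermined_star _).smul Φ).compl,
      cutComplexity_compl]

/-- If an automorphism maps some edge to a cut which crosses an edge, then it can be shortened. -/
theorem exists_shortening_of_crosses [Nonempty α] (Φ : MulAut (FreeGroup α))
    {D E : Set (Boundary α)} (hD : D ∈ edgeCuts α) (hE : E ∈ edgeCuts α)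
    (h : Crosses (Φ • D) E) :
    ∃ ψ : MulAut (FreeGroup α), IsWhiteheadSecondKind ψ ∧
      autLength (ψ⁻¹ * Φ) < autLength Φ ∧ autComplexity (ψ⁻¹ * Φ) < autComplexity Φ := by
  obtain ⟨g, e, hcr, hun⟩ := h.exists_leaf
    ((finitelyDetermined_of_mem_edgeCuts hD).smul Φ) hE
  -- The translation to the leaf is absorbed into D through Φ, and D is replaced by its complement
  -- if necessary to put e⁻¹ on its side.
  obtain ⟨D, hD, hcr, hun, hinv⟩ : ∃ D ∈ edgeCuts α, Crosses (Φ • D) (star {e}) ∧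
      (∀ b ≠ e, star {b} ⊆ Φ • D ∨ star {b} ⊆ (Φ • D)ᶜ) ∧ star {invLetter e} ⊆ Φ • D := by
    have hg : g • Φ • D = Φ • (Φ⁻¹ g) • D := by
      rw [aut_smul_translation_smul_set, MulAut.apply_inv_self]
    rw [hg] at hcr hun
    have hD' := smul_mem_edgeCuts (Φ⁻¹ g) hD
    rcases hun _ (invLetter_ne e) with h | h
    · exact ⟨_, hD', hcr, hun, h⟩
    · rw [← Set.smul_set_compl] at h
      refine ⟨_, compl_mem_edgeCuts hD', ?_, fun b hb => ?_, h⟩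
      · rw [Set.smul_set_compl]
        exact hcr.compl_left
      · rw [Set.smul_set_compl, compl_compl]
        exact (hun b hb).symm
  -- Each direction other than e lies on one side of Φ • D, so this corner is the pullback of a set
  -- of letters.
  have hV : Φ⁻¹ • star {b | b ≠ e ∧ star {b} ⊆ Φ • D} = (Φ⁻¹ • star {e})ᶜ ∩ D := by
    rw [← Set.smul_set_compl, inv_smul_eq_iff, Set.smul_set_inter, smul_inv_smul]
    ext x
    rw [mem_star, Set.mem_ofPred_eq, Set.mem_inter_iff]
    refine and_congr_right fun hx => ⟨fun h => h rfl, fun h => (hun _ hx).resolve_right fun h' => ?_⟩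
    exact h' rfl h
  have hcr' : Crosses (Φ⁻¹ • star {e})ᶜ D := by
    rw [crosses_compl_left, crosses_smul_left, inv_inv]
    exact hcr.symm
  have hf : FinitelyDetermined (Φ⁻¹ • star {e})ᶜ := ((finitelyDetermined_star _).smul _).compl
  have hcap := hcr'.capacity_inter_lt hf hD
  have hcross := crossingNumber_inter_lt hf hD hcr'
  -- The corner costs at least one edge and less than the cut of e. The latter is therefore not
  -- minimal and carries the extra 1 in its complexity.
  have hmin := edgeCapacity_le_capacity (hf.inter (finitelyDetermined_of_mem_edgeCuts hD)) hcr'.1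
    (hcr'.2.1.mono fun x hx hx' => hx.2 hx'.2)
  -- The set contains e⁻¹ and not e, so e⁻¹ plays the role of the separated letter.
  refine exists_shortening_of_cut Φ (e := invLetter e) (R := {b | b ≠ e ∧ star {b} ⊆ Φ • D})
    ⟨invLetter_ne e, hinv⟩ (fun h => h.1 (invLetter_invLetter e)) (fun b hb => ?_) fun b hb => ?_
  · rw [hV, capacity_smul_star_of_fst_eq Φ⁻¹ (show b.1 = e.1 from hb), ← capacity_compl (Φ⁻¹ • _)]
    exact hcap
  · rw [hV, cutComplexity_smul_star_of_fst_eq Φ⁻¹ (show b.1 = e.1 from hb),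
      ← cutComplexity_compl (Φ⁻¹ • _), cutComplexity, cutComplexity,
      if_neg (hmin.trans_lt hcap).ne']
    split_ifs <;> omega

theorem signedCount_star_finset (e : α × Bool) (Φ : MulAut (FreeGroup α)) (S : Finset (α × Bool)) :
    signedCount e (Φ • star (S : Set (α × Bool))) = ∑ b ∈ S, signedCount e (Φ • star {b}) := by
  induction S using Finset.induction_on with
  | empty =>
    rw [Finset.coe_empty, show star (∅ : Set (α × Bool)) = ∅ from rfl, Set.smul_set_empty,
      signedCount_empty, Finset.sum_empty]
  | insert b S hb ih =>
    rw [Finset.coe_insert, star_insert, Set.smul_set_union, signedCount_union e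
      ((finitelyDetermined_star _).smul Φ) ((finitelyDetermined_star _).smul Φ)
      (Set.disjoint_smul_set.2 (disjoint_star (by simpa using hb))), ih, Finset.sum_insert hb]

/-- If the image of the edge with label `c` is the cut given by a set `S` of edges at a vertex and
not itself an edge, then `S` separates some letter `e` from its inverse for which the preimage of
the edge with label `e` is not an edge. -/
theorem exists_separated_letter [Nonempty α] (Φ : MulAut (FreeGroup α))
    (hcr : ∀ D ∈ edgeCuts α, ∀ E ∈ edgeCuts α, ¬ Crosses (Φ • D) E) {c : α × Bool}
    (hc : capacity (Φ • star {c}) ≠ edgeCapacity α) {g : FreeGroup α} {S : Set (α × Bool)}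
    (hS : Φ • star {c} = g • star S) :
    ∃ e ∈ S, invLetter e ∉ S ∧ capacity (Φ⁻¹ • star {e}) ≠ edgeCapacity α := by
  classical
  by_contra! hne
  have hf : ∀ b : α × Bool, FinitelyDetermined (Φ⁻¹ • star {b}) := fun b =>
    (finitelyDetermined_star _).smul _
  -- By the negated claim, the preimage of a separated letter of S has minimal capacity, so it is an
  -- edge; its label c' differs from c and c⁻¹.
  have hzero : ∀ b ∈ S, invLetter b ∉ S → signedCount c (Φ⁻¹ • star {b}) = 0 := by
    intro b hb hb'
    have hedge : Φ⁻¹ • star {b} ∈ edgeCuts α := by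
      refine (edgeCapacity_le_capacity_of_not_crosses (hf b)
        (star_singleton_nonempty b).smul_set ?_ fun E hE h => ?_).2 (hne b hb hb')
      · rw [← Set.smul_set_compl]
        exact (star_singleton_compl_nonempty b).smul_set
      · rw [crosses_smul_left, inv_inv] at h
        exact hcr E hE _ (star_mem_edgeCuts b) h.symm
    obtain ⟨u, c', hu⟩ := hedge
    rw [hu, signedCount_smul c u (finitelyDetermined_star _), signedCount_star_singleton]
    -- Otherwise Φ • `star {c}` would have the capacity of Φ • `star {c'}`, which is a translate of
    -- the edge `star {b}`.
    have hcc : c'.1 ≠ c.1 := by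
      intro hcc
      apply hc
      rw [← capacity_smul_star_of_fst_eq Φ hcc, ← capacity_smul (Φ u)
        ((finitelyDetermined_star _).smul Φ), ← aut_smul_translation_smul_set, ← hu, smul_inv_smul]
      exact capacity_of_mem_edgeCuts (star_mem_edgeCuts b)
    have h1 : c' ≠ c := by rintro rfl; exact hcc rfl
    have h2 : c' ≠ invLetter c := by rintro rfl; exact hcc rfl
    simp [letterSign, h1, h2]
  -- Separated letters contribute 0, and the remaining ones come in pairs b, b⁻¹ with opposite
  -- counts.
  have hsum : signedCount c (Φ⁻¹ • star ((S.toFinset : Finset (α × Bool)) : Set (α × Bool))) = 0 := by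
    rw [signedCount_star_finset]
    have hfil : ∑ b ∈ S.toFinset, signedCount c (Φ⁻¹ • star {b}) =
        ∑ b ∈ S.toFinset with invLetter b ∈ S, signedCount c (Φ⁻¹ • star {b}) := by
      rw [Finset.sum_filter]
      refine Finset.sum_congr rfl fun b hb => ?_
      split_ifs with h
      · rfl
      · exact hzero b (Set.mem_toFinset.1 hb) h
    rw [hfil]
    refine Finset.sum_involution (fun b _ => invLetter b) (fun b _ => ?_)
      (fun b _ _ => invLetter_ne b) (fun b hb => ?_) (fun b _ => invLetter_invLetter b)
    · rw [smul_star_inv, signedCount_smul c _ (hf b).compl]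
      exact signedCount_add_compl c (hf b)
    · simp only [Finset.mem_filter, Set.mem_toFinset, invLetter_invLetter] at hb ⊢
      exact hb.symm
  -- On the other hand, this set is a translate of `star {c}`, an edge with label c.
  have hone : signedCount c (Φ⁻¹ • star S) = 1 := by
    have : Φ⁻¹ • star S = (Φ⁻¹ g⁻¹) • star {c} := by
      rw [inv_smul_eq_iff, aut_smul_translation_smul_set, MulAut.apply_inv_self, hS, inv_smul_smul]
    rw [this, signedCount_smul c _ (finitelyDetermined_star _), signedCount_star_singleton]
    simp [letterSign]
  rw [Set.coe_toFinset, hone] at hsum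
  exact one_ne_zero hsum

/-- If an automorphism maps some edge to a cut which crosses no edge and is not an edge itself,
then it can be shortened. -/
theorem exists_shortening_of_not_crosses [Nonempty α] (Φ : MulAut (FreeGroup α))
    (hcr : ∀ D ∈ edgeCuts α, ∀ E ∈ edgeCuts α, ¬ Crosses (Φ • D) E) {c : α × Bool}
    (hc : capacity (Φ • star {c}) ≠ edgeCapacity α) :
    ∃ ψ : MulAut (FreeGroup α), IsWhiteheadSecondKind ψ ∧
      autLength (ψ⁻¹ * Φ) < autLength Φ ∧ autComplexity (ψ⁻¹ * Φ) < autComplexity Φ := by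
  have hf : ∀ b : α × Bool, FinitelyDetermined (Φ⁻¹ • star {b}) := fun b =>
    (finitelyDetermined_star _).smul _
  obtain ⟨g, S, hS⟩ := exists_eq_smul_star ((finitelyDetermined_star {c}).smul Φ)
    (star_singleton_nonempty c).smul_set
    (by rw [← Set.smul_set_compl]; exact (star_singleton_compl_nonempty c).smul_set)
    (hcr _ (star_mem_edgeCuts c))
  obtain ⟨e, he, he', hcap⟩ := exists_separated_letter Φ hcr hc hS
  -- Pulled back by Φ, the cut of S becomes a translate of `star {c}`; it has the least capacity and
  -- complexity 0.
  have hV : Φ⁻¹ • star S ∈ edgeCuts α := by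
    refine ⟨Φ⁻¹ g⁻¹, c, ?_⟩
    rw [inv_smul_eq_iff, aut_smul_translation_smul_set, MulAut.apply_inv_self, hS, inv_smul_smul]
  have hmin := edgeCapacity_le_capacity (hf e) (star_singleton_nonempty e).smul_set
    (by rw [← Set.smul_set_compl]; exact (star_singleton_compl_nonempty e).smul_set)
  refine exists_shortening_of_cut Φ he he' (fun b hb => ?_) fun b hb => ?_
  · rw [capacity_of_mem_edgeCuts hV, capacity_smul_star_of_fst_eq Φ⁻¹ hb]
    exact hmin.lt_of_ne hcap.symm
  · rw [cutComplexity_eq_zero_of_mem_edgeCuts hV, cutComplexity_smul_star_of_fst_eq Φ⁻¹ hb,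
      cutComplexity, if_neg hcap]
    omega

/-- A non-simple automorphism can be shortened by a Whitehead automorphism. -/
theorem exists_shortening [Nontrivial α] {Φ : MulAut (FreeGroup α)} (h : ¬ IsSimpleAut Φ) :
    ∃ ψ : MulAut (FreeGroup α), IsWhiteheadSecondKind ψ ∧
      autLength (ψ⁻¹ * Φ) < autLength Φ ∧ autComplexity (ψ⁻¹ * Φ) < autComplexity Φ := by
  by_cases hcr : ∀ D ∈ edgeCuts α, ∀ E ∈ edgeCuts α, ¬ Crosses (Φ • D) E
  · by_cases hcap : ∀ c : α × Bool, capacity (Φ • star {c}) = edgeCapacity α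
    -- Uncrossed cuts of minimal capacity are edges, and an automorphism that sends the edges at 1
    -- to edges is simple.
    · refine absurd (isSimpleAut_of_forall_mem_edgeCuts fun c => ?_) h
      refine (edgeCapacity_le_capacity_of_not_crosses ((finitelyDetermined_star {c}).smul Φ)
        (star_singleton_nonempty c).smul_set ?_ (hcr _ (star_mem_edgeCuts c))).2 (hcap c)
      rw [← Set.smul_set_compl]
      exact (star_singleton_compl_nonempty c).smul_set
    · push Not at hcap
      obtain ⟨c, hc⟩ := hcap
      exact exists_shortening_of_not_crosses Φ hcr hc
  · push Not at hcr
    obtain ⟨D, hD, E, hE, h⟩ := hcr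
    exact exists_shortening_of_crosses Φ hD hE h

theorem partialProduct_congr {G : Type*} [Mul G] {τ τ' : ℕ → G} (σ : G) {n : ℕ}
    (h : ∀ i, 1 ≤ i → i ≤ n → τ i = τ' i) : partialProduct τ σ n = partialProduct τ' σ n := by
  induction n with
  | zero => rfl
  | succ n ih =>
    rw [partialProduct, partialProduct, h (n + 1) (by omega) le_rfl,
      ih fun i h1 h2 => h i h1 (by omega)]

end Reduction

end FreeGroupLength

/-! ### The factorisation, by induction on the complexity. -/

theorem theorem1p3 {α : Type*} [DecidableEq α] [Fintype α] (Φ : MulAut (FreeGroup α))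
    (hΦ : ¬ FreeGroupLength.IsSimpleAut Φ) :
    ∃ (n : ℕ) (τ : ℕ → MulAut (FreeGroup α)) (σ : MulAut (FreeGroup α)),
      1 ≤ n ∧
      FreeGroupLength.IsSimpleAut σ ∧
      (∀ i, 1 ≤ i → i ≤ n → FreeGroupLength.IsWhiteheadSecondKind (τ i)) ∧
      Φ = FreeGroupLength.partialProduct τ σ n ∧
      ∀ i, 1 ≤ i → i ≤ n →
        FreeGroupLength.autLength (FreeGroupLength.partialProduct τ σ (i - 1)) <
          FreeGroupLength.autLength (FreeGroupLength.partialProduct τ σ i) := by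
  rcases subsingleton_or_nontrivial α with hα | hα
  · exact absurd (FreeGroupLength.isSimpleAut_of_subsingleton Φ) hΦ
  induction hN : FreeGroupLength.autComplexity Φ using Nat.strong_induction_on generalizing Φ with
  | _ N ih =>
    obtain ⟨ψ, hψ, hlen, hcom⟩ := FreeGroupLength.exists_shortening hΦ
    -- Here n = 0 is allowed, to cover the case in which ψ⁻¹Φ is already simple.
    obtain ⟨n, τ, σ, hσ, hτ, he, hlt⟩ : ∃ (n : ℕ) (τ : ℕ → MulAut (FreeGroup α))
        (σ : MulAut (FreeGroup α)), FreeGroupLength.IsSimpleAut σ ∧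
        (∀ i, 1 ≤ i → i ≤ n → FreeGroupLength.IsWhiteheadSecondKind (τ i)) ∧
        ψ⁻¹ * Φ = FreeGroupLength.partialProduct τ σ n ∧
        ∀ i, 1 ≤ i → i ≤ n →
          FreeGroupLength.autLength (FreeGroupLength.partialProduct τ σ (i - 1)) <
            FreeGroupLength.autLength (FreeGroupLength.partialProduct τ σ i) := by
      by_cases hs : FreeGroupLength.IsSimpleAut (ψ⁻¹ * Φ)
      · exact ⟨0, fun _ => 1, _, hs, fun i h1 h2 => by omega, rfl, fun i h1 h2 => by omega⟩
      · obtain ⟨n, τ, σ, -, h⟩ := ih _ (hN ▸ hcom) _ hs rfl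
        exact ⟨n, τ, σ, h⟩
    -- Placing ψ at the index n + 1 leaves the earlier partial products unchanged.
    have hagree : ∀ i ≤ n, FreeGroupLength.partialProduct (Function.update τ (n + 1) ψ) σ i =
        FreeGroupLength.partialProduct τ σ i := fun i hi =>
      FreeGroupLength.partialProduct_congr σ fun j _ hj =>
        Function.update_of_ne (by omega) _ _
    have hlast : FreeGroupLength.partialProduct (Function.update τ (n + 1) ψ) σ (n + 1) = Φ := by
      rw [FreeGroupLength.partialProduct, hagree n le_rfl, ← he, Function.update_self,
        mul_inv_cancel_left]
    refine ⟨n + 1, Function.update τ (n + 1) ψ, σ, by omega, hσ, fun i h1 h2 => ?_, hlast.symm,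
      fun i h1 h2 => ?_⟩
    · rcases Nat.lt_or_ge n i with h | h
      · rw [show i = n + 1 by omega, Function.update_self]
        exact hψ
      · rw [Function.update_of_ne (by omega)]
        exact hτ i h1 h
    · rcases Nat.lt_or_ge n i with h | h
      · obtain rfl : i = n + 1 := by omega
        rw [hlast, Nat.add_sub_cancel, hagree n le_rfl, ← he]
        exact hlen
      · rw [hagree i h, hagree (i - 1) (by omega)]
        exact hlt i h1 h
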